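/- Let $\phi:\mathbb C\to[-\infty,\infty)$ be a nonharmonic subharmonic function (upper semicontinuous, not identically $-\infty$, satisfying the sub-mean value inequality on every circle) whose distributional Laplacian $\mu=\Delta\phi$ (with $\Delta=\partial_x^2+\partial_y^2$) is a doubling measure: there is $C>0$ with $\mu(D(z,2r))\le C\,\mu(D(z,r))$ for all $z\in\mathbb C$ and $r>0$. Here $\mu$ is a nonzero Borel measure, finite on compact sets. For $z\in\mathbb C$ let $\rho(z)>0$ be the radius with $\mu(D(z,\rho(z)))=1$, and let $$d_\phi(z,w)=\inf_\gamma\int_0^1\frac{|\gamma'(t)|}{\rho(\gamma(t))}\,dt ,$$ where the infimum is over all piecewise $\mathcal C^1$ curves $\gamma:[0,1]\to\mathbb C$ with $\gamma(0)=z$ and $\gamma(1)=w$; for a set $A\subset\mathbb C$ put $d_\phi(z,A)=\inf_{a\in A}d_\phi(z,a)$. Then for every $z_0\in\mathbb C$ there is an entire function $g$, with zero set $\mathcal Z(g)=\{z\in\mathbb C: g(z)=0\}$, such that (a) $\mathcal Z(g)$ is $\rho$-separated, i.e. there is $\delta>0$ such that $|\lambda-\lambda'|\ge\delta\max(\rho(\lambda),\rho(\lambda'))$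 for all distinct $\lambda,\lambda'\in\mathcal Z(g)$, and $\sup_{z\in\mathbb C}d_\phi(z,\mathcal Z(g))<\infty$; (b) $|g(z)|\simeq e^{\phi(z)}\,d_\phi(z,\mathcal Z(g))$, i.e. there is a constant $K>0$ such that for all $z\in\mathbb C$ $$K^{-1}e^{\phi(z)}d_\phi(z,\mathcal Z(g))\le|g(z)|\le K\,e^{\phi(z)}d_\phi(z,\mathcal Z(g));$$ (c) $g(z_0)=0$. -/

import Mathlib

open MeasureTheory Metric Set
open scoped ENNReal NNReal

noncomputable section

namespace FockMultiplier

/-- The mean of an extended-real function over the circle of centre `c` and radius `r`, as the mean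
of the positive part minus the mean of the negative part.  It is used for functions that are bounded
above on circles, so that the mean of the positive part is finite and the value lies in `[-∞, ∞)`. -/
def circleMean (φ : ℂ → EReal) (c : ℂ) (r : ℝ) : EReal :=
  ((⨍⁻ θ in Ioc 0 (2 * Real.pi), (φ (circleMap c r θ)).toENNReal ∂volume : ℝ≥0∞) : EReal)
    - ((⨍⁻ θ in Ioc 0 (2 * Real.pi), (-φ (circleMap c r θ)).toENNReal ∂volume : ℝ≥0∞) : EReal)

/-- Subharmonic functions `ℂ → [-∞, ∞)`: upper semicontinuous, not identically `-∞`, and satisfying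
the sub-mean value inequality on every circle. -/
structure IsSubharmonic (φ : ℂ → EReal) : Prop where
  ne_top : ∀ z, φ z ≠ ⊤
  exists_ne_bot : ∃ z, φ z ≠ ⊥
  upperSemicontinuous : UpperSemicontinuous φ
  le_circleMean : ∀ (c : ℂ) (r : ℝ), 0 < r → φ c ≤ circleMean φ c r

/-- `Δφ = μ` in the sense of distributions, where `φ` is a locally integrable extended-real
function, `Δ = ∂²/∂x² + ∂²/∂y²`, and `μ` is a Borel measure that is finite on compact sets. -/
structure HasDistribLaplacian (φ : ℂ → EReal) (μ : Measure ℂ) : Prop where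
  ae_finite : ∀ᵐ z, φ z ≠ ⊤ ∧ φ z ≠ ⊥
  locallyIntegrable : LocallyIntegrable (fun z => (φ z).toReal)
  isLocallyFiniteMeasure : IsLocallyFiniteMeasure μ
  integral_laplacian : ∀ f : ℂ → ℝ, ContDiff ℝ (⊤ : ℕ∞) f → HasCompactSupport f →
    ∫ z, (φ z).toReal * Laplacian.laplacian f z = ∫ z, f z ∂μ

/-- Doubling measures: `μ(D(z, 2r)) ≤ C μ(D(z, r))` for all `z` and all `r > 0`. -/
def IsDoubling (μ : Measure ℂ) : Prop :=
  ∃ C : ℝ≥0, ∀ (z : ℂ) (r : ℝ), 0 < r → μ (ball z (2 * r)) ≤ C * μ (ball z r)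

/-- The radius `ρ(z) > 0` with `μ(D(z, ρ(z))) = 1`.  For a nonzero, locally finite doubling measure
there is exactly one such radius, so the infimum is over a one-point set. -/
def rho (μ : Measure ℂ) (z : ℂ) : ℝ :=
  sInf {r : ℝ | 0 < r ∧ μ (ball z r) = 1}

/-- Piecewise `C¹` curves parametrised by `[0, 1]`: there is a subdivision
`0 = t₀ < t₁ < ⋯ < tₙ = 1` such that `γ` is `C¹` on each closed interval `[tᵢ, tᵢ₊₁]`. -/
def IsPiecewiseC1 (γ : ℝ → ℂ) : Prop :=
  ∃ (n : ℕ) (t : Fin (n + 1) → ℝ), StrictMono t ∧ t 0 = 0 ∧ t (Fin.last n) = 1 ∧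
    ∀ i : Fin n, ContDiffOn ℝ 1 γ (Icc (t i.castSucc) (t i.succ))

/-- The length `∫₀¹ |γ'(t)| / ρ(γ(t)) dt` of a curve in the metric `ρ⁻²(z) dz ⊗ dz̄`. -/
def rhoLength (μ : Measure ℂ) (γ : ℝ → ℂ) : ℝ≥0∞ :=
  ∫⁻ t in Icc (0 : ℝ) 1, ‖deriv γ t‖ₑ / ENNReal.ofReal (rho μ (γ t))

/-- The distance `d_φ` (for `μ = Δφ`): the infimum of the lengths of the piecewise `C¹` curves from
`z` to `w`. -/
def rhoDist (μ : Measure ℂ) (z w : ℂ) : ℝ≥0∞ :=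
  ⨅ (γ : ℝ → ℂ) (_ : IsPiecewiseC1 γ ∧ γ 0 = z ∧ γ 1 = w), rhoLength μ γ

/-- The distance `d_φ(z, A)` from a point to a set (it is `∞` for the empty set). -/
def rhoInfDist (μ : Measure ℂ) (z : ℂ) (A : Set ℂ) : ℝ≥0∞ :=
  ⨅ a ∈ A, rhoDist μ z a

/-- `ρ`-separated sets: `|a - b| ≥ δ max(ρ(a), ρ(b))` for some `δ > 0` and all distinct `a`, `b`. -/
def IsRhoSeparated (μ : Measure ℂ) (A : Set ℂ) : Prop :=
  ∃ δ : ℝ, 0 < δ ∧ ∀ a ∈ A, ∀ b ∈ A, a ≠ b → δ * max (rho μ a) (rho μ b) ≤ ‖a - b‖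

end FockMultiplier

end

/-!
# An entire function with modulus comparable to `exp φ` times the distance to its zeros

The zeros of `g` are obtained by discretizing `μ`. By `DoublingBounds.exists_decomposition`, `μ`
is a sum of pieces `ν k` of mass exactly `6π`, each located at a point `c k` at the scale
`rho μ (c k)`: the plane is cut into cells at that scale, and every cell passes the remainder of
its mass modulo `6π` to a nearby cell farther from the origin, before it is split into equal
parts. Each piece is replaced by three points `x k i`, the roots of a cubic, with the same mass,
first and second moments as `ν k / 2π`. These conditions leave one coefficient of the cubic free,
and it is used to keep the points separated from each other (`DoublingBounds.exists_pieces`). The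
piece `k = 0` is exempted from the moment conditions, so that `z₀` can be one of its points.

The difference `u k` of the logarithmic potentials of the three points and of `ν k / 2π` is, up to
a bounded term, `∑ i, log (min 1 (|z - x k i| / rho μ (c k)))` near `c k`, and it decays like the
cube of `rho μ (c k) / |z - c k|` away from `c k`, by the agreement of the moments
(`DoublingBounds.exists_abs_potentialDiff_sub_le`). These cubes have a bounded sum
(`DoublingBounds.exists_tsum_decay_le`), since doubling makes `rho` grow by less than a linear
function. Hence `U = ∑ u k` converges, with distributional Laplacian `2π ∑ δ_{x k i} - μ`, and
`φ + U` has the distributional Laplacian `2π ∑ δ_{x k i}`. By Weyl's lemma (`weyl`) it is, on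
every disc, almost everywhere equal to the logarithm of the modulus of a holomorphic function with
zeros at the points `x k i`. Such functions on larger and larger discs differ by unimodular
constants, so that they can be glued to one entire function `g` with `|g| = exp (φ + U)` almost
everywhere (`DoublingBounds.exists_entire`).

By separation and density of the points, `exp U` is comparable to the Euclidean distance to the
points divided by `rho` (`DoublingBounds.exists_exp_potentialSum_comparable`), which in turn is
comparable to the distance to the points in the metric `rhoDist`
(`DoublingBounds.exists_rhoInfDist_comparable`). This proves the two bounds for `|g|` almost
everywhere. Upper semicontinuity of `φ` extends the upper bound to every point, and the sub-mean
value inequality on small circles extends the lower bound (`IsSubharmonic.norm_le_of_ae_le`,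
`IsSubharmonic.exp_mul_le_of_ae_le`).
-/


noncomputable section
namespace FockMultiplier
open Filter Topology

/-! ### Doubling measures in the plane -/

section Doubling
variable {μ : Measure ℂ} {C : ℝ≥0}

theorem measure_ball_two_pow_le
    (hC : ∀ (z : ℂ) (r : ℝ), 0 < r → μ (ball z (2 * r)) ≤ C * μ (ball z r))
    (z : ℂ) {r : ℝ} (hr : 0 < r) (n : ℕ) :
    μ (ball z (2 ^ n * r)) ≤ (C : ℝ≥0∞) ^ n * μ (ball z r) := by
  induction n with
  | zero => simp
  | succ n ih =>
    calc μ (ball z (2 ^ (n + 1) * r)) = μ (ball z (2 * (2 ^ n * r))) := by ring_nf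
      _ ≤ C * μ (ball z (2 ^ n * r)) := hC _ _ (by positivity)
      _ ≤ C * ((C : ℝ≥0∞) ^ n * μ (ball z r)) := by gcongr
      _ = _ := by ring

theorem measure_ball_pos_of_doubling (hμ0 : μ ≠ 0)
    (hC : ∀ (z : ℂ) (r : ℝ), 0 < r → μ (ball z (2 * r)) ≤ C * μ (ball z r))
    (z : ℂ) {r : ℝ} (hr : 0 < r) : 0 < μ (ball z r) := by
  rw [pos_iff_ne_zero]
  intro h
  apply hμ0
  rw [← Measure.measure_univ_eq_zero]
  have hU : (univ : Set ℂ) = ⋃ n : ℕ, ball z (2 ^ n * r) := by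
    symm
    rw [eq_univ_iff_forall]
    intro w
    obtain ⟨n, hn⟩ := pow_unbounded_of_one_lt (dist w z / r) (one_lt_two)
    refine mem_iUnion.2 ⟨n, ?_⟩
    rw [mem_ball]
    rwa [div_lt_iff₀ hr] at hn
  rw [hU, measure_iUnion_null_iff]
  intro n
  have := measure_ball_two_pow_le hC z hr n
  rw [h, mul_zero] at this
  exact le_antisymm this bot_le

theorem measure_ball_ne_top [IsLocallyFiniteMeasure μ] (z : ℂ) (r : ℝ) : μ (ball z r) ≠ ⊤ :=
  (measure_ball_lt_top).ne

/-- Spheres are null for a doubling measure: a sphere is porous, so none of its points can be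
a point of density. -/
theorem measure_sphere_eq_zero [IsLocallyFiniteMeasure μ] (hμ0 : μ ≠ 0)
    (hC : ∀ (z : ℂ) (r : ℝ), 0 < r → μ (ball z (2 * r)) ≤ C * μ (ball z r))
    (z : ℂ) {r : ℝ} (hr : 0 < r) : μ (sphere z r) = 0 := by
  have : IsUnifLocDoublingMeasure μ := by
    refine ⟨⟨C ^ 2, ?_⟩⟩
    filter_upwards [self_mem_nhdsWithin] with ε hε x
    have hε : 0 < ε := hε
    calc μ (closedBall x (2 * ε)) ≤ μ (ball x (2 ^ 2 * ε)) :=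
          measure_mono (closedBall_subset_ball (by linarith))
      _ ≤ (C : ℝ≥0∞) ^ 2 * μ (ball x ε) := measure_ball_two_pow_le hC x hε 2
      _ ≤ _ := by
          push_cast
          gcongr
          exact ball_subset_closedBall
  by_contra hne
  have hd := IsUnifLocDoublingMeasure.ae_tendsto_measure_inter_div μ (sphere z r) 1
  rw [ae_restrict_iff' isClosed_sphere.measurableSet] at hd
  have : ∃ x ∈ sphere z r, ∀ {ι : Type} {l : Filter ι} (w : ι → ℂ) (δ : ι → ℝ),
      Tendsto δ l (𝓝[>] 0) → (∀ᶠ (j : ι) in l, x ∈ closedBall (w j) (1 * δ j)) →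
      Tendsto (fun j ↦ μ (sphere z r ∩ closedBall (w j) (δ j)) / μ (closedBall (w j) (δ j)))
      l (𝓝 1) := by
    by_contra hcon
    push Not at hcon
    apply hne
    refine measure_mono_null ?_ (ae_iff.1 hd)
    intro x hx
    simp only [mem_ofPred_eq]
    intro hall
    obtain ⟨ι, l, w, δ, h1, h2, h3⟩ := hcon x hx
    exact h3 (hall hx w δ h1 h2)
  obtain ⟨x, hx, H⟩ := this
  have ht := H (ι := ℝ) (l := 𝓝[>] 0) (fun _ => x) id tendsto_id (by
    filter_upwards [self_mem_nhdsWithin] with ε hε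
    have hε : (0:ℝ) < ε := hε
    simpa using hε.le)
  -- every small ball about `x` contains a comparable ball that misses the sphere
  have hbd : ∀ ε > 0, ε < r → μ (sphere z r ∩ closedBall x ε) / μ (closedBall x ε)
      ≤ 1 - ((C : ℝ≥0∞) ^ 4)⁻¹ := by
    intro ε hε hεr
    set y : ℂ := x + ((ε / (2 * r) : ℝ) : ℂ) * (z - x) with hy
    have hxz : ‖z - x‖ = r := by rw [← dist_eq_norm, dist_comm]; exact hx
    have hyx : dist y x = ε / 2 := by
      rw [hy, dist_eq_norm, add_sub_cancel_left, norm_mul, hxz, Complex.norm_real,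
        Real.norm_of_nonneg (by positivity)]
      field_simp
    have hyz : dist y z = r - ε / 2 := by
      have : y - z = ((1 - ε / (2 * r) : ℝ) : ℂ) * (x - z) := by rw [hy]; push_cast; ring
      rw [dist_eq_norm, this, norm_mul, norm_sub_rev, hxz, Complex.norm_real,
        Real.norm_of_nonneg]
      · field_simp
      · rw [sub_nonneg, div_le_one (by positivity)]; linarith
    have hsub : ball y (ε / 4) ⊆ closedBall x ε \ sphere z r := by
      intro w hw
      rw [mem_ball] at hw
      refine ⟨?_, ?_⟩
      · rw [mem_closedBall]
        linarith [dist_triangle w y x]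
      · intro hws
        rw [mem_sphere] at hws
        linarith [dist_triangle w y z]
    have hbig : closedBall x ε ⊆ ball y (2 ^ 4 * (ε / 4)) := by
      intro w hw
      rw [mem_closedBall] at hw
      rw [mem_ball]
      have := dist_triangle w x y
      rw [dist_comm x y] at this
      linarith
    have h1 : μ (closedBall x ε) ≤ (C : ℝ≥0∞) ^ 4 * μ (ball y (ε / 4)) :=
      (measure_mono hbig).trans (measure_ball_two_pow_le hC y (by positivity) 4)
    have hpos : 0 < μ (closedBall x ε) :=
      (measure_ball_pos_of_doubling hμ0 hC x hε).trans_le (measure_mono ball_subset_closedBall)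
    have hfin : μ (closedBall x ε) ≠ ⊤ := measure_closedBall_lt_top.ne
    have h2 : ((C : ℝ≥0∞) ^ 4)⁻¹ * μ (closedBall x ε) ≤ μ (ball y (ε / 4)) := by
      rw [mul_comm, ← div_eq_mul_inv]
      exact ENNReal.div_le_of_le_mul' h1
    have h3 : μ (sphere z r ∩ closedBall x ε) + μ (ball y (ε / 4)) ≤ μ (closedBall x ε) := by
      rw [← measure_union _ isOpen_ball.measurableSet]
      · apply measure_mono
        rintro w (hw | hw)
        · exact hw.2
        · exact (hsub hw).1
      · rw [Set.disjoint_left]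
        intro w hw hw2
        exact (hsub hw2).2 hw.1
    rw [ENNReal.div_le_iff hpos.ne' hfin, ENNReal.sub_mul (fun _ _ => hfin), one_mul]
    apply ENNReal.le_sub_of_add_le_right
    · exact ne_top_of_le_ne_top (measure_ball_ne_top (μ := μ) y (ε / 4)) h2
    · exact (add_le_add le_rfl h2).trans h3
  have : (1 : ℝ≥0∞) ≤ 1 - ((C : ℝ≥0∞) ^ 4)⁻¹ := by
    refine le_of_tendsto ht ?_
    have : ∀ᶠ ε : ℝ in 𝓝[>] 0, ε < r := nhdsWithin_le_nhds (Iio_mem_nhds hr)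
    filter_upwards [self_mem_nhdsWithin, this] with ε hε hεr
    exact hbd ε hε hεr
  have h4 : 1 - ((C : ℝ≥0∞) ^ 4)⁻¹ < 1 := by
    apply ENNReal.sub_lt_self ENNReal.one_ne_top one_ne_zero
    rw [Ne, ENNReal.inv_eq_zero]
    exact ENNReal.pow_ne_top ENNReal.coe_ne_top
  exact absurd this (not_le.2 h4)

/-- Reverse doubling: `ball z (4 r)` contains a ball of comparable mass disjoint from
`ball z r`. -/
theorem reverse_doubling
    (hC : ∀ (z : ℂ) (r : ℝ), 0 < r → μ (ball z (2 * r)) ≤ C * μ (ball z r))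
    (z : ℂ) {r : ℝ} (hr : 0 < r) :
    (1 + ((C : ℝ≥0∞) ^ 2)⁻¹) * μ (ball z r) ≤ μ (ball z (4 * r)) := by
  have hd : dist (z + ((2 * r : ℝ) : ℂ)) z = 2 * r := by
    rw [dist_eq_norm, add_sub_cancel_left, Complex.norm_real, Real.norm_of_nonneg (by positivity)]
  set x : ℂ := z + ((2 * r : ℝ) : ℂ)
  have h1 : μ (ball z r) ≤ (C : ℝ≥0∞) ^ 2 * μ (ball x r) := by
    refine (measure_mono ?_).trans (measure_ball_two_pow_le hC x hr 2)
    intro w hw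
    rw [mem_ball] at *
    have := dist_triangle w z x
    rw [dist_comm z x] at this
    linarith
  have h2 : ((C : ℝ≥0∞) ^ 2)⁻¹ * μ (ball z r) ≤ μ (ball x r) := by
    rw [mul_comm, ← div_eq_mul_inv]
    exact ENNReal.div_le_of_le_mul' h1
  rw [add_mul, one_mul]
  calc _ ≤ μ (ball z r) + μ (ball x r) := by gcongr
    _ = μ (ball z r ∪ ball x r) := by
        rw [measure_union _ isOpen_ball.measurableSet]
        apply ball_disjoint_ball
        rw [dist_comm]; linarith
    _ ≤ _ := by
        apply measure_mono
        rintro w (hw | hw) <;> rw [mem_ball] at *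
        · linarith
        · linarith [dist_triangle w x z]

/-- The qualitative and quantitative content of the doubling hypothesis that is used throughout:
the measure of balls, normalized to real numbers, with upper and lower growth. -/
structure DoublingBounds (μ : Measure ℂ) (C q : ℝ) : Prop where
  one_le : 1 ≤ C
  one_lt : 1 < q
  pos : ∀ (z : ℂ) (r : ℝ), 0 < r → 0 < μ.real (ball z r)
  sphere : ∀ (z : ℂ) (r : ℝ), 0 < r → μ (sphere z r) = 0
  upper : ∀ (z : ℂ) (r : ℝ), 0 < r → μ.real (ball z (2 * r)) ≤ C * μ.real (ball z r)
  lower : ∀ (z : ℂ) (r : ℝ), 0 < r → q * μ.real (ball z r) ≤ μ.real (ball z (4 * r))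

/-- A nonzero locally finite doubling measure charges every disc, does not charge circles, and has
discs whose mass grows at least geometrically under dilation by `4`. -/
theorem IsDoubling.exists_bounds [IsLocallyFiniteMeasure μ] (h : IsDoubling μ) (hμ0 : μ ≠ 0) :
    ∃ C q, DoublingBounds μ C q := by
  obtain ⟨C, hC⟩ := h
  have hp : ∀ (z : ℂ) (r : ℝ), 0 < r → 0 < μ.real (ball z r) := fun z r hr =>
    ENNReal.toReal_pos (measure_ball_pos_of_doubling hμ0 hC z hr).ne' (measure_ball_ne_top z r)
  have hu : ∀ (z : ℂ) (r : ℝ), 0 < r → μ.real (ball z (2 * r)) ≤ C * μ.real (ball z r) := by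
    intro z r hr
    have := ENNReal.toReal_mono (ENNReal.mul_ne_top ENNReal.coe_ne_top
      (measure_ball_ne_top z r)) (hC z r hr)
    simpa [Measure.real, ENNReal.toReal_mul] using this
  have hC1 : (1 : ℝ) ≤ C := by
    have h1 := hu 0 1 one_pos
    have h2 : μ.real (ball (0:ℂ) 1) ≤ μ.real (ball 0 (2 * 1)) :=
      measureReal_mono (ball_subset_ball (by norm_num)) (measure_ball_ne_top _ _)
    have h3 := hp 0 1 one_pos
    by_contra hlt
    push Not at hlt
    nlinarith
  refine ⟨C, 1 + ((C : ℝ) ^ 2)⁻¹, hC1, ?_, hp, fun z r hr => measure_sphere_eq_zero hμ0 hC z hr,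
    hu, ?_⟩
  · have : 0 < ((C : ℝ) ^ 2)⁻¹ := by positivity
    linarith
  · intro z r hr
    have := ENNReal.toReal_mono (measure_ball_ne_top z (4 * r)) (reverse_doubling hC z hr)
    have hC0 : (C : ℝ≥0∞) ≠ 0 := by
      simp only [ne_eq, ENNReal.coe_eq_zero]
      rintro rfl
      simp at hC1
      linarith
    rw [ENNReal.toReal_mul, ENNReal.toReal_add ENNReal.one_ne_top
      (ENNReal.inv_ne_top.2 (pow_ne_zero _ hC0))] at this
    simpa [Measure.real] using this

end Doubling

/-! ### The radius function -/

section Rho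
variable {μ : Measure ℂ} {C q : ℝ}

theorem DoublingBounds.upper_pow (B : DoublingBounds μ C q) (z : ℂ) {r : ℝ} (hr : 0 < r) (n : ℕ) :
    μ.real (ball z (2 ^ n * r)) ≤ C ^ n * μ.real (ball z r) := by
  have := B.one_le
  induction n with
  | zero => simp
  | succ n ih =>
    calc μ.real (ball z (2 ^ (n + 1) * r)) = μ.real (ball z (2 * (2 ^ n * r))) := by ring_nf
      _ ≤ C * μ.real (ball z (2 ^ n * r)) := B.upper _ _ (by positivity)
      _ ≤ C * (C ^ n * μ.real (ball z r)) := by gcongr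
      _ = _ := by ring

theorem DoublingBounds.lower_pow (B : DoublingBounds μ C q) (z : ℂ) {r : ℝ} (hr : 0 < r) (n : ℕ) :
    q ^ n * μ.real (ball z r) ≤ μ.real (ball z (4 ^ n * r)) := by
  have := B.one_lt
  induction n with
  | zero => simp
  | succ n ih =>
    calc q ^ (n + 1) * μ.real (ball z r) = q * (q ^ n * μ.real (ball z r)) := by ring
      _ ≤ q * μ.real (ball z (4 ^ n * r)) := by gcongr
      _ ≤ μ.real (ball z (4 * (4 ^ n * r))) := B.lower _ _ (by positivity)
      _ = _ := by ring_nf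

/-- Doubling bounds are unaffected by multiplying the measure by a positive constant. -/
theorem DoublingBounds.smul (B : DoublingBounds μ C q) {a : ℝ≥0} (ha : 0 < a) :
    DoublingBounds (a • μ) C q := by
  have e : ∀ s : Set ℂ, (a • μ).real s = a * μ.real s := fun s => measureReal_nnreal_smul_apply a
  refine ⟨B.one_le, B.one_lt, fun z r hr => ?_, fun z r hr => ?_, fun z r hr => ?_,
    fun z r hr => ?_⟩
  · rw [e]; exact mul_pos ha (B.pos z r hr)
  · simp [B.sphere z r hr]
  · rw [e, e]
    have := B.upper z r hr
    have ha' : (0:ℝ) < a := ha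
    nlinarith
  · rw [e, e]
    have := B.lower z r hr
    have ha' : (0:ℝ) < a := ha
    nlinarith

variable [IsLocallyFiniteMeasure μ]

theorem measureReal_ball_mono (z : ℂ) {r s : ℝ} (h : r ≤ s) :
    μ.real (ball z r) ≤ μ.real (ball z s) :=
  measureReal_mono (ball_subset_ball h) (measure_ball_ne_top _ _)

theorem measureReal_ball_le_of_subset {z w : ℂ} {r s : ℝ} (h : dist z w + r ≤ s) :
    μ.real (ball z r) ≤ μ.real (ball w s) :=
  measureReal_mono (ball_subset_ball' (by linarith)) (measure_ball_ne_top _ _)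

/-- The mass of concentric discs is strictly increasing in the radius, since an annulus contains a
disc. -/
theorem DoublingBounds.measureReal_ball_lt (B : DoublingBounds μ C q) (z : ℂ) {r s : ℝ} (hr : 0 < r)
    (h : r < s) : μ.real (ball z r) < μ.real (ball z s) := by
  have hd : dist (z + (((r + s) / 2 : ℝ) : ℂ)) z = (r + s) / 2 := by
    rw [dist_eq_norm, add_sub_cancel_left, Complex.norm_real, Real.norm_of_nonneg (by linarith)]
  set x : ℂ := z + (((r + s) / 2 : ℝ) : ℂ)
  have h1 : μ.real (ball z r) + μ.real (ball x ((s - r) / 2)) ≤ μ.real (ball z s) := by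
    rw [← measureReal_union _ isOpen_ball.measurableSet (measure_ball_ne_top _ _)
      (measure_ball_ne_top _ _)]
    · apply measureReal_mono _ (measure_ball_ne_top _ _)
      rintro w (hw | hw) <;> rw [mem_ball] at *
      · linarith
      · linarith [dist_triangle w x z]
    · apply ball_disjoint_ball
      rw [dist_comm]; linarith
  linarith [B.pos x ((s - r) / 2) (by linarith)]

/-- The defining property of `rho`: it is positive and the ball of radius `rho μ z` about `z` has
mass one. -/
theorem DoublingBounds.rho_spec (B : DoublingBounds μ C q) (z : ℂ) :
    0 < rho μ z ∧ μ.real (ball z (rho μ z)) = 1 := by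
  have hq := B.one_lt
  have hpos1 := B.pos z 1 one_pos
  set S := {r : ℝ | 0 < r ∧ μ.real (ball z r) ≤ 1} with hS
  have hne : S.Nonempty := by
    obtain ⟨n, hn⟩ := pow_unbounded_of_one_lt (μ.real (ball z 1)) hq
    refine ⟨1 / 4 ^ n, by positivity, ?_⟩
    have := B.lower_pow z (r := 1 / 4 ^ n) (by positivity) n
    rw [mul_one_div_cancel (by positivity)] at this
    by_contra hcon
    push Not at hcon
    have : q ^ n * 1 < q ^ n * μ.real (ball z (1 / 4 ^ n)) := by gcongr
    linarith
  have hbdd : BddAbove S := by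
    obtain ⟨n, hn⟩ := pow_unbounded_of_one_lt (1 / μ.real (ball z 1)) hq
    refine ⟨4 ^ n, fun r hr => ?_⟩
    by_contra hcon
    push Not at hcon
    have h1 := B.lower_pow z one_pos n
    rw [mul_one] at h1
    rw [div_lt_iff₀ hpos1] at hn
    linarith [hr.2, measureReal_ball_mono (μ := μ) z hcon.le]
  set r₀ := sSup S
  have hr₀ : 0 < r₀ := by
    obtain ⟨r, hr⟩ := hne
    exact hr.1.trans_le (le_csSup hbdd hr)
  have hle : μ (ball z r₀) ≤ 1 := by
    have hmono : Monotone (fun n : ℕ => ball z (r₀ - 1 / (n + 1))) := by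
      intro m n hmn
      apply ball_subset_ball
      have : (1:ℝ) / (n + 1) ≤ 1 / (m + 1) := by gcongr
      linarith
    have hU : ball z r₀ = ⋃ n : ℕ, ball z (r₀ - 1 / (n + 1)) := by
      ext w
      simp only [mem_ball, mem_iUnion]
      constructor
      · intro h
        obtain ⟨n, hn⟩ := exists_nat_one_div_lt (sub_pos.2 h)
        exact ⟨n, by linarith⟩
      · rintro ⟨n, hn⟩
        have : (0:ℝ) < 1 / (n + 1) := by positivity
        linarith
    rw [hU, hmono.measure_iUnion]
    refine iSup_le fun n => ?_
    have hlt : r₀ - 1 / ((n:ℝ) + 1) < r₀ := by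
      have : (0:ℝ) < 1 / (n + 1) := by positivity
      linarith
    obtain ⟨s, hs, hs2⟩ := exists_lt_of_lt_csSup hne hlt
    have h1 := (measureReal_ball_mono (μ := μ) z hs2.le).trans hs.2
    rw [Measure.real, ← ENNReal.toReal_one] at h1
    exact (ENNReal.toReal_le_toReal (measure_ball_ne_top _ _) ENNReal.one_ne_top).1 h1
  have hge : 1 ≤ μ (ball z r₀) := by
    have h0 : μ (ball z r₀) = μ (closedBall z r₀) := by
      rw [← ball_union_sphere]
      apply le_antisymm (measure_mono subset_union_left)
      refine (measure_union_le _ _).trans ?_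
      rw [B.sphere z r₀ hr₀, add_zero]
    have hanti : Antitone (fun n : ℕ => ball z (r₀ + 1 / (n + 1))) := by
      intro m n hmn
      apply ball_subset_ball
      have : (1:ℝ) / (n + 1) ≤ 1 / (m + 1) := by gcongr
      linarith
    have hU : closedBall z r₀ = ⋂ n : ℕ, ball z (r₀ + 1 / (n + 1)) := by
      ext w
      simp only [mem_ball, mem_iInter, mem_closedBall]
      constructor
      · intro h n
        have : (0:ℝ) < 1 / (n + 1) := by positivity
        linarith
      · intro h
        by_contra hcon
        push Not at hcon
        obtain ⟨n, hn⟩ := exists_nat_one_div_lt (sub_pos.2 hcon)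
        linarith [h n]
    rw [h0, hU, hanti.measure_iInter (fun n => isOpen_ball.measurableSet.nullMeasurableSet)
      ⟨0, measure_ball_ne_top _ _⟩]
    refine le_iInf fun n => ?_
    by_contra hcon
    push Not at hcon
    have hlt : r₀ < r₀ + 1 / ((n:ℝ) + 1) := by
      have : (0:ℝ) < 1 / (n + 1) := by positivity
      linarith
    have : r₀ + 1 / ((n:ℝ) + 1) ∈ S := by
      refine ⟨by linarith, ?_⟩
      rw [Measure.real]
      exact ENNReal.toReal_le_of_le_ofReal zero_le_one (by simpa using hcon.le)
    linarith [le_csSup hbdd this]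
  have heq : μ (ball z r₀) = 1 := le_antisymm hle hge
  have hset : {r : ℝ | 0 < r ∧ μ (ball z r) = 1} = {r₀} := by
    ext r
    simp only [mem_ofPred_eq, mem_singleton_iff]
    constructor
    · rintro ⟨hr, h1⟩
      rcases lt_trichotomy r r₀ with h | h | h
      · have := B.measureReal_ball_lt z hr h
        simp [Measure.real, h1, heq] at this
      · exact h
      · have := B.measureReal_ball_lt z hr₀ h
        simp [Measure.real, h1, heq] at this
    · rintro rfl
      exact ⟨hr₀, heq⟩
  have : rho μ z = r₀ := by
    rw [rho, hset, csInf_singleton]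
  rw [this]
  exact ⟨hr₀, by simp [Measure.real, heq]⟩

theorem DoublingBounds.rho_pos (B : DoublingBounds μ C q) (z : ℂ) : 0 < rho μ z :=
  (B.rho_spec z).1

theorem DoublingBounds.measure_ball_rho (B : DoublingBounds μ C q) (z : ℂ) :
    μ.real (ball z (rho μ z)) = 1 := (B.rho_spec z).2

theorem DoublingBounds.rho_le_of_one_le (B : DoublingBounds μ C q) {z : ℂ} {r : ℝ} (hr : 0 < r)
    (h : 1 ≤ μ.real (ball z r)) : rho μ z ≤ r := by
  by_contra hcon
  push Not at hcon
  have := B.measureReal_ball_lt z hr hcon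
  rw [B.measure_ball_rho] at this
  linarith

/-- `rho` is 1-Lipschitz. -/
theorem DoublingBounds.rho_le_add (B : DoublingBounds μ C q) (z w : ℂ) :
    rho μ z ≤ rho μ w + dist z w := by
  apply B.rho_le_of_one_le
  · have := B.rho_pos w
    positivity
  · rw [← B.measure_ball_rho w]
    apply measureReal_ball_le_of_subset
    rw [dist_comm]; linarith

theorem DoublingBounds.continuous_rho (B : DoublingBounds μ C q) : Continuous (rho μ) :=
  (LipschitzWith.of_le_add B.rho_le_add).continuous

/-- At distances beyond `rho μ z`, the radius `rho` is smaller than the distance by a power of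
the normalized distance. -/
theorem DoublingBounds.exists_growth (B : DoublingBounds μ C q) :
    ∃ K ε : ℝ, 0 < K ∧ 0 < ε ∧ ∀ z w : ℂ, rho μ w / (rho μ z + dist z w) ≤
      K * (rho μ z / (rho μ z + dist z w)) ^ ε := by
  obtain ⟨C', hC', hC2⟩ : ∃ C' : ℝ, C ≤ C' ∧ 2 ≤ C' := ⟨max C 2, le_max_left _ _, le_max_right _ _⟩
  have hq := B.one_lt
  have hC1 := B.one_le
  set γ := Real.logb 4 q with hγ
  set D := Real.logb 2 C' with hD
  have hγ0 : 0 < γ := Real.logb_pos (by norm_num) hq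
  have hD0 : 0 < D := Real.logb_pos (by norm_num) (by linarith)
  have h4γ : (4:ℝ) ^ γ = q := Real.rpow_logb (by norm_num) (by norm_num) (by linarith)
  have h2D : (2:ℝ) ^ D = C' := Real.rpow_logb (by norm_num) (by norm_num) (by linarith)
  refine ⟨(q * C' ^ 2) ^ (1 / D), γ / D, by positivity, by positivity, fun z w => ?_⟩
  have hz := B.rho_pos z
  have hw := B.rho_pos w
  set s := rho μ z + dist z w with hs
  have hsz : rho μ z ≤ s := by linarith [dist_nonneg (x := z) (y := w)]
  have hsw : rho μ w ≤ s := by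
    have := B.rho_le_add w z
    rw [dist_comm] at this
    linarith
  have hs0 : 0 < s := by linarith
  -- lower bound at `z`
  obtain ⟨n, hn1, hn2⟩ := exists_nat_pow_near ((one_le_div hz).2 hsz) (by norm_num : (1:ℝ) < 4)
  have hlow : q ^ n ≤ μ.real (ball z s) := by
    have := B.lower_pow z hz n
    rw [B.measure_ball_rho, mul_one] at this
    refine this.trans (measureReal_ball_mono z ?_)
    rwa [le_div_iff₀ hz] at hn1
  have hlow2 : (s / rho μ z) ^ γ ≤ q * q ^ n := by
    calc (s / rho μ z) ^ γ ≤ ((4:ℝ) ^ (n + 1)) ^ γ := by gcongr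
      _ = ((4:ℝ) ^ γ) ^ (n + 1) := by
          rw [← Real.rpow_natCast, ← Real.rpow_mul (by norm_num), mul_comm,
            Real.rpow_mul (by norm_num), Real.rpow_natCast]
      _ = q * q ^ n := by rw [h4γ]; ring
  -- upper bound at `w`
  obtain ⟨m, hm1, hm2⟩ := exists_nat_pow_near ((one_le_div hw).2 hsw) (by norm_num : (1:ℝ) < 2)
  have hup : μ.real (ball w (2 * s)) ≤ C' ^ (m + 2) := by
    have h1 := B.upper_pow w hw (m + 2)
    rw [B.measure_ball_rho, mul_one] at h1
    have h2 : μ.real (ball w (2 * s)) ≤ μ.real (ball w (2 ^ (m + 2) * rho μ w)) := by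
      apply measureReal_ball_mono
      rw [div_lt_iff₀ hw] at hm2
      rw [pow_succ]
      linarith
    refine (h2.trans h1).trans ?_
    gcongr
  have hup2 : C' ^ m ≤ (s / rho μ w) ^ D := by
    calc C' ^ m = ((2:ℝ) ^ m) ^ D := by
          rw [← Real.rpow_natCast, ← Real.rpow_natCast, ← Real.rpow_mul (by norm_num), mul_comm,
            Real.rpow_mul (by norm_num), h2D]
      _ ≤ _ := by gcongr
  have hmid : μ.real (ball z s) ≤ μ.real (ball w (2 * s)) := by
    apply measureReal_ball_le_of_subset
    linarith
  have hkey : (s / rho μ z) ^ γ ≤ (q * C' ^ 2) * (s / rho μ w) ^ D := by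
    calc (s / rho μ z) ^ γ ≤ q * q ^ n := hlow2
      _ ≤ q * (C' ^ (m + 2)) := by gcongr; linarith
      _ = (q * C' ^ 2) * C' ^ m := by ring
      _ ≤ _ := by gcongr
  have hkey2 : (s / rho μ z) ^ (γ / D) ≤ (q * C' ^ 2) ^ (1 / D) * (s / rho μ w) := by
    have h1 : ((s / rho μ z) ^ γ) ^ (1 / D) ≤ ((q * C' ^ 2) * (s / rho μ w) ^ D) ^ (1 / D) := by
      gcongr
    rw [← Real.rpow_mul (by positivity), Real.mul_rpow (by positivity) (by positivity),
      ← Real.rpow_mul (by positivity), mul_one_div, mul_one_div_cancel hD0.ne',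
      Real.rpow_one] at h1
    exact h1
  have e1 : (rho μ z / s) ^ (γ / D) = ((s / rho μ z) ^ (γ / D))⁻¹ := by
    rw [← Real.inv_rpow (by positivity), inv_div]
  have hpos : 0 < (s / rho μ z) ^ (γ / D) := by positivity
  rw [e1, ← div_eq_mul_inv, le_div_iff₀ hpos]
  calc rho μ w / s * (s / rho μ z) ^ (γ / D)
      ≤ rho μ w / s * ((q * C' ^ 2) ^ (1 / D) * (s / rho μ w)) := by gcongr
    _ = _ := by field_simp

/-- Points at distance `O(rho)` have comparable radii. -/
theorem DoublingBounds.exists_comparable (B : DoublingBounds μ C q) (K : ℝ) :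
    ∃ K' : ℝ, 1 ≤ K' ∧ ∀ z w : ℂ, dist z w ≤ K * max (rho μ z) (rho μ w) →
      rho μ z ≤ K' * rho μ w := by
  obtain ⟨K₀, ε, hK₀, hε, hG⟩ := B.exists_growth
  set K1 : ℝ := max K 0 with hK1
  -- `rho z ≤ ((2 + K) K₀) ^ (1/ε) * (2 + K) * rho w`
  set T : ℝ := (2 + K1) * K₀ with hT
  have hK1n : 0 ≤ K1 := le_max_right _ _
  refine ⟨max 1 (T ^ (1 / ε) * (2 + K1)), le_max_left _ _, fun z w hzw => ?_⟩
  have hz := B.rho_pos z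
  have hw := B.rho_pos w
  rcases le_total (rho μ z) (rho μ w) with h | h
  · calc rho μ z ≤ 1 * rho μ w := by linarith
      _ ≤ _ := by gcongr; exact le_max_left _ _
  have hd : dist z w ≤ K1 * rho μ z := by
    rw [max_eq_left h] at hzw
    exact hzw.trans (by gcongr; exact le_max_left _ _)
  have hd0 : 0 ≤ dist z w := dist_nonneg
  have h1 := hG w z
  rw [dist_comm w z] at h1
  set s := rho μ w + dist z w with hs
  have hs1 : s ≤ (2 + K1) * rho μ z := by nlinarith
  have hs2 : rho μ z ≤ s := by linarith [B.rho_le_add z w]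
  have hs0 : 0 < s := by linarith
  have h2 : 1 ≤ T * (rho μ w / s) ^ ε := by
    have : 1 ≤ (2 + K1) * (rho μ z / s) := by
      rw [← mul_div_assoc, one_le_div hs0]; exact hs1
    calc (1:ℝ) ≤ (2 + K1) * (rho μ z / s) := this
      _ ≤ (2 + K1) * (K₀ * (rho μ w / s) ^ ε) := by gcongr
      _ = _ := by ring
  have h3 : 1 ≤ T ^ (1 / ε) * (rho μ w / s) := by
    have h4 : (1:ℝ) ^ (1 / ε) ≤ (T * (rho μ w / s) ^ ε) ^ (1 / ε) := by gcongr
    rw [Real.one_rpow, Real.mul_rpow (by positivity) (by positivity),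
      ← Real.rpow_mul (by positivity), mul_one_div_cancel hε.ne', Real.rpow_one] at h4
    exact h4
  rw [← mul_div_assoc, one_le_div hs0] at h3
  calc rho μ z ≤ s := hs2
    _ ≤ T ^ (1 / ε) * rho μ w := h3
    _ ≤ (T ^ (1 / ε) * (2 + K1)) * rho μ w := by
        gcongr
        have : 0 ≤ T ^ (1 / ε) := by positivity
        nlinarith
    _ ≤ _ := by gcongr; exact le_max_right _ _

/-- Replacing the mass one by the mass `1 / a` in the definition of `rho` increases it by at most
a bounded factor. -/
theorem DoublingBounds.exists_rho_smul_le (B : DoublingBounds μ C q) {a : ℝ≥0} (ha : 0 < a) :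
    ∃ K : ℝ, 1 ≤ K ∧ ∀ z, rho (a • μ) z ≤ K * rho μ z := by
  have B' := B.smul ha
  have e : ∀ s : Set ℂ, (a • μ).real s = a * μ.real s := fun s => measureReal_nnreal_smul_apply a
  have ha' : (0:ℝ) < a := ha
  obtain ⟨n, hn⟩ := pow_unbounded_of_one_lt (1 / a : ℝ) B.one_lt
  refine ⟨4 ^ n, one_le_pow₀ (by norm_num), fun z => ?_⟩
  have hz := B.rho_pos z
  apply B'.rho_le_of_one_le (by positivity)
  rw [e]
  have h1 := B.lower_pow z hz n
  rw [B.measure_ball_rho, mul_one] at h1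
  rw [div_lt_iff₀ ha'] at hn
  nlinarith

end Rho

/-! ### The distance with weight `1 / rho` -/

section Distance

/-- The displacement along a piecewise `C¹` curve is at most its Euclidean length. -/
theorem IsPiecewiseC1.enorm_sub_le {γ : ℝ → ℂ} (h : IsPiecewiseC1 γ) :
    ∀ t ∈ Icc (0 : ℝ) 1, ‖γ t - γ 0‖ₑ ≤ ∫⁻ s in Icc (0 : ℝ) 1, ‖deriv γ s‖ₑ := by
  obtain ⟨n, t, hmono, h0, h1, hC⟩ := h
  have key : ∀ j (hj : j < n + 1), ∀ x ∈ Icc (0 : ℝ) (t ⟨j, hj⟩),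
      ‖γ x - γ 0‖ₑ ≤ ∫⁻ s in Icc (0 : ℝ) x, ‖deriv γ s‖ₑ := by
    intro j
    induction j with
    | zero =>
      intro hj x hx
      have : (⟨0, hj⟩ : Fin (n + 1)) = 0 := rfl
      rw [this, h0] at hx
      have hx0 : x = 0 := le_antisymm hx.2 hx.1
      simp [hx0]
    | succ j ih =>
      intro hj x hx
      have hj' : j < n + 1 := by omega
      have hjn : j < n := by omega
      have hpos : 0 ≤ t ⟨j, hj'⟩ := by
        rw [← h0]; exact hmono.monotone (Fin.zero_le _)
      rcases le_total x (t ⟨j, hj'⟩) with hle | hle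
      · exact ih hj' x ⟨hx.1, hle⟩
      · have hc : ContDiffOn ℝ 1 γ (Icc (t ⟨j, hj'⟩) x) :=
          (hC ⟨j, hjn⟩).mono (Icc_subset_Icc_right hx.2)
        have h2 := enorm_sub_le_lintegral_deriv_of_contDiffOn_Icc hc hle
        have h3 := ih hj' (t ⟨j, hj'⟩) ⟨hpos, le_rfl⟩
        calc ‖γ x - γ 0‖ₑ = ‖(γ (t ⟨j, hj'⟩) - γ 0) + (γ x - γ (t ⟨j, hj'⟩))‖ₑ := by
              congr 1; ring
          _ ≤ ‖γ (t ⟨j, hj'⟩) - γ 0‖ₑ + ‖γ x - γ (t ⟨j, hj'⟩)‖ₑ := enorm_add_le _ _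
          _ ≤ (∫⁻ s in Icc (0 : ℝ) (t ⟨j, hj'⟩), ‖deriv γ s‖ₑ) +
              ∫⁻ s in Icc (t ⟨j, hj'⟩) x, ‖deriv γ s‖ₑ := add_le_add h3 h2
          _ = (∫⁻ s in Icc (0 : ℝ) (t ⟨j, hj'⟩), ‖deriv γ s‖ₑ) +
              ∫⁻ s in Ioc (t ⟨j, hj'⟩) x, ‖deriv γ s‖ₑ := by
              rw [Measure.restrict_congr_set Ioc_ae_eq_Icc]
          _ = ∫⁻ s in Icc (0 : ℝ) x, ‖deriv γ s‖ₑ := by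
              rw [← Icc_union_Ioc_eq_Icc hpos hle, lintegral_union measurableSet_Ioc]
              rw [Set.disjoint_left]
              intro s hs hs2
              exact absurd hs.2 (not_le.2 hs2.1)
  intro x hx
  have hx' : x ∈ Icc (0 : ℝ) (t ⟨n, by omega⟩) := by
    have : (⟨n, by omega⟩ : Fin (n + 1)) = Fin.last n := rfl
    rwa [this, h1]
  exact (key n (by omega) x hx').trans (lintegral_mono_set (Icc_subset_Icc_right hx.2))

theorem IsPiecewiseC1.exists_norm_sub_le {γ : ℝ → ℂ} (h : IsPiecewiseC1 γ) (z : ℂ) :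
    ∃ M, 0 ≤ M ∧ ∀ t ∈ Icc (0 : ℝ) 1, ‖γ t - z‖ ≤ M := by
  obtain ⟨n, t, hmono, h0, h1, hC⟩ := h
  have key : ∀ j (hj : j < n + 1), ∃ M, 0 ≤ M ∧ ∀ x ∈ Icc (0 : ℝ) (t ⟨j, hj⟩),
      ‖γ x - z‖ ≤ M := by
    intro j
    induction j with
    | zero =>
      intro hj
      refine ⟨‖γ 0 - z‖, norm_nonneg _, fun x hx => ?_⟩
      have : (⟨0, hj⟩ : Fin (n + 1)) = 0 := rfl
      rw [this, h0] at hx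
      have hx0 : x = 0 := le_antisymm hx.2 hx.1
      simp [hx0]
    | succ j ih =>
      intro hj
      obtain ⟨M, hM0, hM⟩ := ih (by omega)
      have hc := (hC ⟨j, by omega⟩).continuousOn
      obtain ⟨M', hM'⟩ := isCompact_Icc.exists_bound_of_continuousOn (hc.sub continuousOn_const)
      refine ⟨max M M', le_max_of_le_left hM0, fun x hx => ?_⟩
      rcases le_total x (t ⟨j, by omega⟩) with hle | hle
      · exact (hM x ⟨hx.1, hle⟩).trans (le_max_left _ _)
      · exact (hM' x ⟨hle, hx.2⟩).trans (le_max_right _ _)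
  obtain ⟨M, hM0, hM⟩ := key n (by omega)
  refine ⟨M, hM0, fun x hx => hM x ?_⟩
  have : (⟨n, by omega⟩ : Fin (n + 1)) = Fin.last n := rfl
  rwa [this, h1]

/-- The straight segment bounds `rhoDist` from above. -/
theorem rhoDist_le_of_segment {μ : Measure ℂ} {z w : ℂ} {m : ℝ} (hm : 0 < m)
    (h : ∀ ζ ∈ segment ℝ z w, m ≤ rho μ ζ) :
    rhoDist μ z w ≤ ENNReal.ofReal (dist z w / m) := by
  set γ : ℝ → ℂ := fun t => z + t • (w - z) with hγ
  have hd : ∀ t, HasDerivAt γ (w - z) t := by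
    intro t
    have : HasDerivAt γ ((1 : ℝ) • (w - z)) t :=
      ((hasDerivAt_id t).smul_const (w - z)).const_add z
    rwa [one_smul] at this
  have hγ1 : IsPiecewiseC1 γ := by
    refine ⟨1, ![0, 1], ?_, rfl, rfl, fun i => ?_⟩
    · intro i j hij
      fin_cases i <;> fin_cases j <;> simp_all
    · apply ContDiff.contDiffOn
      fun_prop
  refine (iInf₂_le γ ⟨hγ1, by simp [hγ], by simp [hγ]⟩).trans ?_
  rw [rhoLength]
  calc ∫⁻ t in Icc (0 : ℝ) 1, ‖deriv γ t‖ₑ / ENNReal.ofReal (rho μ (γ t))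
      ≤ ∫⁻ t in Icc (0 : ℝ) 1, ENNReal.ofReal (dist z w / m) := by
        refine setLIntegral_mono' measurableSet_Icc fun t ht => ?_
        rw [(hd t).deriv, ENNReal.ofReal_div_of_pos hm]
        have : ‖w - z‖ₑ = ENNReal.ofReal (dist z w) := by
          rw [dist_comm, dist_eq_norm, ofReal_norm]
        rw [this]
        gcongr
        apply h
        rw [segment_eq_image']
        exact ⟨t, ht, rfl⟩
    _ = _ := by simp

variable {μ : Measure ℂ} [IsLocallyFiniteMeasure μ] {C q : ℝ}

/-- A curve of Euclidean length `ℓ` issuing from `z` stays where `rho ≤ rho z + ℓ`, so its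
`rho`-length is at least `ℓ / (rho z + ℓ)`. -/
theorem DoublingBounds.le_rhoDist (B : DoublingBounds μ C q) (z w : ℂ) :
    ENNReal.ofReal (dist z w / (rho μ z + dist z w)) ≤ rhoDist μ z w := by
  refine le_iInf₂ fun γ hγ => ?_
  obtain ⟨hγ, hz, hw⟩ := hγ
  have hz0 := B.rho_pos z
  have key : ∀ X : ℝ, 0 < X → (∀ t ∈ Icc (0:ℝ) 1, rho μ (γ t) ≤ X) →
      (∫⁻ s in Icc (0 : ℝ) 1, ‖deriv γ s‖ₑ) / ENNReal.ofReal X ≤ rhoLength μ γ := by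
    intro X hX h
    rw [div_eq_mul_inv, ← lintegral_mul_const' _ _ (by simpa using hX), rhoLength]
    refine setLIntegral_mono' measurableSet_Icc fun t ht => ?_
    rw [div_eq_mul_inv]
    gcongr
    exact h t ht
  have hlip : ∀ t, rho μ (γ t) ≤ rho μ z + ‖γ t - z‖ := fun t => by
    rw [← dist_eq_norm]; exact B.rho_le_add _ _
  have hlen := hγ.enorm_sub_le
  rw [hz] at hlen
  set ℓ := ∫⁻ s in Icc (0 : ℝ) 1, ‖deriv γ s‖ₑ with hℓ
  by_cases htop : ℓ = ⊤
  · obtain ⟨M, hM0, hM⟩ := hγ.exists_norm_sub_le z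
    have := key (rho μ z + M) (by positivity) fun t ht => (hlip t).trans (by gcongr; exact hM t ht)
    rw [htop, ENNReal.top_div_of_ne_top ENNReal.ofReal_ne_top, top_le_iff] at this
    rw [this]; exact le_top
  · have hb : ∀ t ∈ Icc (0:ℝ) 1, ‖γ t - z‖ ≤ ℓ.toReal := fun t ht => by
      rw [← toReal_enorm]
      exact ENNReal.toReal_mono htop (hlen t ht)
    have := key (rho μ z + ℓ.toReal) (by positivity)
      fun t ht => (hlip t).trans (by gcongr; exact hb t ht)
    refine le_trans ?_ this
    have h1 : dist z w ≤ ℓ.toReal := by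
      have := hb 1 (by simp)
      rwa [hw, ← dist_eq_norm, dist_comm] at this
    rw [← ENNReal.ofReal_toReal htop, ← ENNReal.ofReal_div_of_pos (by positivity),
      ENNReal.toReal_ofReal ENNReal.toReal_nonneg]
    apply ENNReal.ofReal_le_ofReal
    have hd : 0 ≤ dist z w := dist_nonneg
    rw [div_le_div_iff₀ (by positivity) (by positivity)]
    nlinarith

/-- At distances `O(rho μ z)` from `z`, `rhoDist` is at most a multiple of the Euclidean distance in
units of `rho μ z`, since `rho` is comparable to `rho μ z` along the segment. -/
theorem DoublingBounds.exists_rhoDist_le (B : DoublingBounds μ C q) (K : ℝ) :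
    ∃ K' : ℝ, 1 ≤ K' ∧ ∀ z w : ℂ, dist z w ≤ K * rho μ z →
      rhoDist μ z w ≤ ENNReal.ofReal (K' * (dist z w / rho μ z)) := by
  obtain ⟨K', hK', h⟩ := B.exists_comparable (max K 0)
  refine ⟨K', hK', fun z w hzw => ?_⟩
  have hz := B.rho_pos z
  have := rhoDist_le_of_segment (μ := μ) (z := z) (w := w) (m := rho μ z / K') (by positivity) ?_
  · refine this.trans (ENNReal.ofReal_le_ofReal ?_)
    apply le_of_eq
    field_simp
  · intro ζ hζ
    rw [div_le_iff₀' (by positivity)]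
    apply h z ζ
    have h1 : dist z ζ ≤ dist z w := by
      rw [dist_comm z ζ, dist_comm z w]
      exact (convexOn_dist z (convex_univ)).le_max_of_mem_segment (mem_univ z) (mem_univ w) hζ
        |>.trans (by simp)
    calc dist z ζ ≤ K * rho μ z := h1.trans hzw
      _ ≤ max K 0 * max (rho μ z) (rho μ ζ) := by
        gcongr
        · exact le_max_left _ _
        · exact le_max_left _ _

end Distance

/-! ### The Laplacian and a regularized logarithm -/

section LaplacianCalculus
open Laplacian InnerProductSpace

theorem laplacian_eq_fderiv {f : ℂ → ℝ} (hf : ContDiff ℝ 2 f) (z : ℂ) :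
    laplacian f z = fderiv ℝ (fun w => fderiv ℝ f w 1) z 1 +
      fderiv ℝ (fun w => fderiv ℝ f w Complex.I) z Complex.I := by
  have hd : DifferentiableAt ℝ (fderiv ℝ f) z :=
    ((hf.fderiv_right (m := 1) (by norm_num)).differentiable (by norm_num)) z
  rw [laplacian_eq_iteratedFDeriv_complexPlane]
  simp only [iteratedFDeriv_two_apply]
  rw [fderiv_clm_apply hd (by fun_prop), fderiv_clm_apply hd (by fun_prop)]
  simp

theorem contDiff_fderiv_apply {f : ℂ → ℝ} (hf : ContDiff ℝ (⊤ : ℕ∞) f) (v : ℂ) :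
    ContDiff ℝ (⊤ : ℕ∞) (fun w => fderiv ℝ f w v) := by
  have := hf.fderiv_right (m := (⊤ : ℕ∞)) (by norm_cast)
  fun_prop

theorem contDiff_laplacian {f : ℂ → ℝ} (hf : ContDiff ℝ (⊤ : ℕ∞) f) :
    ContDiff ℝ (⊤ : ℕ∞) (laplacian f) := by
  have : laplacian f = fun z => fderiv ℝ (fun w => fderiv ℝ f w 1) z 1 +
      fderiv ℝ (fun w => fderiv ℝ f w Complex.I) z Complex.I := by
    ext z
    exact laplacian_eq_fderiv (hf.of_le (by norm_cast)) z
  rw [this]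
  exact (contDiff_fderiv_apply (contDiff_fderiv_apply hf _) _).add
    (contDiff_fderiv_apply (contDiff_fderiv_apply hf _) _)

theorem tsupport_laplacian_subset {f : ℂ → ℝ} : tsupport (laplacian f) ⊆ tsupport f := by
  apply closure_minimal _ (isClosed_tsupport f)
  intro z hz
  by_contra hcon
  apply hz
  have h0 : f =ᶠ[𝓝 z] fun _ => 0 := notMem_tsupport_iff_eventuallyEq.1 hcon
  have := (laplacian_congr_nhds h0).eq_of_nhds
  rw [this]
  simp

theorem hasCompactSupport_laplacian {f : ℂ → ℝ} (hf : HasCompactSupport f) :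
    HasCompactSupport (laplacian f) :=
  hf.of_isClosed_subset (isClosed_tsupport _) tsupport_laplacian_subset

theorem laplacian_comp_affine {f : ℂ → ℝ} (hf : ContDiff ℝ (⊤ : ℕ∞) f) (a : ℝ) (b z : ℂ) :
    laplacian (fun w => f (a • w + b)) z = a ^ 2 * laplacian f (a • z + b) := by
  have h1 : ∀ (g : ℂ → ℝ), ContDiff ℝ (⊤ : ℕ∞) g → ∀ w v : ℂ,
      fderiv ℝ (fun w => g (a • w + b)) w v = a * fderiv ℝ g (a • w + b) v := by
    intro g hg w v
    have h2 : HasFDerivAt (fun w : ℂ => a • w + b) (a • ContinuousLinearMap.id ℝ ℂ) w :=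
      ((hasFDerivAt_id w).const_smul a).add_const b
    have h3 := ((hg.differentiable (by simp)) (a • w + b)).hasFDerivAt.comp w h2
    have h4 : fderiv ℝ (fun w => g (a • w + b)) w =
        (fderiv ℝ g (a • w + b)).comp (a • ContinuousLinearMap.id ℝ ℂ) := h3.fderiv
    rw [h4]
    simp
  have hf2 : ContDiff ℝ 2 f := hf.of_le (by norm_cast)
  have hcomp : ContDiff ℝ 2 (fun w => f (a • w + b)) := by fun_prop
  rw [laplacian_eq_fderiv hcomp, laplacian_eq_fderiv hf2]
  have h5 : ∀ v : ℂ, fderiv ℝ (fun w => fderiv ℝ (fun w => f (a • w + b)) w v) z v =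
      a ^ 2 * fderiv ℝ (fun w => fderiv ℝ f w v) (a • z + b) v := by
    intro v
    have : (fun w => fderiv ℝ (fun w => f (a • w + b)) w v) =
        fun w => a * fderiv ℝ f (a • w + b) v := by
      ext w; exact h1 f hf w v
    rw [this, fderiv_const_mul, smul_apply,
      h1 _ (contDiff_fderiv_apply hf v)]
    · simp only [smul_eq_mul]; ring
    · have := contDiff_fderiv_apply hf v
      have h6 : ContDiff ℝ (⊤ : ℕ∞) (fun w => fderiv ℝ f (a • w + b) v) := by
        exact this.comp (by fun_prop : ContDiff ℝ (⊤ : ℕ∞) fun w : ℂ => a • w + b)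
      exact (h6.differentiable (by simp)) z
  rw [h5, h5]; ring

/-- Green's formula, with one factor compactly supported. -/
theorem integral_mul_laplacian {f g : ℂ → ℝ} (hf : ContDiff ℝ (⊤ : ℕ∞) f)
    (hfc : HasCompactSupport f) (hg : ContDiff ℝ (⊤ : ℕ∞) g) :
    ∫ z, g z * laplacian f z = ∫ z, laplacian g z * f z := by
  have hf2 : ContDiff ℝ 2 f := hf.of_le (by norm_cast)
  have hg2 : ContDiff ℝ 2 g := hg.of_le (by norm_cast)
  have hfcv : ∀ v : ℂ, HasCompactSupport (fun w => fderiv ℝ f w v) := fun v =>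
    (hfc.fderiv ℝ).comp_left (g := fun L : ℂ →L[ℝ] ℝ => L v) rfl
  have hfcvv : ∀ v : ℂ, HasCompactSupport (fun z => fderiv ℝ (fun w => fderiv ℝ f w v) z v) :=
    fun v => ((hfcv v).fderiv ℝ).comp_left (g := fun L : ℂ →L[ℝ] ℝ => L v) rfl
  have hint : ∀ u w : ℂ → ℝ, ContDiff ℝ (⊤ : ℕ∞) u → ContDiff ℝ (⊤ : ℕ∞) w →
      HasCompactSupport w → Integrable (fun z => u z * w z) := fun u w hu hw hwc =>
    (hu.continuous.mul hw.continuous).integrable_of_hasCompactSupport hwc.mul_left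
  have key : ∀ v : ℂ, ∫ z, g z * fderiv ℝ (fun w => fderiv ℝ f w v) z v =
      ∫ z, fderiv ℝ (fun w => fderiv ℝ g w v) z v * f z := by
    intro v
    have hfv := contDiff_fderiv_apply hf v
    have hgv := contDiff_fderiv_apply hg v
    rw [integral_mul_fderiv_eq_neg_fderiv_mul_of_integrable
      (hint _ _ (contDiff_fderiv_apply hg v) hfv (hfcv v))
      (hint _ _ hg (contDiff_fderiv_apply hfv v) (hfcvv v))
      (hint _ _ hg hfv (hfcv v))
      (fun x _ => hg.differentiable (by simp) x) (fun x _ => hfv.differentiable (by simp) x),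
      integral_mul_fderiv_eq_neg_fderiv_mul_of_integrable
      (hint _ _ (contDiff_fderiv_apply hgv v) hf hfc)
      (hint _ _ hgv hfv (hfcv v))
      (hint _ _ hgv hf hfc)
      (fun x _ => hgv.differentiable (by simp) x) (fun x _ => hf.differentiable (by simp) x),
      neg_neg]
  have hfvv := fun v => contDiff_fderiv_apply (contDiff_fderiv_apply hf v) v
  have hgvv := fun v => contDiff_fderiv_apply (contDiff_fderiv_apply hg v) v
  simp_rw [laplacian_eq_fderiv hf2, laplacian_eq_fderiv hg2, mul_add, add_mul]
  rw [integral_add (hint _ _ hg (hfvv _) (hfcvv _)) (hint _ _ hg (hfvv _) (hfcvv _)),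
    integral_add (hint _ _ (hgvv _) hf hfc) (hint _ _ (hgvv _) hf hfc), key, key]

/-- The radial profile of `regLog` as a function of the square of the modulus. -/
def regLogProfile (s : ℝ) : ℝ := Real.smoothTransition (2 * s - 1) * (Real.log s / 2)

/-- A smooth radial function on the plane that agrees with `log ‖z‖` for `1 ≤ ‖z‖`. Its Laplacian is
a smooth kernel of mass `2π` supported in the unit disc. -/
def regLog (z : ℂ) : ℝ := regLogProfile (Complex.normSq z)

theorem contDiff_regLogProfile : ContDiff ℝ (⊤ : ℕ∞) regLogProfile := by
  rw [contDiff_iff_contDiffAt]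
  intro s
  rcases lt_or_ge s (1 / 2) with h | h
  · have : regLogProfile =ᶠ[𝓝 s] fun _ => 0 := by
      filter_upwards [Iio_mem_nhds h] with t ht
      have ht : t < 1 / 2 := ht
      rw [regLogProfile, Real.smoothTransition.zero_of_nonpos (by linarith), zero_mul]
    exact contDiffAt_const.congr_of_eventuallyEq this
  · have h1 : ContDiffAt ℝ (⊤ : ℕ∞) (fun s : ℝ => Real.smoothTransition (2 * s - 1)) s :=
      Real.smoothTransition.contDiff.contDiffAt.comp s (by fun_prop)
    have h2 : ContDiffAt ℝ (⊤ : ℕ∞) Real.log s := Real.contDiffAt_log.2 (by linarith)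
    exact h1.mul (h2.div_const 2)

theorem contDiff_regLog : ContDiff ℝ (⊤ : ℕ∞) regLog := by
  have : regLog = fun z => regLogProfile (‖z‖ ^ 2) := by
    ext z; rw [regLog, Complex.normSq_eq_norm_sq]
  rw [this]
  exact contDiff_regLogProfile.comp (contDiff_norm_sq ℝ)

theorem regLog_eq_log {z : ℂ} (hz : 1 ≤ ‖z‖) : regLog z = Real.log ‖z‖ := by
  have : 1 ≤ ‖z‖ ^ 2 := one_le_pow₀ hz
  rw [regLog, regLogProfile, Complex.normSq_eq_norm_sq,
    Real.smoothTransition.one_of_one_le (by linarith), Real.log_pow]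
  push_cast; ring

/-- `regLog` lies between `0` and the logarithm, since it is the logarithm times a cutoff. -/
theorem abs_regLog_sub_log_le (z : ℂ) : |regLog z - Real.log ‖z‖| ≤ |Real.log ‖z‖| := by
  have h0 := Real.smoothTransition.nonneg (2 * Complex.normSq z - 1)
  have h1 := Real.smoothTransition.le_one (2 * Complex.normSq z - 1)
  have : regLog z - Real.log ‖z‖ =
      -((1 - Real.smoothTransition (2 * Complex.normSq z - 1)) * Real.log ‖z‖) := by
    rw [regLog, regLogProfile]
    nth_rewrite 2 [Complex.normSq_eq_norm_sq]
    rw [Real.log_pow]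
    push_cast; ring
  rw [this, abs_neg, abs_mul, abs_of_nonneg (by linarith)]
  have := abs_nonneg (Real.log ‖z‖)
  nlinarith

theorem fderiv_comp_normSq {u : ℝ → ℝ} (hu : ContDiff ℝ (⊤ : ℕ∞) u) (z v : ℂ) :
    fderiv ℝ (fun w => u (Complex.normSq w)) z v =
      deriv u (Complex.normSq z) * (2 * (z.re * v.re + z.im * v.im)) := by
  have h1 : HasDerivAt u (deriv u (Complex.normSq z)) (Complex.normSq z) :=
    ((hu.differentiable (by simp)) _).hasDerivAt
  have h2 : HasFDerivAt (fun w : ℂ => Complex.normSq w)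
      (z.re • Complex.reCLM + z.re • Complex.reCLM +
        (z.im • Complex.imCLM + z.im • Complex.imCLM)) z := by
    simp only [Complex.normSq_apply]
    have hr : HasFDerivAt (fun w : ℂ => w.re) Complex.reCLM z := Complex.reCLM.hasFDerivAt
    have hi : HasFDerivAt (fun w : ℂ => w.im) Complex.imCLM z := Complex.imCLM.hasFDerivAt
    exact (hr.mul hr).add (hi.mul hi)
  have h3 : HasFDerivAt (fun w => u (Complex.normSq w)) _ z := h1.comp_hasFDerivAt z h2
  rw [h3.fderiv]
  simp
  ring_nf

/-- The Laplacian of a radial function `u (|z| ^ 2)` is `4 |z| ^ 2 u'' + 4 u'`. -/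
theorem laplacian_regLog (z : ℂ) : laplacian regLog z =
    4 * Complex.normSq z * deriv (deriv regLogProfile) (Complex.normSq z) +
      4 * deriv regLogProfile (Complex.normSq z) := by
  have hu := contDiff_regLogProfile
  have hu' : ContDiff ℝ (⊤ : ℕ∞) (deriv regLogProfile) := by
    exact hu.iterate_deriv 1
  rw [laplacian_eq_fderiv (contDiff_regLog.of_le (by norm_cast))]
  have e1 : (fun w => fderiv ℝ regLog w 1) =
      fun w => deriv regLogProfile (Complex.normSq w) * (2 * w.re) := by
    ext w
    have := fderiv_comp_normSq hu w 1
    rw [show regLog = fun w => regLogProfile (Complex.normSq w) from rfl, this]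
    simp
  have e2 : (fun w => fderiv ℝ regLog w Complex.I) =
      fun w => deriv regLogProfile (Complex.normSq w) * (2 * w.im) := by
    ext w
    have := fderiv_comp_normSq hu w Complex.I
    rw [show regLog = fun w => regLogProfile (Complex.normSq w) from rfl, this]
    simp
  have hd : DifferentiableAt ℝ (fun w => deriv regLogProfile (Complex.normSq w)) z := by
    have h : ContDiff ℝ (⊤ : ℕ∞) (fun w : ℂ => deriv regLogProfile (Complex.normSq w)) := by
      have : (fun w : ℂ => deriv regLogProfile (Complex.normSq w)) =
          fun w => deriv regLogProfile (‖w‖ ^ 2) := by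
        ext z; rw [Complex.normSq_eq_norm_sq]
      rw [this]
      exact hu'.comp (contDiff_norm_sq ℝ)
    exact h.differentiable (by simp) z
  have hr : HasFDerivAt (fun w : ℂ => 2 * w.re) ((2:ℝ) • Complex.reCLM) z :=
    Complex.reCLM.hasFDerivAt.const_mul 2
  have hi : HasFDerivAt (fun w : ℂ => 2 * w.im) ((2:ℝ) • Complex.imCLM) z :=
    Complex.imCLM.hasFDerivAt.const_mul 2
  have a1 := fderiv_comp_normSq hu' z 1
  have a2 := fderiv_comp_normSq hu' z Complex.I
  have b1 := (hd.hasFDerivAt.mul hr).fderiv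
  have b2 := (hd.hasFDerivAt.mul hi).fderiv
  rw [e1, e2]
  erw [b1, b2]
  simp only [add_apply, smul_apply, a1, a2, Complex.reCLM_apply, Complex.imCLM_apply]
  simp [Complex.normSq_apply]
  ring

end LaplacianCalculus

/-! ### The fundamental solution -/

section FundamentalSolution
open Laplacian InnerProductSpace

theorem abs_log_le_div {t r : ℝ} (ht : 0 < t) (htr : t < r) : |Real.log t| ≤ (r ^ 2 + 1) / t := by
  have h1 : Real.log t ≤ t := (Real.log_le_sub_one_of_pos ht).trans (by linarith)
  have h2 : -Real.log t ≤ 1 / t := by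
    rw [← Real.log_inv]
    have := Real.log_le_sub_one_of_pos (inv_pos.2 ht)
    rw [one_div]; linarith
  have h3 : t ≤ r ^ 2 / t := by rw [le_div_iff₀ ht]; nlinarith
  have h4 : 0 < 1 / t := by positivity
  have h5 : 0 ≤ r ^ 2 / t := by positivity
  rw [add_div, abs_le]
  constructor <;> linarith

theorem locallyIntegrable_log_norm_sub (a : ℂ) :
    LocallyIntegrable (fun z : ℂ => Real.log ‖z - a‖) := by
  have hm : AEStronglyMeasurable (fun z : ℂ => Real.log ‖z‖) (volume : Measure ℂ) :=
    (Real.measurable_log.comp measurable_norm).aestronglyMeasurable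
  have h0 : ∀ r : ℝ, IntegrableOn (fun z : ℂ => Real.log ‖z‖) (ball 0 r) := by
    intro r
    refine integrableOn_ball_of_norm_le_rpow (C := r ^ 2 + 1) (α := 1) ?_ ?_ ?_ hm
    · rw [Complex.finrank_real_complex]; norm_num
    · rw [Complex.finrank_real_complex]; norm_num
    · rw [ae_restrict_iff' isOpen_ball.measurableSet]
      filter_upwards [Measure.ae_ne volume 0] with z hz0 hz
      have hz' : 0 < ‖z‖ := norm_pos_iff.2 hz0
      rw [Real.norm_eq_abs, Real.rpow_neg_one, ← div_eq_mul_inv]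
      exact abs_log_le_div hz' (mem_ball_zero_iff.1 hz)
  rw [locallyIntegrable_iff]
  intro K hK
  obtain ⟨R, hR⟩ := hK.isBounded.subset_ball a
  have := (h0 R)
  have h1 : IntegrableOn (fun z : ℂ => Real.log ‖z - a‖) (ball a R) := by
    have hmp : MeasurePreserving (fun z : ℂ => z - a) volume volume := measurePreserving_sub_right _ a
    have := (hmp.integrableOn_comp_preimage (Homeomorph.subRight a).measurableEmbedding
      (f := fun z : ℂ => Real.log ‖z‖) (s := ball 0 R)).2 (h0 R)
    have he : (fun z : ℂ => z - a) ⁻¹' ball 0 R = ball a R := by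
      ext z; simp [dist_eq_norm]
    rwa [he] at this
  exact h1.mono_set hR

theorem laplacian_regLog_eq_zero {z : ℂ} (hz : 1 < ‖z‖) : laplacian regLog z = 0 := by
  have h1 : regLog =ᶠ[𝓝 z] fun w => Real.log ‖w‖ := by
    filter_upwards [continuous_norm.continuousAt.eventually (Ioi_mem_nhds hz)] with w hw
    exact regLog_eq_log (le_of_lt hw)
  rw [(laplacian_congr_nhds h1).eq_of_nhds]
  have h2 : HarmonicAt (fun w : ℂ => Real.log ‖w‖) z :=
    AnalyticAt.harmonicAt_log_norm (f := fun w => w) analyticAt_id (by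
      rintro rfl; simp at hz; linarith)
  exact h2.2.eq_of_nhds

theorem hasCompactSupport_laplacian_regLog : HasCompactSupport (laplacian regLog) := by
  refine HasCompactSupport.intro (isCompact_closedBall (0:ℂ) 1) fun z hz => ?_
  apply laplacian_regLog_eq_zero
  simpa using hz

theorem continuous_laplacian_regLog : Continuous (laplacian regLog) :=
  (contDiff_laplacian contDiff_regLog).continuous

theorem integrable_laplacian_regLog : Integrable (laplacian regLog) :=
  continuous_laplacian_regLog.integrable_of_hasCompactSupport hasCompactSupport_laplacian_regLog

theorem deriv_regLogProfile {s : ℝ} (hs : 1 < s) : deriv regLogProfile s = 1 / (2 * s) := by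
  have h1 : regLogProfile =ᶠ[𝓝 s] fun t => Real.log t / 2 := by
    filter_upwards [Ioi_mem_nhds hs] with t ht
    have ht : 1 < t := ht
    rw [regLogProfile, Real.smoothTransition.one_of_one_le (by linarith), one_mul]
  rw [h1.deriv_eq]
  rw [((Real.hasDerivAt_log (by linarith : s ≠ 0)).div_const 2).deriv]
  field_simp

/-- The mass of the kernel is computed in polar coordinates, where the integrand is the derivative of
`2 s u'(s)` in the square `s` of the radius. -/
theorem integral_laplacian_regLog : ∫ z, laplacian regLog z = 2 * Real.pi := by
  have hu := contDiff_regLogProfile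
  have hu' : ContDiff ℝ (⊤ : ℕ∞) (deriv regLogProfile) := hu.iterate_deriv 1
  have hf : ∀ p : ℝ × ℝ, laplacian regLog (Complex.polarCoord.symm p) =
      laplacian regLog (p.1 : ℂ) := by
    intro p
    rw [laplacian_regLog, laplacian_regLog, Complex.normSq_eq_norm_sq,
      Complex.norm_polarCoord_symm, Complex.normSq_eq_norm_sq, Complex.norm_real, Real.norm_eq_abs]
  rw [← Complex.integral_comp_polarCoord_symm]
  simp_rw [hf]
  have ht : polarCoord.target = Ioi (0:ℝ) ×ˢ Ioo (-Real.pi) Real.pi := rfl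
  rw [ht]
  have h1 := setIntegral_prod_mul (μ := (volume : Measure ℝ)) (ν := (volume : Measure ℝ))
    (fun r : ℝ => r * laplacian regLog (r:ℂ)) (fun _ : ℝ => (1:ℝ)) (Ioi 0)
    (Ioo (-Real.pi) Real.pi)
  have hcont : Continuous (fun r : ℝ => r * laplacian regLog (r:ℂ)) :=
    continuous_id.mul (continuous_laplacian_regLog.comp Complex.continuous_ofReal)
  have h2 : ∫ r in Ioi (0:ℝ), r * laplacian regLog (r:ℂ) =
      1 - 2 * 0 ^ 2 * deriv regLogProfile (0 ^ 2) := by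
    refine integral_Ioi_of_hasDerivAt_of_tendsto
      (f := fun r : ℝ => 2 * r ^ 2 * deriv regLogProfile (r ^ 2)) ?_ ?_ ?_ ?_
    · have : Continuous (fun r : ℝ => 2 * r ^ 2 * deriv regLogProfile (r ^ 2)) := by
        have := hu'.continuous
        fun_prop
      simpa using this.continuousWithinAt
    · intro r hr
      have a1 : HasDerivAt (fun r : ℝ => 2 * r ^ 2) (2 * (2 * r)) r := by
        simpa using (hasDerivAt_pow 2 r).const_mul 2
      have a2 : HasDerivAt (fun r : ℝ => r ^ 2) (2 * r) r := by
        simpa using (hasDerivAt_pow 2 r)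
      have a3 : HasDerivAt (fun r : ℝ => deriv regLogProfile (r ^ 2))
          (deriv (deriv regLogProfile) (r ^ 2) * (2 * r)) r := by
        have a4 : HasDerivAt (deriv regLogProfile) (deriv (deriv regLogProfile) (r ^ 2)) (r ^ 2) :=
          ((hu'.differentiable (by simp)) (r ^ 2)).hasDerivAt
        exact HasDerivAt.comp (h := fun r : ℝ => r ^ 2) r a4 a2
      convert! a1.mul a3 using 1
      rw [laplacian_regLog, Complex.normSq_ofReal]
      ring_nf
    · have : HasCompactSupport (fun r : ℝ => r * laplacian regLog (r:ℂ)) := by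
        refine HasCompactSupport.intro (isCompact_Icc (a := (-1:ℝ)) (b := 1)) fun r hr => ?_
        rw [laplacian_regLog_eq_zero, mul_zero]
        rw [Complex.norm_real, Real.norm_eq_abs]
        by_contra hcon
        exact hr (abs_le.1 (not_lt.1 hcon))
      exact (hcont.integrable_of_hasCompactSupport this).integrableOn
    · refine tendsto_const_nhds.congr' ?_
      filter_upwards [Ioi_mem_atTop 1] with r hr
      have hr : 1 < r := hr
      rw [deriv_regLogProfile (by nlinarith)]
      field_simp
  simp only [mul_one] at h1
  rw [← Measure.volume_eq_prod] at h1
  simp only [smul_eq_mul]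
  rw [h1, h2]
  simp
  rw [max_eq_left (by positivity)]
  ring

/-- The rescaled regularized logarithm, equal to `log ‖z - a‖` outside the disc of radius `ε`. -/
def regLogAt (a : ℂ) (ε : ℝ) (z : ℂ) : ℝ := regLog (ε⁻¹ • z + (-(ε⁻¹ • a))) + Real.log ε

theorem contDiff_regLogAt (a : ℂ) (ε : ℝ) : ContDiff ℝ (⊤ : ℕ∞) (regLogAt a ε) := by
  have h : ContDiff ℝ (⊤ : ℕ∞) (fun z : ℂ => ε⁻¹ • z + (-(ε⁻¹ • a))) := by fun_prop
  exact (contDiff_regLog.comp h).add contDiff_const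

theorem regLogAt_eq {a : ℂ} {ε : ℝ} {z : ℂ} (hε : 0 < ε) (hz : ε ≤ ‖z - a‖) :
    regLogAt a ε z = Real.log ‖z - a‖ := by
  have h1 : ‖ε⁻¹ • z + (-(ε⁻¹ • a))‖ = ε⁻¹ * ‖z - a‖ := by
    rw [← sub_eq_add_neg, ← smul_sub, norm_smul, Real.norm_of_nonneg (by positivity)]
  have hp : 0 < ‖z - a‖ := hε.trans_le hz
  rw [regLogAt, regLog_eq_log, h1, Real.log_mul (by positivity) (by positivity), Real.log_inv]
  · ring
  · rw [h1, inv_mul_eq_div, one_le_div hε]; exact hz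

/-- A bound uniform in `ε` by a locally integrable function. -/
theorem abs_regLogAt_le {a : ℂ} {ε : ℝ} {z : ℂ} (hε : 0 < ε) (hε1 : ε ≤ 1) (hz : z ≠ a) :
    |regLogAt a ε z| ≤ 2 * |Real.log ‖z - a‖| := by
  have hp : 0 < ‖z - a‖ := norm_pos_iff.2 (sub_ne_zero.2 hz)
  rcases le_or_gt ε ‖z - a‖ with h | h
  · rw [regLogAt_eq hε h]
    linarith [abs_nonneg (Real.log ‖z - a‖)]
  · have h1 : ‖ε⁻¹ • z + (-(ε⁻¹ • a))‖ = ε⁻¹ * ‖z - a‖ := by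
      rw [← sub_eq_add_neg, ← smul_sub, norm_smul, Real.norm_of_nonneg (by positivity)]
    have h2 := abs_regLog_sub_log_le (ε⁻¹ • z + (-(ε⁻¹ • a)))
    rw [h1, Real.log_mul (by positivity) (by positivity), Real.log_inv] at h2
    have h3 : Real.log ‖z - a‖ ≤ Real.log ε := Real.log_le_log hp h.le
    have h4 : Real.log ε ≤ 0 := Real.log_nonpos hε.le hε1
    have h5 : Real.log ‖z - a‖ ≤ 0 := by linarith
    rw [abs_of_nonpos (by linarith : -Real.log ε + Real.log ‖z - a‖ ≤ 0)] at h2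
    rw [regLogAt, abs_of_nonpos h5]
    rw [abs_le] at h2 ⊢
    constructor <;> linarith

theorem laplacian_regLogAt (a : ℂ) (ε : ℝ) (z : ℂ) : laplacian (regLogAt a ε) z =
    (ε⁻¹) ^ 2 * laplacian regLog (ε⁻¹ • (z - a)) := by
  have h1 : regLogAt a ε = (fun z => regLog (ε⁻¹ • z + (-(ε⁻¹ • a)))) + fun _ => Real.log ε := rfl
  have h : ContDiff ℝ 2 (fun z => regLog (ε⁻¹ • z + (-(ε⁻¹ • a)))) := by
    have h0 : ContDiff ℝ 2 regLog := contDiff_regLog.of_le (by norm_cast)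
    fun_prop
  rw [h1, h.contDiffAt.laplacian_add contDiffAt_const, laplacian_comp_affine contDiff_regLog]
  rw [← sub_eq_add_neg, ← smul_sub]
  simp

theorem integral_comp_smul_sub (F : ℂ → ℝ) (a : ℂ) {ε : ℝ} (hε : 0 < ε) :
    (ε⁻¹) ^ 2 * ∫ z, F (ε⁻¹ • (z - a)) = ∫ u, F u := by
  rw [integral_sub_right_eq_self (fun z => F (ε⁻¹ • z)) a, Measure.integral_comp_smul,
    Complex.finrank_real_complex, smul_eq_mul, ← mul_assoc, abs_of_pos (by positivity),
    mul_inv_cancel₀ (by positivity), one_mul]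

/-- `log ‖z - a‖ / 2π` is the fundamental solution of the Laplacian in the plane. -/
theorem integral_log_norm_mul_laplacian {f : ℂ → ℝ} (hf : ContDiff ℝ (⊤ : ℕ∞) f)
    (hfc : HasCompactSupport f) (a : ℂ) :
    ∫ z, Real.log ‖z - a‖ * laplacian f z = 2 * Real.pi * f a := by
  have hΔ := contDiff_laplacian hf
  have hΔc := hasCompactSupport_laplacian hfc
  have hA : Tendsto (fun ε : ℝ => ∫ u, laplacian regLog u * f (a + ε • u)) (𝓝[>] 0)
      (𝓝 (∫ u, laplacian regLog u * f a)) := by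
    obtain ⟨M, hM⟩ := hf.continuous.bounded_above_of_compact_support hfc
    refine tendsto_integral_filter_of_dominated_convergence
      (fun u => |laplacian regLog u| * M) ?_ ?_ ?_ ?_
    · refine Eventually.of_forall fun ε => ?_
      have := hf.continuous
      have := continuous_laplacian_regLog
      exact Continuous.aestronglyMeasurable (by fun_prop)
    · refine Eventually.of_forall fun ε => Eventually.of_forall fun u => ?_
      rw [norm_mul, Real.norm_eq_abs (laplacian regLog u)]
      gcongr
      exact hM _
    · exact integrable_laplacian_regLog.abs.mul_const M
    · refine Eventually.of_forall fun u => ?_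
      have hc : Continuous (fun ε : ℝ => laplacian regLog u * f (a + ε • u)) := by
        have := hf.continuous
        fun_prop
      have := (hc.tendsto 0).mono_left (nhdsWithin_le_nhds (s := Ioi 0))
      simpa using this
  have hB : Tendsto (fun ε : ℝ => ∫ z, regLogAt a ε z * laplacian f z) (𝓝[>] 0)
      (𝓝 (∫ z, Real.log ‖z - a‖ * laplacian f z)) := by
    have hlog := locallyIntegrable_log_norm_sub a
    have hint : Integrable (fun z => |Real.log ‖z - a‖| * |laplacian f z|) := by
      have h1 : Integrable (fun z => Real.log ‖z - a‖ * laplacian f z) := by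
        have := hlog.integrable_smul_right_of_hasCompactSupport hΔ.continuous hΔc
        simpa using this
      simpa [abs_mul] using h1.abs
    refine tendsto_integral_filter_of_dominated_convergence
      (fun z => 2 * (|Real.log ‖z - a‖| * |laplacian f z|)) ?_ ?_ (hint.const_mul 2) ?_
    · refine Eventually.of_forall fun ε => ?_
      exact ((contDiff_regLogAt a ε).continuous.mul hΔ.continuous).aestronglyMeasurable
    · have h1 : ∀ᶠ ε : ℝ in 𝓝[>] 0, ε < 1 := nhdsWithin_le_nhds (Iio_mem_nhds one_pos)
      filter_upwards [self_mem_nhdsWithin, h1] with ε hε hε1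
      filter_upwards [Measure.ae_ne volume a] with z hz
      rw [norm_mul, Real.norm_eq_abs, Real.norm_eq_abs, ← mul_assoc]
      gcongr
      exact abs_regLogAt_le hε hε1.le hz
    · filter_upwards [Measure.ae_ne volume a] with z hz
      have hp : 0 < ‖z - a‖ := norm_pos_iff.2 (sub_ne_zero.2 hz)
      refine tendsto_const_nhds.congr' ?_
      have h1 : ∀ᶠ ε : ℝ in 𝓝[>] 0, ε < ‖z - a‖ := nhdsWithin_le_nhds (Iio_mem_nhds hp)
      filter_upwards [self_mem_nhdsWithin, h1] with ε hε hε1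
      rw [regLogAt_eq hε hε1.le]
  have hEq : ∀ ε : ℝ, 0 < ε → ∫ z, regLogAt a ε z * laplacian f z =
      ∫ u, laplacian regLog u * f (a + ε • u) := by
    intro ε hε
    rw [integral_mul_laplacian hf hfc (contDiff_regLogAt a ε),
      ← integral_comp_smul_sub (fun u => laplacian regLog u * f (a + ε • u)) a hε, ← integral_const_mul]
    congr 1
    ext z
    rw [laplacian_regLogAt, smul_smul, mul_inv_cancel₀ hε.ne', one_smul, add_sub_cancel, mul_assoc]
  have hB' : Tendsto (fun ε : ℝ => ∫ u, laplacian regLog u * f (a + ε • u)) (𝓝[>] 0)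
      (𝓝 (∫ z, Real.log ‖z - a‖ * laplacian f z)) := by
    refine hB.congr' ?_
    filter_upwards [self_mem_nhdsWithin] with ε hε
    exact hEq ε hε
  rw [tendsto_nhds_unique hB' hA, integral_mul_const, integral_laplacian_regLog]

end FundamentalSolution

/-! ### Weyl's lemma -/

section Weyl
open Laplacian InnerProductSpace ContinuousLinearMap Convolution

theorem fderiv_convolution_apply {v η : ℂ → ℝ} (hv : LocallyIntegrable v)
    (hη : ContDiff ℝ (⊤ : ℕ∞) η) (hηc : HasCompactSupport η) (w e : ℂ) :
    fderiv ℝ (v ⋆[mul ℝ ℝ] η) w e = (v ⋆[mul ℝ ℝ] fun y => fderiv ℝ η y e) w := by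
  have h1 : ContDiff ℝ 1 η := hη.of_le (by norm_cast)
  rw [(hηc.hasFDerivAt_convolution_right (mul ℝ ℝ) hv h1 w).fderiv,
    convolution_precompR_apply (mul ℝ ℝ) hv (hηc.fderiv ℝ) (h1.continuous_fderiv (by norm_num))]

theorem laplacian_convolution {v η : ℂ → ℝ} (hv : LocallyIntegrable v)
    (hη : ContDiff ℝ (⊤ : ℕ∞) η) (hηc : HasCompactSupport η) (w : ℂ) :
    laplacian (v ⋆[mul ℝ ℝ] η) w = ∫ t, v t * laplacian η (w - t) := by
  have hfcv : ∀ e : ℂ, HasCompactSupport (fun w => fderiv ℝ η w e) := fun e =>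
    (hηc.fderiv ℝ).comp_left (g := fun L : ℂ →L[ℝ] ℝ => L e) rfl
  have hfcvv : ∀ e : ℂ, HasCompactSupport (fun z => fderiv ℝ (fun w => fderiv ℝ η w e) z e) :=
    fun e => ((hfcv e).fderiv ℝ).comp_left (g := fun L : ℂ →L[ℝ] ℝ => L e) rfl
  have hs : ContDiff ℝ 2 (v ⋆[mul ℝ ℝ] η) :=
    hηc.contDiff_convolution_right (mul ℝ ℝ) hv (n := 2) (hη.of_le (by norm_cast))
  have h2 : ∀ e, fderiv ℝ (fun z => fderiv ℝ (v ⋆[mul ℝ ℝ] η) z e) w e =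
      ∫ t, v t * fderiv ℝ (fun z => fderiv ℝ η z e) (w - t) e := by
    intro e
    have : (fun z => fderiv ℝ (v ⋆[mul ℝ ℝ] η) z e) =
        (v ⋆[mul ℝ ℝ] fun y => fderiv ℝ η y e) := by
      ext z; exact fderiv_convolution_apply hv hη hηc z e
    rw [this, fderiv_convolution_apply hv (contDiff_fderiv_apply hη e) (hfcv e)]
    rfl
  have hi : ∀ e, Integrable (fun t => v t * fderiv ℝ (fun z => fderiv ℝ η z e) (w - t) e) := by
    intro e
    exact (hfcvv e).convolutionExists_right (mul ℝ ℝ) hv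
      (contDiff_fderiv_apply (contDiff_fderiv_apply hη e) e).continuous w
  rw [laplacian_eq_fderiv hs, h2, h2, ← integral_add (hi _) (hi _)]
  congr 1
  ext t
  rw [laplacian_eq_fderiv (hη.of_le (by norm_cast))]
  ring

theorem laplacian_regLog_neg (z : ℂ) : laplacian regLog (-z) = laplacian regLog z := by
  rw [laplacian_regLog, laplacian_regLog, Complex.normSq_neg]

/-- **Weyl's lemma**: a locally integrable function whose distributional Laplacian vanishes in a
disc agrees almost everywhere, in a smaller concentric disc, with the real part of a holomorphic
function. -/
theorem weyl {v : ℂ → ℝ} (hv : LocallyIntegrable v) {r : ℝ}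
    (h : ∀ f : ℂ → ℝ, ContDiff ℝ (⊤ : ℕ∞) f → HasCompactSupport f → tsupport f ⊆ ball 0 r →
      ∫ z, v z * laplacian f z = 0) :
    ∃ H : ℂ → ℂ, DifferentiableOn ℂ H (ball 0 (r - 1)) ∧
      ∀ᵐ w, w ∈ ball (0:ℂ) (r - 1) → v w = (H w).re := by
  set κ := laplacian regLog with hκ
  have hκs : ContDiff ℝ (⊤ : ℕ∞) κ := contDiff_laplacian contDiff_regLog
  have hκc : HasCompactSupport κ := hasCompactSupport_laplacian_regLog
  have hκn : ∀ z, κ (-z) = κ z := laplacian_regLog_neg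
  set V := (v ⋆[mul ℝ ℝ] κ) with hV
  have hVs : ContDiff ℝ 2 V :=
    hκc.contDiff_convolution_right (mul ℝ ℝ) hv (n := 2) (hκs.of_le (by norm_cast))
  have hVw : ∀ w, V w = ∫ z, v z * κ (z - w) := by
    intro w
    change ∫ z, v z * κ (w - z) = _
    congr 1; ext z
    rw [← hκn (z - w), neg_sub]
  have hball : ∀ w ∈ ball (0:ℂ) (r - 1), closedBall w 1 ⊆ ball 0 r := by
    intro w hw x hx
    rw [mem_ball] at hw ⊢
    rw [mem_closedBall] at hx
    linarith [dist_triangle x w 0]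
  -- the mollifications of `v` at different scales agree: the difference of two rescaled
  -- regularized logarithms has compact support
  have hscale : ∀ w ∈ ball (0:ℂ) (r - 1), ∀ ε : ℝ, 0 < ε → ε ≤ 1 →
      ∫ z, v z * ((ε⁻¹) ^ 2 * κ (ε⁻¹ • (z - w))) = V w := by
    intro w hw ε hε hε1
    set f : ℂ → ℝ := regLogAt w ε - regLogAt w 1 with hf
    have hfs : ContDiff ℝ (⊤ : ℕ∞) f := (contDiff_regLogAt w ε).sub (contDiff_regLogAt w 1)
    have hsup : tsupport f ⊆ closedBall w 1 := by
      apply closure_minimal _ isClosed_closedBall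
      intro z hz
      by_contra hcon
      rw [mem_closedBall, dist_eq_norm, not_le] at hcon
      apply hz
      rw [hf, Pi.sub_apply, regLogAt_eq hε (by linarith), regLogAt_eq one_pos hcon.le, sub_self]
    have hfc : HasCompactSupport f :=
      (isCompact_closedBall w 1).of_isClosed_subset (isClosed_tsupport _) hsup
    have h0 := h f hfs hfc (hsup.trans (hball w hw))
    have hΔ : ∀ z, laplacian f z = (ε⁻¹) ^ 2 * κ (ε⁻¹ • (z - w)) - κ (z - w) := by
      intro z
      rw [hf, ContDiffAt.laplacian_sub ((contDiff_regLogAt w ε).of_le (by norm_cast)).contDiffAt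
        ((contDiff_regLogAt w 1).of_le (by norm_cast)).contDiffAt, laplacian_regLogAt,
        laplacian_regLogAt]
      simp [hκ]
    have hiκ : Integrable (fun z => v z * κ (z - w)) := by
      have hc : HasCompactSupport (fun z => κ (z - w)) :=
        hκc.comp_homeomorph (Homeomorph.subRight w)
      have := hv.integrable_smul_right_of_hasCompactSupport
        (hκs.continuous.comp (continuous_sub_right w)) hc
      simpa using this
    have hiε : Integrable (fun z => v z * ((ε⁻¹) ^ 2 * κ (ε⁻¹ • (z - w)))) := by
      have hΔi : Integrable (fun z => v z * laplacian f z) := by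
        have := hv.integrable_smul_right_of_hasCompactSupport
          (contDiff_laplacian hfs).continuous (hasCompactSupport_laplacian hfc)
        simpa using this
      convert! hΔi.add hiκ using 1
      ext z
      rw [Pi.add_apply, hΔ]; ring
    rw [hVw, ← sub_eq_zero, ← integral_sub hiε hiκ, ← h0]
    congr 1
    ext z
    rw [hΔ]; ring
  have hharm : HarmonicOnNhd V (ball 0 (r - 1)) := by
    intro w hw
    refine ⟨hVs.contDiffAt, ?_⟩
    filter_upwards [isOpen_ball.mem_nhds hw] with x hx
    rw [laplacian_convolution hv hκs hκc, Pi.zero_apply]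
    have hneg : ∀ z, laplacian κ (x - z) = laplacian (fun y => κ (y - x)) z := by
      intro z
      have h1 : (fun y => κ (y - x)) = fun y => κ ((-1 : ℝ) • y + x) := by
        ext y; rw [← hκn, neg_sub, neg_one_smul, neg_add_eq_sub]
      rw [h1, laplacian_comp_affine hκs, neg_one_smul, neg_add_eq_sub]
      ring
    simp_rw [hneg]
    apply h
    · exact hκs.comp (by fun_prop : ContDiff ℝ (⊤ : ℕ∞) fun y : ℂ => y - x)
    · exact hκc.comp_homeomorph (Homeomorph.subRight x)
    · refine (closure_minimal ?_ isClosed_closedBall).trans (hball x hx)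
      intro z hz
      by_contra hcon
      rw [mem_closedBall, dist_eq_norm, not_le] at hcon
      exact hz (laplacian_regLog_eq_zero hcon)
  obtain ⟨F, hF, hFV⟩ := hharm.exists_analyticOnNhd_ball_re_eq
  have hlim : ∀ᵐ w, w ∈ ball (0:ℂ) (r - 1) → V w = 2 * Real.pi * v w := by
    obtain ⟨M, hM⟩ := hκs.continuous.bounded_above_of_compact_support hκc
    filter_upwards [IsUnifLocDoublingMeasure.ae_tendsto_average_norm_sub volume hv 1] with w hw hwb
    have ht := hw (fun _ : ℝ => w) (fun ε : ℝ => ε) (l := 𝓝[>] 0) tendsto_id (by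
      filter_upwards [self_mem_nhdsWithin] with ε hε
      have hε : (0:ℝ) < ε := hε
      simpa using hε.le)
    have hbd : ∀ ε : ℝ, 0 < ε → ε ≤ 1 → |V w - 2 * Real.pi * v w| ≤
        (M * Real.pi) * ⨍ y in closedBall w ε, ‖v y - v w‖ := by
      intro ε hε hε1
      have hc : HasCompactSupport (fun z => (ε⁻¹) ^ 2 * κ (ε⁻¹ • (z - w))) := by
        refine HasCompactSupport.intro (isCompact_closedBall w ε) fun z hz => ?_
        rw [mem_closedBall, dist_eq_norm, not_le] at hz
        rw [hκ, laplacian_regLog_eq_zero, mul_zero]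
        rw [norm_smul, Real.norm_of_nonneg (by positivity), inv_mul_eq_div, one_lt_div hε]
        exact hz
      have hcont : Continuous (fun z => (ε⁻¹) ^ 2 * κ (ε⁻¹ • (z - w))) := by
        have := hκs.continuous
        fun_prop
      have hi1 : Integrable (fun z => v z * ((ε⁻¹) ^ 2 * κ (ε⁻¹ • (z - w)))) := by
        simpa using hv.integrable_smul_right_of_hasCompactSupport hcont hc
      have hi2 : Integrable (fun z => v w * ((ε⁻¹) ^ 2 * κ (ε⁻¹ • (z - w)))) :=
        (hcont.integrable_of_hasCompactSupport hc).const_mul _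
      have hV2 : V w - 2 * Real.pi * v w =
          ∫ z, (v z - v w) * ((ε⁻¹) ^ 2 * κ (ε⁻¹ • (z - w))) := by
        simp_rw [sub_mul]
        rw [integral_sub hi1 hi2, hscale w hwb ε hε hε1, integral_const_mul, integral_const_mul,
          integral_comp_smul_sub κ w hε, integral_laplacian_regLog]
        ring
      have hvol : volume.real (closedBall w ε) = Real.pi * ε ^ 2 := by
        rw [Measure.real, Complex.volume_closedBall]
        simp [ENNReal.toReal_mul, hε.le]
        ring
      rw [hV2, ← Real.norm_eq_abs]
      have hset : ∫ z, (v z - v w) * ((ε⁻¹) ^ 2 * κ (ε⁻¹ • (z - w))) =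
          ∫ z in closedBall w ε, (v z - v w) * ((ε⁻¹) ^ 2 * κ (ε⁻¹ • (z - w))) := by
        symm
        apply setIntegral_eq_integral_of_forall_compl_eq_zero
        intro z hz
        rw [mem_closedBall, dist_eq_norm, not_le] at hz
        rw [hκ, laplacian_regLog_eq_zero, mul_zero, mul_zero]
        rw [norm_smul, Real.norm_of_nonneg (by positivity), inv_mul_eq_div, one_lt_div hε]
        exact hz
      rw [hset, setAverage_eq, hvol, smul_eq_mul]
      have hiv : IntegrableOn (fun z => ‖v z - v w‖) (closedBall w ε) :=
        ((hv.integrableOn_isCompact (isCompact_closedBall w ε)).sub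
          (integrableOn_const (isCompact_closedBall w ε).measure_lt_top.ne)).norm
      calc ‖∫ z in closedBall w ε, (v z - v w) * ((ε⁻¹) ^ 2 * κ (ε⁻¹ • (z - w)))‖
          ≤ ∫ z in closedBall w ε, ‖v z - v w‖ * ((ε⁻¹) ^ 2 * M) := by
            apply norm_integral_le_of_norm_le (hiv.mul_const _)
            refine Eventually.of_forall fun z => ?_
            rw [norm_mul, norm_mul, Real.norm_of_nonneg (by positivity : 0 ≤ (ε⁻¹) ^ 2)]
            gcongr
            exact hM _
        _ = _ := by
            rw [integral_mul_const]
            have := Real.pi_pos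
            field_simp
    have ht2 := (ht.const_mul (M * Real.pi))
    rw [mul_zero] at ht2
    have h1 : ∀ᶠ ε : ℝ in 𝓝[>] 0, ε < 1 := nhdsWithin_le_nhds (Iio_mem_nhds one_pos)
    have h2 : |V w - 2 * Real.pi * v w| ≤ 0 := by
      refine ge_of_tendsto ht2 ?_
      filter_upwards [self_mem_nhdsWithin, h1] with ε hε hε1
      exact hbd ε hε hε1.le
    have := abs_nonpos_iff.1 h2
    linarith
  refine ⟨fun w => ((2 * Real.pi)⁻¹ : ℝ) * F w, ?_, ?_⟩
  · exact (hF.differentiableOn).const_mul _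
  · filter_upwards [hlim] with w hw hwb
    have h1 := hw hwb
    have h2 : (F w).re = V w := hFV hwb
    rw [Complex.re_ofReal_mul, h2, h1]
    have := Real.pi_pos
    field_simp

end Weyl

/-! ### Decomposition of a doubling measure into pieces of equal mass -/

section Decomposition

/-- A partition of the plane into cells adapted to a positive 1-Lipschitz radius function `R`,
together with a map sending each cell to a nearby cell whose centre is farther from the origin. -/
theorem exists_cells {R : ℂ → ℝ} (hR : ∀ z, 0 < R z) (hL : ∀ z w, R z ≤ R w + dist z w) :
    ∃ (c : ℕ → ℂ) (Q : ℕ → Set ℂ) (π : ℕ → ℕ),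
      (∀ n, MeasurableSet (Q n)) ∧ Pairwise (Function.onFun Disjoint Q) ∧ ⋃ n, Q n = univ ∧
      (∀ n, ball (c n) (R (c n) / 8) ⊆ Q n) ∧ (∀ n, Q n ⊆ ball (c n) (R (c n))) ∧
      (∀ n, ‖c n‖ < ‖c (π n)‖) ∧ ∀ n, dist (c n) (c (π n)) ≤ 6 * R (c n) := by
  have hRc : Continuous R := (LipschitzWith.of_le_add hL).continuous
  -- a maximal separated set
  obtain ⟨Z, hZ⟩ := zorn_subset {Z : Set ℂ | Z.Pairwise fun z w => max (R z) (R w) / 4 ≤ dist z w}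
    (by
      intro S hS hchain
      refine ⟨⋃₀ S, ?_, fun s hs => subset_sUnion_of_mem hs⟩
      rw [mem_ofPred_eq, pairwise_sUnion hchain.directedOn]
      exact fun a ha => hS ha)
  have hsep : Z.Pairwise fun z w => max (R z) (R w) / 4 ≤ dist z w := hZ.1
  have hcov : ∀ w, ∃ z ∈ Z, dist w z < max (R w) (R z) / 4 := by
    intro w
    by_contra! hcon
    have hw : insert w Z ∈ {Z : Set ℂ | Z.Pairwise fun z w => max (R z) (R w) / 4 ≤ dist z w} := by
      rw [mem_ofPred_eq, pairwise_insert]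
      refine ⟨hsep, fun b hb _ => ⟨hcon b hb, ?_⟩⟩
      rw [dist_comm, max_comm]; exact hcon b hb
    have hwZ : w ∈ Z := hZ.2 hw (subset_insert w Z) (mem_insert w Z)
    have := hcon w hwZ
    rw [dist_self, max_self] at this
    linarith [hR w]
  have hnear : ∀ w z, dist w z < max (R w) (R z) / 4 →
      R w ≤ 4 / 3 * R z ∧ R z ≤ 4 / 3 * R w ∧ dist w z ≤ R w / 3 ∧ dist w z ≤ R z / 3 := by
    intro w z h
    have h1 := hL w z
    have h2 := hL z w
    rw [dist_comm] at h2
    rcases le_total (R w) (R z) with h3 | h3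
    · rw [max_eq_right h3] at h
      refine ⟨?_, ?_, ?_, ?_⟩ <;> linarith
    · rw [max_eq_left h3] at h
      refine ⟨?_, ?_, ?_, ?_⟩ <;> linarith
  have hparent : ∀ z ∈ Z, ∃ z' ∈ Z, ‖z‖ < ‖z'‖ ∧ dist z z' ≤ 6 * R z := by
    intro z _
    have hz := hR z
    obtain ⟨u, hu, hzu⟩ : ∃ u : ℂ, ‖u‖ = 1 ∧ z = ‖z‖ • u := by
      by_cases h0 : z = 0
      · exact ⟨1, by simp, by simp [h0]⟩
      · refine ⟨‖z‖⁻¹ • z, ?_, ?_⟩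
        · rw [norm_smul, norm_inv, norm_norm, inv_mul_cancel₀ (norm_ne_zero_iff.2 h0)]
        · rw [smul_smul, mul_inv_cancel₀ (norm_ne_zero_iff.2 h0), one_smul]
    set w : ℂ := z + (4 * R z) • u with hw
    have hwz : dist w z = 4 * R z := by
      rw [hw, dist_eq_norm, add_sub_cancel_left, norm_smul, hu, Real.norm_of_nonneg (by positivity),
        mul_one]
    have hwn : ‖w‖ = ‖z‖ + 4 * R z := by
      have : w = (‖z‖ + 4 * R z) • u := by
        rw [hw, add_smul]; nth_rewrite 1 [hzu]; rfl
      rw [this, norm_smul, hu, Real.norm_of_nonneg (by positivity), mul_one]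
    obtain ⟨z', hz', hd⟩ := hcov w
    obtain ⟨-, -, h3, -⟩ := hnear w z' hd
    have h4 : R w ≤ 5 * R z := by
      have := hL w z
      linarith
    refine ⟨z', hz', ?_, ?_⟩
    · have : ‖w‖ ≤ ‖z'‖ + dist w z' := by
        rw [dist_eq_norm]
        calc ‖w‖ = ‖z' + (w - z')‖ := by ring_nf
          _ ≤ _ := norm_add_le _ _
      linarith
    · have := dist_triangle z w z'
      rw [dist_comm z w] at this
      linarith
  have hdisjB : Z.PairwiseDisjoint fun z => ball z (R z / 8) := by
    intro z hz w hw hne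
    apply ball_disjoint_ball
    have := hsep hz hw hne
    linarith [le_max_left (R z) (R w), le_max_right (R z) (R w)]
  have hcount : Z.Countable := hdisjB.countable_of_isOpen (fun z _ => isOpen_ball)
    (fun z _ => ⟨z, mem_ball_self (by linarith [hR z])⟩)
  have hinf : Z.Infinite := by
    intro hfin
    obtain ⟨z₁, hz₁, -⟩ := hcov 0
    obtain ⟨z, hz, hmax⟩ := exists_max_image Z (fun z => ‖z‖) hfin ⟨z₁, hz₁⟩
    obtain ⟨z', hz', hlt, -⟩ := hparent z hz
    linarith [hmax z' hz']
  have : Countable Z := hcount.to_subtype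
  have : Infinite Z := hinf.to_subtype
  obtain ⟨hden⟩ := nonempty_denumerable_iff.2 ⟨‹Countable Z›, ‹Infinite Z›⟩
  set e : ℕ ≃ Z := (Denumerable.eqv Z).symm with he
  set c : ℕ → ℂ := fun n => (e n : ℂ) with hc
  have hcinj : Function.Injective c := Subtype.val_injective.comp e.injective
  have hcZ : ∀ n, c n ∈ Z := fun n => (e n).2
  have hcsurj : ∀ z ∈ Z, ∃ n, c n = z := fun z hz => ⟨e.symm ⟨z, hz⟩, by simp [hc]⟩
  set B : ℕ → Set ℂ := fun n => ball (c n) (R (c n) / 8) with hB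
  set V : ℕ → Set ℂ := fun n => {w | dist w (c n) < max (R w) (R (c n)) / 4} with hV
  set W : ℕ → Set ℂ := fun n => V n \ ⋃ j ∈ {j | j ≠ n}, B j with hW
  have hBV : ∀ n, B n ⊆ V n := by
    intro n w hw
    have hw : dist w (c n) < R (c n) / 8 := hw
    change dist w (c n) < max (R w) (R (c n)) / 4
    linarith [le_max_right (R w) (R (c n)), hR (c n)]
  have hBdisj : ∀ i j, i ≠ j → Disjoint (B i) (B j) := fun i j hij =>
    hdisjB (hcZ i) (hcZ j) (fun h => hij (hcinj h))
  have hBW : ∀ n, B n ⊆ W n := by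
    intro n w hw
    refine ⟨hBV n hw, ?_⟩
    rw [mem_iUnion₂]
    rintro ⟨j, hj, hwj⟩
    exact (Set.disjoint_left.1 (hBdisj j n hj)) hwj hw
  have hWU : ⋃ n, W n = univ := by
    rw [eq_univ_iff_forall]
    intro w
    rw [mem_iUnion]
    by_cases h : ∃ j, w ∈ B j
    · obtain ⟨j, hj⟩ := h
      exact ⟨j, hBW j hj⟩
    · push Not at h
      obtain ⟨z, hz, hd⟩ := hcov w
      obtain ⟨n, rfl⟩ := hcsurj z hz
      refine ⟨n, hd, ?_⟩
      rw [mem_iUnion₂]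
      rintro ⟨j, hj, hwj⟩
      exact h j hwj
  choose π' hπ' using fun n => hparent (c n) (hcZ n)
  choose π hπ using fun n => hcsurj (π' n) (hπ' n).1
  refine ⟨c, disjointed W, π, ?_, disjoint_disjointed W, by rw [iUnion_disjointed, hWU], ?_, ?_,
    ?_, ?_⟩
  · refine MeasurableSet.disjointed fun n => MeasurableSet.diff ?_ ?_
    · apply IsOpen.measurableSet
      exact isOpen_lt (by fun_prop) (by fun_prop)
    · exact MeasurableSet.biUnion (to_countable _) fun j _ => isOpen_ball.measurableSet
  · intro n w hw
    rw [disjointed_eq_inter_compl]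
    refine ⟨hBW n hw, ?_⟩
    rw [mem_iInter₂]
    intro j hj hwj
    apply hwj.2
    rw [mem_iUnion₂]
    exact ⟨n, (ne_of_lt hj).symm, hw⟩
  · intro n
    refine (disjointed_subset W n).trans fun w hw => ?_
    have := (hnear w (c n) hw.1).2.2.2
    rw [mem_ball]
    linarith [hR (c n)]
  · intro n
    rw [hπ n]; exact (hπ' n).2.1
  · intro n
    rw [hπ n]; exact (hπ' n).2.2

/-- Passing remainders along a well-founded parent map: every cell `k` of mass `q k ≥ m` sends a
mass `r k < m` to its parent `π k`, in such a way that what remains in each cell is a positive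
integer multiple of `m`. -/
theorem exists_remainders {q : ℕ → ℝ} {m : ℝ} (hm : 0 < m) (hq : ∀ k, m ≤ q k) {π : ℕ → ℕ}
    {h : ℕ → ℝ} (hh : ∀ k, h k < h (π k)) (hfin : ∀ k, {j | h j ≤ h k}.Finite) :
    ∃ (r : ℕ → ℝ) (ch : ℕ → Finset ℕ) (n : ℕ → ℕ), (∀ k, 0 ≤ r k ∧ r k < m) ∧
      (∀ k c, c ∈ ch k ↔ π c = k) ∧ ∀ k, 0 < n k ∧ q k - r k + ∑ c ∈ ch k, r c = n k * m := by
  have hchfin : ∀ k, {c | π c = k}.Finite := fun k => (hfin k).subset fun c hc => by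
    have hc : π c = k := hc
    rw [← hc]; exact (hh c).le
  set ch : ℕ → Finset ℕ := fun k => (hchfin k).toFinset with hch
  have hmem : ∀ k c, c ∈ ch k ↔ π c = k := fun k c => by simp [hch]
  set rk : ℕ → ℕ := fun k => (hfin k).toFinset.card with hrk
  have hlt : ∀ k, ∀ c ∈ ch k, rk c < rk k := by
    intro k c hc
    have hk := (hmem k c).1 hc
    apply Finset.card_lt_card
    rw [Finset.ssubset_iff_of_subset]
    · refine ⟨k, by simp, ?_⟩
      simp only [Finite.mem_toFinset, mem_ofPred_eq, not_le]
      rw [← hk]; exact hh c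
    · intro j hj
      simp only [Finite.mem_toFinset, mem_ofPred_eq] at hj ⊢
      rw [← hk]; exact hj.trans (hh c).le
  have hwf : WellFounded (fun a b => rk a < rk b) := (measure rk).wf
  set r : ℕ → ℝ := hwf.fix fun k ih =>
    m * Int.fract ((q k + ∑ c ∈ (ch k).attach, ih c (hlt k c c.2)) / m) with hr
  have hreq : ∀ k, r k = m * Int.fract ((q k + ∑ c ∈ ch k, r c) / m) := by
    intro k
    rw [hr, hwf.fix_eq, ← hr]
    rw [Finset.sum_attach (ch k) (fun c => r c)]
  have hr01 : ∀ k, 0 ≤ r k ∧ r k < m := by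
    intro k
    rw [hreq k]
    refine ⟨mul_nonneg hm.le (Int.fract_nonneg _), ?_⟩
    have := Int.fract_lt_one ((q k + ∑ c ∈ ch k, r c) / m)
    nlinarith
  have hint : ∀ k, q k - r k + ∑ c ∈ ch k, r c = ⌊(q k + ∑ c ∈ ch k, r c) / m⌋ * m := by
    intro k
    have h1 := hreq k
    rw [Int.fract, mul_sub, mul_div_cancel₀ _ hm.ne'] at h1
    linarith
  have hpos : ∀ k, 0 < ⌊(q k + ∑ c ∈ ch k, r c) / m⌋ := by
    intro k
    have h1 := hint k
    have h2 : 0 ≤ ∑ c ∈ ch k, r c := Finset.sum_nonneg fun c _ => (hr01 c).1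
    have h3 : 0 < (⌊(q k + ∑ c ∈ ch k, r c) / m⌋ : ℝ) * m := by
      rw [← h1]
      linarith [hq k, (hr01 k).2]
    have h4 := pos_of_mul_pos_left h3 hm.le
    exact_mod_cast h4
  refine ⟨r, ch, fun k => ⌊(q k + ∑ c ∈ ch k, r c) / m⌋.toNat, hr01, hmem, fun k => ⟨?_, ?_⟩⟩
  · have := hpos k
    simp only
    omega
  · rw [hint k]
    congr 1
    have : ((⌊(q k + ∑ c ∈ ch k, r c) / m⌋.toNat : ℤ) : ℝ) = ⌊(q k + ∑ c ∈ ch k, r c) / m⌋ := by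
      rw [Int.toNat_of_nonneg (hpos k).le]
    rw [← this]
    norm_cast

variable {μ : Measure ℂ} [IsLocallyFiniteMeasure μ] {C q : ℝ}

/-- A doubling measure splits into countably many pieces of the same prescribed mass `m`, each of
them supported in a disc of radius comparable to `rho` at its centre. -/
theorem DoublingBounds.exists_decomposition (B : DoublingBounds μ C q) {m : ℝ} (hm : 0 < m) :
    ∃ (M : ℝ) (c : ℕ → ℂ) (ν : ℕ → Measure ℂ), 1 ≤ M ∧ Measure.sum ν = μ ∧
      (∀ k, ν k univ = ENNReal.ofReal m) ∧
      ∀ k, ν k (closedBall (c k) (M * rho μ (c k)))ᶜ = 0 := by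
  have hC := B.one_le
  -- radii for which the balls of radius `R / 8` have mass at least `m`
  set a : ℝ≥0 := Real.toNNReal (1 / (m * C ^ 3)) with ha
  have haR : (a : ℝ) = 1 / (m * C ^ 3) := Real.coe_toNNReal _ (by positivity)
  have ha0 : 0 < a := by
    rw [← NNReal.coe_pos, haR]; positivity
  have B' := B.smul ha0
  set R := rho (a • μ) with hRdef
  obtain ⟨K, hK1, hK⟩ := B.exists_rho_smul_le ha0
  obtain ⟨K', hK'1, hK'⟩ := B'.exists_comparable 6
  have hRpos : ∀ z, 0 < R z := B'.rho_pos
  have hmass : ∀ z, m ≤ μ.real (ball z (R z / 8)) := by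
    intro z
    have h1 := B'.measure_ball_rho z
    rw [measureReal_nnreal_smul_apply, haR] at h1
    have h2 := B.upper_pow z (r := R z / 8) (by linarith [hRpos z]) 3
    have h3 : (2:ℝ) ^ 3 * (R z / 8) = R z := by ring
    rw [h3] at h2
    have h4 : μ.real (ball z (R z)) = m * C ^ 3 := by
      have : m * C ^ 3 ≠ 0 := by positivity
      field_simp at h1
      linarith
    rw [h4, mul_comm] at h2
    exact le_of_mul_le_mul_left h2 (by positivity)
  obtain ⟨c, Q, π, hQm, hQd, hQU, hQB, hQR, hπ, hπd⟩ := exists_cells hRpos B'.rho_le_add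
  have hQtop : ∀ k, μ (Q k) ≠ ⊤ := fun k =>
    ne_top_of_le_ne_top (measure_ball_ne_top _ _) (measure_mono (hQR k))
  have hQmass : ∀ k, m ≤ μ.real (Q k) := fun k =>
    (hmass (c k)).trans (measureReal_mono (hQB k) (hQtop k))
  have hfin : ∀ k, {j | ‖c j‖ ≤ ‖c k‖}.Finite := by
    intro k
    set S := {j | ‖c j‖ ≤ ‖c k‖} with hS
    have hU : ⋃ j : S, Q j ⊆ ball 0 (2 * ‖c k‖ + R 0) := by
      refine iUnion_subset fun ⟨j, hj⟩ w hw => ?_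
      have h1 := hQR j hw
      have hj : ‖c j‖ ≤ ‖c k‖ := hj
      have h2 := B'.rho_le_add (c j) 0
      rw [mem_ball] at h1
      rw [dist_zero_right] at h2
      rw [mem_ball]
      have h3 := dist_triangle w (c j) 0
      rw [dist_zero_right (c j)] at h3
      have : rho (a • μ) (c j) = R (c j) := rfl
      have : rho (a • μ) 0 = R 0 := rfl
      linarith
    have h1 := Measure.finite_const_le_meas_of_disjoint_iUnion μ
      (ENNReal.ofReal_pos.2 hm) (fun j : S => hQm j)
      (fun i j hij => hQd (fun h => hij (Subtype.ext h)))
      (ne_top_of_le_ne_top (measure_ball_ne_top _ _) (measure_mono hU))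
    have h2 : {j : S | ENNReal.ofReal m ≤ μ (Q j)} = univ := by
      rw [eq_univ_iff_forall]
      intro j
      exact (ENNReal.ofReal_le_iff_le_toReal (hQtop j)).2 (hQmass j)
    rw [h2] at h1
    have : Finite S := Set.finite_univ_iff.1 h1
    exact Set.toFinite S
  obtain ⟨r, ch, n, hr, hch, hn⟩ := exists_remainders hm hQmass hπ hfin
  set θ : ℕ → ℝ := fun k => r k / μ.real (Q k) with hθ
  have hqpos : ∀ k, 0 < μ.real (Q k) := fun k => hm.trans_le (hQmass k)
  have hθ01 : ∀ k, 0 ≤ θ k ∧ θ k ≤ 1 := fun k =>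
    ⟨div_nonneg (hr k).1 (hqpos k).le,
      (div_le_one (hqpos k)).2 ((hr k).2.le.trans (hQmass k))⟩
  have hθq : ∀ k, ENNReal.ofReal (θ k) * μ (Q k) = ENNReal.ofReal (r k) := by
    intro k
    rw [← ENNReal.ofReal_toReal (hQtop k), ← ENNReal.ofReal_mul (hθ01 k).1]
    congr 1
    exact div_mul_cancel₀ _ (hqpos k).ne'
  set τ : ℕ → Measure ℂ := fun k => ENNReal.ofReal (1 - θ k) • μ.restrict (Q k) +
    Measure.sum fun j => (if π j = k then ENNReal.ofReal (θ j) else 0) • μ.restrict (Q j) with hτ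
  have hτs : ∀ k s, MeasurableSet s → τ k s = ENNReal.ofReal (1 - θ k) * μ.restrict (Q k) s +
      ∑' j, (if π j = k then ENNReal.ofReal (θ j) else 0) * μ.restrict (Q j) s := by
    intro k s hs
    rw [hτ]
    simp only [Measure.coe_add, Pi.add_apply, Measure.sum_apply _ hs, Measure.smul_apply,
      smul_eq_mul]
  have hτmass : ∀ k, τ k univ = ENNReal.ofReal (n k * m) := by
    intro k
    rw [hτs k univ MeasurableSet.univ, ← (hn k).2, Measure.restrict_apply_univ]
    rw [ENNReal.ofReal_add (by linarith [(hr k).2, hQmass k])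
      (Finset.sum_nonneg fun j _ => (hr j).1)]
    congr 1
    · rw [← ENNReal.ofReal_toReal (hQtop k), ← ENNReal.ofReal_mul (by linarith [(hθ01 k).2])]
      congr 1
      have : θ k * (μ (Q k)).toReal = r k := div_mul_cancel₀ _ (hqpos k).ne'
      rw [sub_mul, this, one_mul]
      rfl
    · rw [ENNReal.ofReal_sum_of_nonneg fun j _ => (hr j).1, tsum_eq_sum (s := ch k)]
      · refine Finset.sum_congr rfl fun j hj => ?_
        rw [if_pos ((hch k j).1 hj), Measure.restrict_apply_univ, hθq]
      · intro j hj
        rw [if_neg (fun h => hj ((hch k j).2 h)), zero_mul]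
  have hτsum : ∀ s, MeasurableSet s → ∑' k, τ k s = μ s := by
    intro s hs
    simp_rw [hτs _ s hs]
    rw [ENNReal.tsum_add, ENNReal.tsum_comm]
    have h1 : ∀ j, ∑' k, (if π j = k then ENNReal.ofReal (θ j) else 0) * μ.restrict (Q j) s =
        ENNReal.ofReal (θ j) * μ.restrict (Q j) s := by
      intro j
      rw [tsum_eq_single (π j)]
      · rw [if_pos rfl]
      · intro k hk
        rw [if_neg hk.symm, zero_mul]
    simp_rw [h1]
    rw [← ENNReal.tsum_add]
    have h2 : ∀ k, ENNReal.ofReal (1 - θ k) * μ.restrict (Q k) s +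
        ENNReal.ofReal (θ k) * μ.restrict (Q k) s = μ.restrict (Q k) s := by
      intro k
      rw [← add_mul, ← ENNReal.ofReal_add (by linarith [(hθ01 k).2]) (hθ01 k).1]
      simp
    simp_rw [h2]
    rw [← Measure.sum_apply _ hs, ← Measure.restrict_iUnion hQd hQm, hQU, Measure.restrict_univ]
  have hsupp : ∀ k, τ k (closedBall (c k) ((7 * K' * K) * rho μ (c k)))ᶜ = 0 := by
    intro k
    have hms : MeasurableSet (closedBall (c k) ((7 * K' * K) * rho μ (c k)))ᶜ :=
      isClosed_closedBall.measurableSet.compl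
    have hρ := B.rho_pos (c k)
    have hRk := hK (c k)
    have hKK : 1 ≤ K' * K := one_le_mul_of_one_le_of_one_le hK'1 hK1
    rw [hτs k _ hms, add_eq_zero]
    constructor
    · rw [Measure.restrict_apply hms]
      have : (closedBall (c k) ((7 * K' * K) * rho μ (c k)))ᶜ ∩ Q k = ∅ := by
        rw [eq_empty_iff_forall_notMem]
        rintro w ⟨hw, hwQ⟩
        apply hw
        have h1 := hQR k hwQ
        rw [mem_ball] at h1
        rw [mem_closedBall]
        have h2 : R (c k) ≤ (7 * K' * K) * rho μ (c k) := by
          refine hRk.trans ?_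
          gcongr
          nlinarith
        linarith
      rw [this, measure_empty, mul_zero]
    · rw [ENNReal.tsum_eq_zero]
      intro j
      split_ifs with hj
      · rw [Measure.restrict_apply hms]
        have : (closedBall (c k) ((7 * K' * K) * rho μ (c k)))ᶜ ∩ Q j = ∅ := by
          rw [eq_empty_iff_forall_notMem]
          rintro w ⟨hw, hwQ⟩
          apply hw
          have h1 := hQR j hwQ
          rw [mem_ball] at h1
          rw [mem_closedBall]
          have h2 := hπd j
          rw [hj] at h2
          have h3 : R (c j) ≤ K' * R (c k) := by
            apply hK'
            refine h2.trans ?_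
            gcongr
            exact le_max_left _ _
          have h4 := dist_triangle w (c j) (c k)
          have h5 : K' * R (c k) ≤ K' * (K * rho μ (c k)) := by gcongr
          nlinarith
        rw [this, measure_empty, mul_zero]
      · rw [zero_mul]
  -- the pieces are indexed by a cell `k` and a number below `n k`
  have hinf : Infinite (Σ k, Fin (n k)) := by
    apply Infinite.of_injective (fun k : ℕ => (⟨k, ⟨0, (hn k).1⟩⟩ : Σ k, Fin (n k)))
    intro k l hkl
    exact congrArg Sigma.fst hkl
  obtain ⟨hden⟩ := nonempty_denumerable_iff.2
    ⟨(inferInstance : Countable (Σ k, Fin (n k))), hinf⟩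
  set e : ℕ ≃ Σ k, Fin (n k) := (Denumerable.eqv _).symm
  have hn0 : ∀ k, (n k : ℝ≥0∞) ≠ 0 := fun k => by
    have := (hn k).1
    exact_mod_cast this.ne'
  have hnt : ∀ k, (n k : ℝ≥0∞) ≠ ⊤ := fun k => ENNReal.natCast_ne_top _
  refine ⟨7 * K' * K, fun i => c (e i).1, fun i => ((n (e i).1 : ℝ≥0∞)⁻¹) • τ (e i).1, ?_, ?_, ?_,
    ?_⟩
  · have : 1 ≤ K' * K := one_le_mul_of_one_le_of_one_le hK'1 hK1
    nlinarith
  · ext s hs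
    rw [Measure.sum_apply _ hs, ← hτsum s hs]
    simp only [Measure.smul_apply, smul_eq_mul]
    rw [e.tsum_eq (fun p : Σ k, Fin (n k) => ((n p.1 : ℝ≥0∞)⁻¹) * τ p.1 s), ENNReal.tsum_sigma']
    congr 1
    ext k
    rw [tsum_fintype]
    simp only []
    rw [Finset.sum_const, Finset.card_univ, Fintype.card_fin, nsmul_eq_mul,
      ← mul_assoc, ENNReal.mul_inv_cancel (hn0 k) (hnt k), one_mul]
  · intro i
    rw [Measure.smul_apply, smul_eq_mul, hτmass, ENNReal.ofReal_mul (by positivity),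
      ENNReal.ofReal_natCast, ← mul_assoc, ENNReal.inv_mul_cancel (hn0 _) (hnt _), one_mul]
  · intro i
    rw [Measure.smul_apply, hsupp, smul_zero]

end Decomposition

/-! ### Decay sums and logarithmic potentials -/

section Estimates

/-- The decay at `z` of the potential of a compensated piece located at `c` at scale `rho μ c`. -/
def decay (μ : Measure ℂ) (c z : ℂ) : ℝ := (rho μ c / (rho μ c + dist z c)) ^ 3

variable {μ : Measure ℂ} [IsLocallyFiniteMeasure μ] {C q : ℝ}

theorem DoublingBounds.decay_pos (B : DoublingBounds μ C q) (c z : ℂ) : 0 < decay μ c z := by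
  have := B.rho_pos c
  have : 0 ≤ dist z c := dist_nonneg
  rw [decay]
  positivity

theorem DoublingBounds.continuous_decay (B : DoublingBounds μ C q) (z : ℂ) :
    Continuous (fun c => decay μ c z) := by
  have h1 := B.continuous_rho
  refine (h1.div (h1.add (by fun_prop)) fun c => ?_).pow 3
  have := B.rho_pos c
  have hd : 0 ≤ dist z c := dist_nonneg
  have : 0 < rho μ c + dist z c := by positivity
  exact this.ne'

theorem DoublingBounds.continuous_decay_right (B : DoublingBounds μ C q) (c : ℂ) :
    Continuous (fun z => decay μ c z) := by
  refine (continuous_const.div (by fun_prop) fun z => ?_).pow 3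
  have := B.rho_pos c
  have hd : 0 ≤ dist z c := dist_nonneg
  positivity

/-- `decay` depends on the location of the piece only up to a bounded factor. -/
theorem DoublingBounds.exists_decay_le (B : DoublingBounds μ C q) {M : ℝ} (hM : 0 ≤ M) :
    ∃ A, 0 < A ∧ ∀ c ζ z : ℂ, dist ζ c ≤ M * rho μ c → decay μ c z ≤ A * decay μ ζ z := by
  obtain ⟨K, hK1, hK⟩ := B.exists_comparable M
  refine ⟨(K * (1 + 2 * M)) ^ 3, by positivity, fun c ζ z h => ?_⟩
  have hc := B.rho_pos c
  have hζ := B.rho_pos ζ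
  have hd : 0 ≤ dist z c := dist_nonneg
  have hd' : 0 ≤ dist z ζ := dist_nonneg
  rw [decay, decay, ← mul_pow]
  gcongr
  have h1 : rho μ c ≤ K * rho μ ζ := by
    apply hK
    rw [dist_comm]
    exact h.trans (by gcongr; exact le_max_left _ _)
  have h2 : rho μ ζ + dist z ζ ≤ (1 + 2 * M) * (rho μ c + dist z c) := by
    have := B.rho_le_add ζ c
    have h3 := dist_triangle z c ζ
    rw [dist_comm c ζ] at h3
    nlinarith
  rw [← mul_div_assoc, div_le_div_iff₀ (by positivity) (by positivity)]
  calc rho μ c * (rho μ ζ + dist z ζ)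
      ≤ (K * rho μ ζ) * ((1 + 2 * M) * (rho μ c + dist z c)) := by gcongr
    _ = _ := by ring

/-- The integral of `decay` against Lebesgue measure with density `rho⁻²` is bounded uniformly
in `z`. -/
theorem DoublingBounds.exists_lintegral_decay_div_le (B : DoublingBounds μ C q) :
    ∃ A : ℝ, 0 < A ∧ ∀ z : ℂ,
      ∫⁻ w, ENNReal.ofReal (decay μ w z / rho μ w ^ 2) ≤ ENNReal.ofReal A := by
  obtain ⟨K, ε, hK, hε, hG⟩ := B.exists_growth
  set J : ℂ → ℝ := fun u => (1 + ‖u‖) ^ (-(2 + ε)) with hJ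
  have hJi : Integrable J := by
    apply integrable_one_add_norm
    rw [Complex.finrank_real_complex]
    push_cast; linarith
  have hJ0 : ∀ u, 0 ≤ J u := fun u => by positivity
  have hI0 : 0 ≤ ∫ u, J u := integral_nonneg hJ0
  refine ⟨8 * K * (∫ u, J u) + 1, by positivity, fun z => ?_⟩
  have hz := B.rho_pos z
  have hpt : ∀ w, decay μ w z / rho μ w ^ 2 ≤
      8 * K * (((rho μ z)⁻¹) ^ 2 * J ((rho μ z)⁻¹ • (w - z))) := by
    intro w
    have hw := B.rho_pos w
    have hd : 0 ≤ dist z w := dist_nonneg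
    set s := rho μ z + dist z w with hs
    have hs0 : 0 < s := by positivity
    have h1 : s ≤ 2 * (rho μ w + dist z w) := by
      have := B.rho_le_add z w
      linarith
    have h2 : decay μ w z / rho μ w ^ 2 = rho μ w / (rho μ w + dist z w) ^ 3 := by
      rw [decay]; field_simp
    have h3 : rho μ w / (rho μ w + dist z w) ^ 3 ≤ 8 * (rho μ w / s) / s ^ 2 := by
      have : s ^ 3 ≤ 8 * (rho μ w + dist z w) ^ 3 := by
        calc s ^ 3 ≤ (2 * (rho μ w + dist z w)) ^ 3 := by gcongr
          _ = _ := by ring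
      rw [show 8 * (rho μ w / s) / s ^ 2 = 8 * rho μ w / s ^ 3 by field_simp,
        div_le_div_iff₀ (by positivity) (by positivity)]
      nlinarith
    have h4 : J ((rho μ z)⁻¹ • (w - z)) = (rho μ z / s) ^ ε * (rho μ z / s) ^ 2 := by
      have e1 : 1 + ‖(rho μ z)⁻¹ • (w - z)‖ = (rho μ z / s)⁻¹ := by
        rw [norm_smul, ← dist_eq_norm, dist_comm w z, Real.norm_of_nonneg (by positivity), hs]
        field_simp
      rw [hJ]
      simp only
      rw [e1, Real.inv_rpow (by positivity), Real.rpow_neg (by positivity), inv_inv, add_comm,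
        Real.rpow_add (by positivity)]
      congr 1
      exact Real.rpow_natCast _ 2
    rw [h2]
    refine h3.trans ?_
    rw [h4]
    calc 8 * (rho μ w / s) / s ^ 2 ≤ 8 * (K * (rho μ z / s) ^ ε) / s ^ 2 := by
          gcongr
          exact hG z w
      _ = _ := by field_simp
  have hF : Integrable (fun w => 8 * K * (((rho μ z)⁻¹) ^ 2 * J ((rho μ z)⁻¹ • (w - z)))) := by
    refine Integrable.const_mul (Integrable.const_mul ?_ _) _
    have := (hJi.comp_smul (R := (rho μ z)⁻¹) (by positivity)).comp_sub_right z
    exact this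
  calc ∫⁻ w, ENNReal.ofReal (decay μ w z / rho μ w ^ 2)
      ≤ ∫⁻ w, ENNReal.ofReal (8 * K * (((rho μ z)⁻¹) ^ 2 * J ((rho μ z)⁻¹ • (w - z)))) :=
        lintegral_mono fun w => ENNReal.ofReal_le_ofReal (hpt w)
    _ = ENNReal.ofReal (∫ w, 8 * K * (((rho μ z)⁻¹) ^ 2 * J ((rho μ z)⁻¹ • (w - z)))) := by
        rw [ofReal_integral_eq_lintegral_ofReal hF]
        refine Eventually.of_forall fun w => ?_
        have := hJ0 ((rho μ z)⁻¹ • (w - z))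
        positivity
    _ ≤ _ := by
        rw [integral_const_mul, integral_const_mul, integral_comp_smul_sub J z hz]
        apply ENNReal.ofReal_le_ofReal
        linarith

/-- The integral of `decay` against `μ` is bounded uniformly in `z`. -/
theorem DoublingBounds.exists_lintegral_decay_le (B : DoublingBounds μ C q) :
    ∃ A : ℝ, 0 < A ∧ ∀ z : ℂ, ∫⁻ ζ, ENNReal.ofReal (decay μ ζ z) ∂μ ≤ ENNReal.ofReal A := by
  obtain ⟨A₁, hA₁, h₁⟩ := B.exists_lintegral_decay_div_le
  obtain ⟨A₂, hA₂, h₂⟩ := B.exists_decay_le (M := 1) zero_le_one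
  refine ⟨A₂ * 3 * A₁, by positivity, fun z => ?_⟩
  have hρc := B.continuous_rho
  have hdec := B.continuous_decay z
  set S : Set (ℂ × ℂ) := {p | dist p.1 p.2 < rho μ p.2} with hS
  have hSo : IsOpen S := isOpen_lt (by fun_prop) (by fun_prop)
  set G : ℂ → ℝ≥0∞ := fun w => ENNReal.ofReal (A₂ * 3 * (decay μ w z / rho μ w ^ 2)) with hG
  have hGm : Measurable G := by
    apply Measurable.ennreal_ofReal
    exact ((hdec.measurable).div (hρc.measurable.pow_const 2)).const_mul _
  -- the value at `ζ` is dominated by the average over the disc of radius `rho ζ / 2`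
  have hpt : ∀ ζ, ENNReal.ofReal (decay μ ζ z) ≤ ∫⁻ w, S.indicator (fun p => G p.2) (ζ, w) := by
    intro ζ
    have hζ := B.rho_pos ζ
    have hvol : volume (ball ζ (rho μ ζ / 2)) = ENNReal.ofReal (Real.pi * (rho μ ζ / 2) ^ 2) := by
      rw [Complex.volume_ball, ENNReal.ofReal_mul Real.pi_pos.le, ← ENNReal.ofReal_pow (by positivity),
        mul_comm]
      congr 1
      rw [← NNReal.coe_real_pi, ENNReal.ofReal_coe_nnreal]
    calc ENNReal.ofReal (decay μ ζ z)
        = ENNReal.ofReal (decay μ ζ z / (Real.pi * (rho μ ζ / 2) ^ 2)) *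
            volume (ball ζ (rho μ ζ / 2)) := by
          have hpi := Real.pi_pos
          have := (B.decay_pos ζ z).le
          rw [hvol, ← ENNReal.ofReal_mul (by positivity)]
          congr 1
          field_simp
      _ = ∫⁻ w in ball ζ (rho μ ζ / 2),
            ENNReal.ofReal (decay μ ζ z / (Real.pi * (rho μ ζ / 2) ^ 2)) := by
          rw [setLIntegral_const]
      _ ≤ ∫⁻ w in ball ζ (rho μ ζ / 2), S.indicator (fun p => G p.2) (ζ, w) := by
          refine setLIntegral_mono' isOpen_ball.measurableSet fun w hw => ?_
          rw [mem_ball] at hw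
          have hw0 := B.rho_pos w
          have h3 := B.rho_le_add ζ w
          rw [dist_comm] at h3
          have h4 := B.rho_le_add w ζ
          have hwS : (ζ, w) ∈ S := by
            change dist ζ w < rho μ w
            rw [dist_comm]
            linarith
          rw [indicator_of_mem hwS]
          apply ENNReal.ofReal_le_ofReal
          have h5 := h₂ ζ w z (by linarith)
          have h6 : rho μ w ^ 2 ≤ 9 / 4 * rho μ ζ ^ 2 := by nlinarith
          have hpi := Real.pi_gt_three
          have hpos := B.decay_pos w z
          rw [mul_div_assoc', div_le_div_iff₀ (by positivity) (by positivity)]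
          calc decay μ ζ z * rho μ w ^ 2 ≤ (A₂ * decay μ w z) * (9 / 4 * rho μ ζ ^ 2) := by gcongr
            _ = (A₂ * 3 * decay μ w z) * (3 * (rho μ ζ / 2) ^ 2) := by ring
            _ ≤ _ := by gcongr
      _ ≤ _ := setLIntegral_le_lintegral _ _
  calc ∫⁻ ζ, ENNReal.ofReal (decay μ ζ z) ∂μ
      ≤ ∫⁻ ζ, ∫⁻ w, S.indicator (fun p => G p.2) (ζ, w) ∂volume ∂μ := lintegral_mono hpt
    _ = ∫⁻ w, ∫⁻ ζ, S.indicator (fun p => G p.2) (ζ, w) ∂μ ∂volume := by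
        apply lintegral_lintegral_swap
        exact ((hGm.comp measurable_snd).indicator hSo.measurableSet).aemeasurable
    _ = ∫⁻ w, G w := by
        congr 1
        ext w
        have : ∀ ζ, S.indicator (fun p => G p.2) (ζ, w) =
            (ball w (rho μ w)).indicator (fun _ => G w) ζ := by
          intro ζ
          by_cases h : dist ζ w < rho μ w
          · rw [indicator_of_mem (show (ζ, w) ∈ S from h), indicator_of_mem (mem_ball.2 h)]
          · rw [indicator_of_notMem (show (ζ, w) ∉ S from h),
              indicator_of_notMem (fun h' => h (mem_ball.1 h'))]
        simp_rw [this]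
        rw [lintegral_indicator isOpen_ball.measurableSet, setLIntegral_const]
        have h1 := B.measure_ball_rho w
        have h2 : μ (ball w (rho μ w)) = 1 := by
          rw [← ENNReal.ofReal_toReal (measure_ball_ne_top (μ := μ) w (rho μ w))]
          have : (μ (ball w (rho μ w))).toReal = 1 := h1
          rw [this, ENNReal.ofReal_one]
        rw [h2, mul_one]
    _ = ENNReal.ofReal (A₂ * 3) * ∫⁻ w, ENNReal.ofReal (decay μ w z / rho μ w ^ 2) := by
        rw [← lintegral_const_mul' _ _ ENNReal.ofReal_ne_top]
        congr 1
        ext w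
        exact ENNReal.ofReal_mul (p := A₂ * 3) (by positivity)
    _ ≤ ENNReal.ofReal (A₂ * 3) * ENNReal.ofReal A₁ := by
        gcongr
        exact h₁ z
    _ = _ := by rw [← ENNReal.ofReal_mul (by positivity)]

/-- A family of pieces of equal mass whose sum is `μ`, located at the points `c k` at the scale of
`rho`, has uniformly bounded total decay. -/
theorem DoublingBounds.exists_tsum_decay_le (B : DoublingBounds μ C q) {M m : ℝ} (hM : 0 ≤ M)
    (hm : 0 < m) {c : ℕ → ℂ} {ν : ℕ → Measure ℂ} (hsum : Measure.sum ν = μ)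
    (hmass : ∀ k, ν k univ = ENNReal.ofReal m)
    (hsupp : ∀ k, ν k (closedBall (c k) (M * rho μ (c k)))ᶜ = 0) :
    ∃ A : ℝ, 0 < A ∧ ∀ z, Summable (fun k => decay μ (c k) z) ∧ ∑' k, decay μ (c k) z ≤ A := by
  obtain ⟨A₁, hA₁, h₁⟩ := B.exists_lintegral_decay_le
  obtain ⟨A₂, hA₂, h₂⟩ := B.exists_decay_le hM
  have key : ∀ z, ∑' k, ENNReal.ofReal (decay μ (c k) z) ≤ ENNReal.ofReal (A₂ * A₁ / m) := by
    intro z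
    have h3 : ∀ k, ENNReal.ofReal (decay μ (c k) z) * ENNReal.ofReal m ≤
        ∫⁻ ζ, ENNReal.ofReal A₂ * ENNReal.ofReal (decay μ ζ z) ∂(ν k) := by
      intro k
      rw [← hmass k, ← lintegral_const]
      apply lintegral_mono_ae
      have : ∀ᵐ ζ ∂(ν k), ζ ∈ closedBall (c k) (M * rho μ (c k)) := by
        rw [ae_iff]; exact hsupp k
      filter_upwards [this] with ζ hζ
      rw [← ENNReal.ofReal_mul hA₂.le]
      exact ENNReal.ofReal_le_ofReal (h₂ _ _ _ hζ)
    have h4 : (∑' k, ENNReal.ofReal (decay μ (c k) z)) * ENNReal.ofReal m ≤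
        ENNReal.ofReal (A₂ * A₁) := by
      rw [← ENNReal.tsum_mul_right]
      calc ∑' k, ENNReal.ofReal (decay μ (c k) z) * ENNReal.ofReal m
          ≤ ∑' k, ∫⁻ ζ, ENNReal.ofReal A₂ * ENNReal.ofReal (decay μ ζ z) ∂(ν k) :=
            ENNReal.tsum_le_tsum h3
        _ = ∫⁻ ζ, ENNReal.ofReal A₂ * ENNReal.ofReal (decay μ ζ z) ∂μ := by
            rw [← lintegral_sum_measure, hsum]
        _ = ENNReal.ofReal A₂ * ∫⁻ ζ, ENNReal.ofReal (decay μ ζ z) ∂μ :=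
            lintegral_const_mul' _ _ ENNReal.ofReal_ne_top
        _ ≤ ENNReal.ofReal A₂ * ENNReal.ofReal A₁ := by gcongr; exact h₁ z
        _ = _ := by rw [← ENNReal.ofReal_mul hA₂.le]
    rw [ENNReal.ofReal_div_of_pos hm, ENNReal.le_div_iff_mul_le]
    · exact h4
    · left; simpa using hm
    · left; exact ENNReal.ofReal_ne_top
  refine ⟨A₂ * A₁ / m, by positivity, fun z => ?_⟩
  have hs : Summable (fun k => decay μ (c k) z) := by
    have h5 : ∑' k, ENNReal.ofReal (decay μ (c k) z) ≠ ⊤ :=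
      ne_top_of_le_ne_top ENNReal.ofReal_ne_top (key z)
    have := ENNReal.summable_toReal h5
    refine this.congr fun k => ?_
    rw [ENNReal.toReal_ofReal (B.decay_pos _ _).le]
  refine ⟨hs, ?_⟩
  have := key z
  rw [← ENNReal.ofReal_tsum_of_nonneg (fun k => (B.decay_pos _ _).le) hs] at this
  exact (ENNReal.ofReal_le_ofReal_iff (by positivity)).1 this

/-- The negative part of `log x` is controlled by the number of powers of `1 / 4` above `x`. -/
theorem neg_log_le_tsum {x : ℝ} (hx : 0 < x) : ENNReal.ofReal (-Real.log x) ≤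
    ENNReal.ofReal (Real.log 4) * ∑' i : ℕ, if x ≤ (1 / 4) ^ i then 1 else 0 := by
  rcases le_or_gt 1 x with h | h
  · rw [ENNReal.ofReal_of_nonpos (by linarith [Real.log_nonneg h])]
    exact bot_le
  · obtain ⟨n, hn1, hn2⟩ := exists_nat_pow_near ((one_le_inv₀ hx).2 h.le)
      (by norm_num : (1:ℝ) < 4)
    have h1 : -Real.log x ≤ Real.log 4 * (n + 1) := by
      rw [← Real.log_inv]
      calc Real.log x⁻¹ ≤ Real.log (4 ^ (n + 1)) :=
            Real.log_le_log (by positivity) hn2.le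
        _ = _ := by rw [Real.log_pow]; push_cast; ring
    have h2 : ((n + 1 : ℕ) : ℝ≥0∞) ≤ ∑' i : ℕ, if x ≤ (1 / 4) ^ i then 1 else 0 := by
      refine le_trans ?_ (ENNReal.sum_le_tsum (Finset.range (n + 1)))
      rw [Finset.sum_congr rfl (g := fun _ => (1 : ℝ≥0∞))]
      · simp
      · intro i hi
        rw [if_pos]
        have hi' : i ≤ n := by
          have := Finset.mem_range.1 hi
          omega
        have h3 : x ≤ (1 / 4) ^ n := by
          rw [one_div, inv_pow]
          exact (le_inv_comm₀ (by positivity) hx).1 hn1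
        exact h3.trans (pow_le_pow_of_le_one (by norm_num) (by norm_num) hi')
    calc ENNReal.ofReal (-Real.log x) ≤ ENNReal.ofReal (Real.log 4 * (n + 1)) :=
          ENNReal.ofReal_le_ofReal h1
      _ = ENNReal.ofReal (Real.log 4) * ((n + 1 : ℕ) : ℝ≥0∞) := by
          rw [ENNReal.ofReal_mul (Real.log_nonneg (by norm_num))]
          congr 1
          rw [← ENNReal.ofReal_natCast]
          push_cast; rfl
      _ ≤ _ := by gcongr

/-- The negative part of the logarithmic potential of `μ` at scale `r` is controlled by the mass of
a disc of radius comparable to `r`, by reverse doubling. -/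
theorem DoublingBounds.exists_lintegral_neg_log_le (B : DoublingBounds μ C q) :
    ∃ A : ℝ, 0 < A ∧ ∀ (z : ℂ) (r : ℝ), 0 < r →
      ∫⁻ ζ, ENNReal.ofReal (-Real.log (dist z ζ / r)) ∂μ ≤
        ENNReal.ofReal (A * μ.real (ball z (4 * r))) := by
  have hq := B.one_lt
  have hlog4 : 0 < Real.log 4 := Real.log_pos (by norm_num)
  have hq1 : 0 < 1 - q⁻¹ := by
    have := inv_lt_one_of_one_lt₀ hq
    linarith
  refine ⟨Real.log 4 * (1 - q⁻¹)⁻¹, by positivity, fun z r hr => ?_⟩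
  have hpt : ∀ ζ, ENNReal.ofReal (-Real.log (dist z ζ / r)) ≤ ENNReal.ofReal (Real.log 4) *
      ∑' i : ℕ, (closedBall z ((1 / 4) ^ i * r)).indicator (fun _ => (1:ℝ≥0∞)) ζ := by
    intro ζ
    rcases eq_or_ne z ζ with h | h
    · subst h; simp
    · refine (neg_log_le_tsum (div_pos (dist_pos.2 h) hr)).trans (le_of_eq ?_)
      congr 1
      congr 1
      ext i
      by_cases h' : dist z ζ / r ≤ (1 / 4) ^ i
      · have : ζ ∈ closedBall z ((1 / 4) ^ i * r) := by
          rwa [mem_closedBall, dist_comm, ← div_le_iff₀ hr]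
        rw [if_pos h', indicator_of_mem this]
      · have : ζ ∉ closedBall z ((1 / 4) ^ i * r) := by
          rwa [mem_closedBall, dist_comm, ← div_le_iff₀ hr]
        rw [if_neg h', indicator_of_notMem this]
  have hball : ∀ i : ℕ, μ (closedBall z ((1 / 4) ^ i * r)) ≤
      ENNReal.ofReal ((q⁻¹) ^ i * μ.real (ball z (4 * r))) := by
    intro i
    have h1 := B.lower_pow z (r := 4 * ((1 / 4) ^ i * r)) (by positivity) i
    have h2 : (4:ℝ) ^ i * (4 * ((1 / 4) ^ i * r)) = 4 * r := by
      rw [one_div, inv_pow]; field_simp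
    rw [h2] at h1
    have h3 : μ.real (ball z (4 * ((1 / 4) ^ i * r))) ≤ (q⁻¹) ^ i * μ.real (ball z (4 * r)) := by
      rw [inv_pow, inv_mul_eq_div, le_div_iff₀ (by positivity), mul_comm]
      exact h1
    calc μ (closedBall z ((1 / 4) ^ i * r)) ≤ μ (ball z (4 * ((1 / 4) ^ i * r))) := by
          apply measure_mono
          apply closedBall_subset_ball
          have : 0 < (1 / 4 : ℝ) ^ i * r := by positivity
          linarith
      _ = ENNReal.ofReal (μ.real (ball z (4 * ((1 / 4) ^ i * r)))) :=
          (ENNReal.ofReal_toReal (measure_ball_ne_top _ _)).symm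
      _ ≤ _ := ENNReal.ofReal_le_ofReal h3
  have hgeo := (summable_geometric_of_lt_one (r := q⁻¹) (by positivity) (by linarith))
  calc ∫⁻ ζ, ENNReal.ofReal (-Real.log (dist z ζ / r)) ∂μ
      ≤ ∫⁻ ζ, ENNReal.ofReal (Real.log 4) *
        ∑' i : ℕ, (closedBall z ((1 / 4) ^ i * r)).indicator (fun _ => (1:ℝ≥0∞)) ζ ∂μ :=
        lintegral_mono hpt
    _ = ENNReal.ofReal (Real.log 4) * ∑' i : ℕ, μ (closedBall z ((1 / 4) ^ i * r)) := by
        rw [lintegral_const_mul' _ _ ENNReal.ofReal_ne_top, lintegral_tsum]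
        · congr 2
          ext i
          rw [lintegral_indicator isClosed_closedBall.measurableSet]
          simp
        · intro i
          exact (measurable_const.indicator isClosed_closedBall.measurableSet).aemeasurable
    _ ≤ ENNReal.ofReal (Real.log 4) *
        ∑' i : ℕ, ENNReal.ofReal ((q⁻¹) ^ i * μ.real (ball z (4 * r))) := by
        gcongr
        exact hball _
    _ = _ := by
        rw [← ENNReal.ofReal_tsum_of_nonneg _ (hgeo.mul_right _), ← ENNReal.ofReal_mul hlog4.le,
          tsum_mul_right, tsum_geometric_of_lt_one (by positivity) (by linarith), mul_assoc]
        intro i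
        positivity

/-- The logarithmic potential of a piece of `μ` at scale `rho μ c`, near the piece. -/
theorem DoublingBounds.exists_lintegral_log_le (B : DoublingBounds μ C q) (L M : ℝ) :
    ∃ A : ℝ, 0 < A ∧ ∀ (c z : ℂ) (ν : Measure ℂ), dist z c ≤ L * rho μ c → ν ≤ μ →
      ν (closedBall c (M * rho μ c))ᶜ = 0 →
      ∫⁻ ζ, ENNReal.ofReal |Real.log (dist z ζ / rho μ c)| ∂ν ≤ ENNReal.ofReal A := by
  obtain ⟨A₀, hA₀, h₀⟩ := B.exists_lintegral_neg_log_le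
  have hC := B.one_le
  obtain ⟨n, hn⟩ := pow_unbounded_of_one_lt (|L| + |M| + 5) (one_lt_two)
  set T := |L| + |M| with hT
  have hT0 : 0 ≤ T := by positivity
  refine ⟨(A₀ + T) * C ^ n + 1, by positivity, fun c z ν hz hν hsupp => ?_⟩
  have hc := B.rho_pos c
  have hVol : ∀ r, r ≤ 2 ^ n * rho μ c → μ.real (ball c r) ≤ C ^ n := by
    intro r hr
    have := B.upper_pow c hc n
    rw [B.measure_ball_rho, mul_one] at this
    exact (measureReal_ball_mono c hr).trans this
  have hz' : dist z c ≤ |L| * rho μ c := hz.trans (by gcongr; exact le_abs_self L)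
  have hae : ∀ᵐ ζ ∂ν, ζ ∈ closedBall c (M * rho μ c) := by
    rw [ae_iff]; exact hsupp
  have hpt : ∀ᵐ ζ ∂ν, ENNReal.ofReal |Real.log (dist z ζ / rho μ c)| ≤
      ENNReal.ofReal T + ENNReal.ofReal (-Real.log (dist z ζ / rho μ c)) := by
    filter_upwards [hae] with ζ hζ
    rw [mem_closedBall] at hζ
    rcases le_total 0 (Real.log (dist z ζ / rho μ c)) with h | h
    · rw [abs_of_nonneg h]
      refine le_add_right (ENNReal.ofReal_le_ofReal ?_)
      rcases eq_or_ne z ζ with h' | h'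
      · subst h'; simpa using hT0
      · have hd : 0 < dist z ζ / rho μ c := div_pos (dist_pos.2 h') hc
        have h3 : dist z ζ / rho μ c ≤ T := by
          rw [div_le_iff₀ hc]
          have h1 := dist_triangle z c ζ
          rw [dist_comm c ζ] at h1
          have h2 : M * rho μ c ≤ |M| * rho μ c := by gcongr; exact le_abs_self M
          rw [hT, add_mul]
          linarith
        linarith [Real.log_le_sub_one_of_pos hd]
    · rw [abs_of_nonpos h]
      exact le_add_left le_rfl
  have hνuniv : ν univ ≤ ENNReal.ofReal (C ^ n) := by
    calc ν univ ≤ ν (closedBall c (M * rho μ c)) + ν (closedBall c (M * rho μ c))ᶜ := by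
          rw [← union_compl_self (closedBall c (M * rho μ c))]
          exact measure_union_le _ _
      _ = ν (closedBall c (M * rho μ c)) := by rw [hsupp, add_zero]
      _ ≤ μ (closedBall c (M * rho μ c)) := hν _
      _ ≤ μ (ball c (2 ^ n * rho μ c)) := by
          apply measure_mono
          apply closedBall_subset_ball
          gcongr
          have := le_abs_self M
          have := abs_nonneg L
          linarith
      _ = ENNReal.ofReal (μ.real (ball c (2 ^ n * rho μ c))) :=
          (ENNReal.ofReal_toReal (measure_ball_ne_top _ _)).symm
      _ ≤ _ := ENNReal.ofReal_le_ofReal (hVol _ le_rfl)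
  calc ∫⁻ ζ, ENNReal.ofReal |Real.log (dist z ζ / rho μ c)| ∂ν
      ≤ ∫⁻ ζ, (ENNReal.ofReal T + ENNReal.ofReal (-Real.log (dist z ζ / rho μ c))) ∂ν :=
        lintegral_mono_ae hpt
    _ = ENNReal.ofReal T * ν univ + ∫⁻ ζ, ENNReal.ofReal (-Real.log (dist z ζ / rho μ c)) ∂ν := by
        rw [lintegral_add_left measurable_const, lintegral_const]
    _ ≤ ENNReal.ofReal T * ENNReal.ofReal (C ^ n) +
        ∫⁻ ζ, ENNReal.ofReal (-Real.log (dist z ζ / rho μ c)) ∂μ := by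
        gcongr
    _ ≤ ENNReal.ofReal T * ENNReal.ofReal (C ^ n) + ENNReal.ofReal (A₀ * C ^ n) := by
        gcongr
        refine (h₀ z _ hc).trans (ENNReal.ofReal_le_ofReal ?_)
        gcongr
        refine (measureReal_ball_le_of_subset (μ := μ) (w := c) (s := 2 ^ n * rho μ c) ?_).trans
          (hVol _ le_rfl)
        have := abs_nonneg M
        nlinarith
    _ ≤ _ := by
        rw [← ENNReal.ofReal_mul hT0, ← ENNReal.ofReal_add (by positivity) (by positivity)]
        apply ENNReal.ofReal_le_ofReal
        nlinarith

end Estimates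

/-! ### Triples of points with prescribed moments -/

section Points

/-- Fewer than `n` points cannot come close to all of the `n` points `j / n`. -/
theorem exists_far_from_finset {n : ℕ} (S : Finset ℂ) (hS : S.card < n) :
    ∃ e : ℂ, ‖e‖ ≤ 1 ∧ ∀ b ∈ S, 1 / (2 * (n : ℝ)) ≤ ‖e - b‖ := by
  have hn : (0:ℝ) < n := by
    have : 0 < n := by omega
    exact_mod_cast this
  by_contra! hcon
  have hle : ∀ j ∈ Finset.range n, ‖((j / n : ℝ) : ℂ)‖ ≤ 1 := by
    intro j hj
    rw [Complex.norm_real, Real.norm_of_nonneg (by positivity), div_le_one hn]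
    exact_mod_cast (Finset.mem_range.1 hj).le
  choose! f hf using fun j (hj : j ∈ Finset.range n) => hcon ((j / n : ℝ) : ℂ) (hle j hj)
  obtain ⟨i, hi, j, hj, hij, hfij⟩ := Finset.exists_ne_map_eq_of_card_lt_of_maps_to
    (s := Finset.range n) (t := S) (by simpa using hS) (f := f) (fun j hj => (hf j hj).1)
  have h1 : ‖(((i / n : ℝ) : ℂ)) - ((j / n : ℝ) : ℂ)‖ < 1 / n := by
    calc ‖(((i / n : ℝ) : ℂ)) - ((j / n : ℝ) : ℂ)‖
        = ‖((((i / n : ℝ) : ℂ)) - f i) - (((j / n : ℝ) : ℂ) - f j)‖ := by rw [hfij]; ring_nf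
      _ ≤ ‖(((i / n : ℝ) : ℂ)) - f i‖ + ‖((j / n : ℝ) : ℂ) - f j‖ := norm_sub_le _ _
      _ < 1 / (2 * (n:ℝ)) + 1 / (2 * (n:ℝ)) := add_lt_add (hf i hi).2 (hf j hj).2
      _ = 1 / n := by field_simp; norm_num
  rw [← Complex.ofReal_sub, Complex.norm_real, Real.norm_eq_abs, ← sub_div, abs_div,
    abs_of_pos hn, div_lt_div_iff_of_pos_right hn] at h1
  have h2 : |((i:ℤ) - (j:ℤ) : ℤ)| < 1 := by
    have : ((|((i:ℤ) - (j:ℤ) : ℤ)| : ℤ) : ℝ) < 1 := by push_cast; exact h1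
    exact_mod_cast this
  rw [Int.abs_lt_one_iff] at h2
  omega

/-- The cubic `y ^ 3 - (s / 2) y - e` splits, and its roots have power sums `0` and `s`. -/
theorem exists_cubic_roots (s e : ℂ) : ∃ x₁ x₂ x₃ : ℂ, x₁ + x₂ + x₃ = 0 ∧
    x₁ ^ 2 + x₂ ^ 2 + x₃ ^ 2 = s ∧
    ∀ y, (y - x₁) * (y - x₂) * (y - x₃) = y ^ 3 - s / 2 * y - e := by
  obtain ⟨x₁, hx₁⟩ : ∃ x : ℂ, x ^ 3 - s / 2 * x - e = 0 := by
    have hdeg : (Polynomial.X ^ 3 - Polynomial.C (s / 2) * Polynomial.X -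
        Polynomial.C e : Polynomial ℂ).degree = 3 := by
      compute_degree!
    obtain ⟨x, hx⟩ := IsAlgClosed.exists_root _ (by rw [hdeg]; norm_num)
    refine ⟨x, ?_⟩
    simpa [Polynomial.IsRoot] using hx
  obtain ⟨d, hd⟩ := IsAlgClosed.exists_pow_nat_eq (2 * s - 3 * x₁ ^ 2) (n := 2) (by norm_num)
  refine ⟨x₁, (-x₁ + d) / 2, (-x₁ - d) / 2, by ring, by linear_combination hd / 2, fun y => ?_⟩
  linear_combination (-y / 4 + x₁ / 4) * hd - hx₁

/-- Three well separated points with prescribed first and second moments about `c`, at the scale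
`ρ`, avoiding a given finite set. The free coefficient of the cubic gives the room to avoid. -/
theorem exists_three_points {M : ℝ} (hM : 1 ≤ M) : ∃ L : ℝ, 1 ≤ L ∧ ∀ N : ℕ, ∃ δ : ℝ, 0 < δ ∧
    ∀ (ρ : ℝ) (c p₁ p₂ : ℂ) (F : Finset ℂ), 0 < ρ → ‖p₁‖ ≤ 3 * M * ρ → ‖p₂‖ ≤ 3 * (M * ρ) ^ 2 →
      F.card ≤ N → ∃ x : Fin 3 → ℂ, ∑ i, (x i - c) = p₁ ∧ ∑ i, (x i - c) ^ 2 = p₂ ∧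
        (∀ i, dist (x i) c ≤ L * ρ) ∧ (∀ i j, i ≠ j → δ * ρ ≤ dist (x i) (x j)) ∧
        ∀ w ∈ F, ∀ i, δ * ρ ≤ dist (x i) w := by
  set T := 3 * M ^ 2 + 1 with hT
  have hT1 : 1 ≤ T := by rw [hT]; nlinarith
  refine ⟨M + T, by linarith, fun N => ?_⟩
  set n := N + 3 with hn
  have hn0 : (1:ℝ) ≤ n := by rw [hn]; push_cast; linarith [(Nat.cast_nonneg N : (0:ℝ) ≤ N)]
  set δ : ℝ := 1 / (18 * n * T ^ 2) with hδ
  have hδ0 : 0 < δ := by positivity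
  have hδ1 : δ ≤ 1 := by
    rw [hδ, div_le_one (by positivity)]
    nlinarith [mul_le_mul hn0 (one_le_pow₀ hT1 : 1 ≤ T ^ 2) zero_le_one (by positivity)]
  refine ⟨δ, hδ0, fun ρ c p₁ p₂ F hρ hp₁ hp₂ hF => ?_⟩
  set β := c + p₁ / 3 with hβ
  set s := p₂ - p₁ ^ 2 / 3 with hs
  have hsn : ‖s‖ ≤ 6 * (M * ρ) ^ 2 := by
    have h1 : ‖p₁ ^ 2 / 3‖ ≤ 3 * (M * ρ) ^ 2 := by
      rw [norm_div, norm_pow, Complex.norm_ofNat]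
      have : ‖p₁‖ ^ 2 ≤ (3 * M * ρ) ^ 2 := by gcongr
      nlinarith
    calc ‖s‖ ≤ ‖p₂‖ + ‖p₁ ^ 2 / 3‖ := norm_sub_le _ _
      _ ≤ _ := by linarith
  obtain ⟨a, ha⟩ := IsAlgClosed.exists_pow_nat_eq (s ^ 3 / 54) (n := 2) (by norm_num)
  classical
  have hρ3 : ((ρ:ℂ) ^ 3) ≠ 0 := pow_ne_zero _ (Complex.ofReal_ne_zero.2 hρ.ne')
  set S : Finset ℂ := (F.image fun w => ((w - β) ^ 3 - s / 2 * (w - β)) / (ρ:ℂ) ^ 3) ∪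
    {a / (ρ:ℂ) ^ 3, -a / (ρ:ℂ) ^ 3} with hS
  have hScard : S.card < n := by
    have h1 : S.card ≤ _ + _ := Finset.card_union_le _ _
    have h2 := Finset.card_image_le (s := F)
      (f := fun w => ((w - β) ^ 3 - s / 2 * (w - β)) / (ρ:ℂ) ^ 3)
    have h3 := Finset.card_le_two (a := a / (ρ:ℂ) ^ 3) (b := -a / (ρ:ℂ) ^ 3)
    omega
  obtain ⟨e₀, he₀, hfar₀⟩ := exists_far_from_finset S hScard
  set e := e₀ * (ρ:ℂ) ^ 3 with he
  have hen : ‖e‖ ≤ ρ ^ 3 := by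
    rw [he, norm_mul, norm_pow, Complex.norm_real, Real.norm_of_nonneg hρ.le]
    have : 0 < ρ ^ 3 := by positivity
    nlinarith
  have hfar : ∀ b, b / (ρ:ℂ) ^ 3 ∈ S → ρ ^ 3 / (2 * n) ≤ ‖e - b‖ := by
    intro b hb
    have h1 := hfar₀ _ hb
    have h2 : e - b = (e₀ - b / (ρ:ℂ) ^ 3) * (ρ:ℂ) ^ 3 := by
      rw [he, sub_mul, div_mul_cancel₀ _ hρ3]
    rw [h2, norm_mul, norm_pow, Complex.norm_real, Real.norm_of_nonneg hρ.le]
    calc ρ ^ 3 / (2 * n) = 1 / (2 * (n:ℝ)) * ρ ^ 3 := by ring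
      _ ≤ _ := by gcongr
  obtain ⟨x₁, x₂, x₃, h0, h2, hfac⟩ := exists_cubic_roots s e
  -- the roots lie in the disc of radius `T ρ`
  have hbd : ∀ x : ℂ, x ^ 3 - s / 2 * x - e = 0 → ‖x‖ ≤ T * ρ := by
    intro x hx
    by_contra! hcon
    have h1 : ρ < ‖x‖ := by nlinarith
    have hx3 : x ^ 3 = s / 2 * x + e := by linear_combination hx
    have h4 : ‖x‖ ^ 3 ≤ 3 * (M * ρ) ^ 2 * ‖x‖ + ρ ^ 3 := by
      rw [← norm_pow, hx3]
      refine (norm_add_le _ _).trans (add_le_add ?_ hen)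
      rw [norm_mul, norm_div, Complex.norm_ofNat]
      gcongr
      linarith
    have h5 : ρ ^ 3 ≤ ρ ^ 2 * ‖x‖ := by nlinarith [sq_nonneg ρ]
    have h6 : ‖x‖ ^ 2 * ‖x‖ ≤ (T * ρ ^ 2) * ‖x‖ := by rw [hT]; nlinarith
    have h7 : ‖x‖ ^ 2 ≤ T * ρ ^ 2 := le_of_mul_le_mul_right h6 (by linarith)
    have h8 : (T * ρ) ^ 2 < ‖x‖ ^ 2 := by gcongr
    have h9 : T * ρ ^ 2 ≤ (T * ρ) ^ 2 := by
      have : 0 < ρ ^ 2 := by positivity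
      nlinarith [mul_le_mul_of_nonneg_right hT1 (by positivity : 0 ≤ T * ρ ^ 2)]
    linarith
  have hb₁ := hbd x₁ (by rw [← hfac]; ring)
  have hb₂ := hbd x₂ (by rw [← hfac]; ring)
  have hb₃ := hbd x₃ (by rw [← hfac]; ring)
  have hdiff : ∀ x y : ℂ, ‖x‖ ≤ T * ρ → ‖y‖ ≤ T * ρ → ‖x - y‖ ≤ 2 * T * ρ := fun x y hx hy =>
    (norm_sub_le _ _).trans (by linarith)
  -- the discriminant is bounded below
  have hdisc : ρ ^ 3 / (2 * n) ≤ ‖(x₁ - x₂) * (x₁ - x₃) * (x₂ - x₃)‖ := by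
    have hx3 : x₃ = -x₁ - x₂ := by linear_combination h0
    have he3 : e = x₁ * x₂ * x₃ := by
      have := hfac 0
      simp only [zero_sub] at this
      linear_combination this
    have h4 : ((x₁ - x₂) * (x₁ - x₃) * (x₂ - x₃)) ^ 2 = 27 * (-(e - a)) * (e - -a) := by
      have h5 : 27 * (-(e - a)) * (e - -a) = s ^ 3 / 2 - 27 * e ^ 2 := by
        linear_combination 27 * ha
      rw [h5, he3, ← h2, hx3]
      ring
    have h6 : (ρ ^ 3 / (2 * n)) ^ 2 ≤ ‖(x₁ - x₂) * (x₁ - x₃) * (x₂ - x₃)‖ ^ 2 := by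
      rw [← norm_pow, h4, norm_mul, norm_mul, norm_neg, Complex.norm_ofNat]
      have h7 := hfar a (by simp [hS])
      have h8 := hfar (-a) (by simp [hS])
      have h9 : 0 ≤ ρ ^ 3 / (2 * n) := by positivity
      calc (ρ ^ 3 / (2 * n)) ^ 2 = 1 * (ρ ^ 3 / (2 * n)) * (ρ ^ 3 / (2 * n)) := by ring
        _ ≤ 27 * ‖e - a‖ * ‖e - -a‖ := by gcongr; norm_num
    exact le_of_sq_le_sq h6 (norm_nonneg _)
  have hsep : ∀ u v w : ℂ, ‖v‖ ≤ 2 * T * ρ → ‖w‖ ≤ 2 * T * ρ → ρ ^ 3 / (2 * n) ≤ ‖u‖ * ‖v‖ * ‖w‖ →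
      δ * ρ ≤ ‖u‖ := by
    intro u v w hv hw h
    have h1 : ‖u‖ * ‖v‖ * ‖w‖ ≤ ‖u‖ * (2 * T * ρ) * (2 * T * ρ) := by gcongr
    have h2 : (ρ / (8 * n * T ^ 2)) * (4 * T ^ 2 * ρ ^ 2) ≤ ‖u‖ * (4 * T ^ 2 * ρ ^ 2) := by
      calc (ρ / (8 * n * T ^ 2)) * (4 * T ^ 2 * ρ ^ 2) = ρ ^ 3 / (2 * n) := by
            field_simp; norm_num
        _ ≤ _ := h.trans h1
        _ = _ := by ring
    have h3 := le_of_mul_le_mul_right h2 (by positivity)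
    refine le_trans ?_ h3
    rw [hδ, one_div_mul_eq_div]
    gcongr
    norm_num
  have h12 : δ * ρ ≤ ‖x₁ - x₂‖ := hsep _ (x₁ - x₃) (x₂ - x₃) (hdiff _ _ hb₁ hb₃)
    (hdiff _ _ hb₂ hb₃) (by rwa [← norm_mul, ← norm_mul])
  have h13 : δ * ρ ≤ ‖x₁ - x₃‖ := hsep _ (x₁ - x₂) (x₂ - x₃) (hdiff _ _ hb₁ hb₂)
    (hdiff _ _ hb₂ hb₃) (by rw [← norm_mul, ← norm_mul]; convert hdisc using 2; ring)
  have h23 : δ * ρ ≤ ‖x₂ - x₃‖ := hsep _ (x₁ - x₂) (x₁ - x₃) (hdiff _ _ hb₁ hb₂)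
    (hdiff _ _ hb₁ hb₃) (by rw [← norm_mul, ← norm_mul]; convert hdisc using 2; ring)
  -- a root cannot be close to a point of `F`
  have hF' : ∀ w ∈ F, ∀ u v t : ℂ, ‖u‖ ≤ T * ρ → ‖v‖ ≤ T * ρ → ‖t‖ ≤ T * ρ →
      (∀ y, (y - u) * (y - v) * (y - t) = y ^ 3 - s / 2 * y - e) →
      δ * ρ ≤ ‖β + u - w‖ := by
    intro w hw u v t hu hv ht hfac'
    by_contra! hcon
    have h1 := hfar ((w - β) ^ 3 - s / 2 * (w - β)) (by
      rw [hS, Finset.mem_union]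
      left
      exact Finset.mem_image.2 ⟨w, hw, rfl⟩)
    have h2 : e - ((w - β) ^ 3 - s / 2 * (w - β)) = (β + u - w) * (w - β - v) * (w - β - t) := by
      linear_combination hfac' (w - β)
    rw [h2, norm_mul, norm_mul] at h1
    have h3 : ∀ v : ℂ, ‖v‖ ≤ T * ρ → ‖w - β - v‖ ≤ 3 * T * ρ := by
      intro v hv
      calc ‖w - β - v‖ = ‖(u - v) - (β + u - w)‖ := by ring_nf
        _ ≤ ‖u - v‖ + ‖β + u - w‖ := norm_sub_le _ _
        _ ≤ 2 * T * ρ + δ * ρ := add_le_add (hdiff _ _ hu hv) hcon.le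
        _ ≤ _ := by nlinarith
    have h4 : ‖β + u - w‖ * ‖w - β - v‖ * ‖w - β - t‖ ≤ ‖β + u - w‖ * (3 * T * ρ) * (3 * T * ρ) := by
      gcongr
      · exact h3 v hv
      · exact h3 t ht
    have h5 : ‖β + u - w‖ * (3 * T * ρ) * (3 * T * ρ) < (δ * ρ) * (3 * T * ρ) * (3 * T * ρ) := by
      gcongr
    have h6 : (δ * ρ) * (3 * T * ρ) * (3 * T * ρ) = ρ ^ 3 / (2 * n) := by
      rw [hδ]; field_simp; norm_num
    linarith
  refine ⟨![β + x₁, β + x₂, β + x₃], ?_, ?_, ?_, ?_, ?_⟩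
  · simp only [Fin.sum_univ_three, Matrix.cons_val_zero, Matrix.cons_val_one, Matrix.cons_val]
    rw [hβ]; linear_combination h0
  · simp only [Fin.sum_univ_three, Matrix.cons_val_zero, Matrix.cons_val_one, Matrix.cons_val]
    rw [hβ]; linear_combination h2 + 2 * p₁ / 3 * h0
  · have hb : ∀ x : ℂ, ‖x‖ ≤ T * ρ → dist (β + x) c ≤ (M + T) * ρ := by
      intro x hx
      rw [dist_eq_norm, hβ]
      calc ‖c + p₁ / 3 + x - c‖ = ‖p₁ / 3 + x‖ := by ring_nf
        _ ≤ ‖p₁ / 3‖ + ‖x‖ := norm_add_le _ _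
        _ ≤ M * ρ + T * ρ := by
            gcongr
            rw [norm_div, Complex.norm_ofNat]
            linarith
        _ = _ := by ring
    intro i
    fin_cases i
    · exact hb _ hb₁
    · exact hb _ hb₂
    · exact hb _ hb₃
  · have e1 : ∀ x y : ℂ, dist (β + x) (β + y) = ‖x - y‖ := fun x y => by
      rw [dist_add_left, dist_eq_norm]
    intro i j hij
    fin_cases i <;> fin_cases j <;> simp only [Fin.zero_eta, Fin.mk_one, Fin.reduceFinMk, ne_eq,
      not_true_eq_false, Matrix.cons_val_zero, Matrix.cons_val_one, Matrix.cons_val, e1] at hij ⊢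
    · exact h12
    · exact h13
    · rw [norm_sub_rev]; exact h12
    · exact h23
    · rw [norm_sub_rev]; exact h13
    · rw [norm_sub_rev]; exact h23
  · intro w hw i
    fin_cases i
    · exact (hF' w hw x₁ x₂ x₃ hb₁ hb₂ hb₃ hfac).trans_eq (dist_eq_norm _ _).symm
    · exact (hF' w hw x₂ x₁ x₃ hb₂ hb₁ hb₃ (fun y => by rw [← hfac]; ring)).trans_eq
        (dist_eq_norm _ _).symm
    · exact (hF' w hw x₃ x₁ x₂ hb₃ hb₁ hb₂ (fun y => by rw [← hfac]; ring)).trans_eq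
        (dist_eq_norm _ _).symm

end Points

/-! ### Discretization of a doubling measure -/

section Pieces

/-- A discretization of `μ`: pieces `ν k` of mass `6π` with sum `μ`, located at `c k` at the scale
`rho μ (c k)`, and for each of them three points `x k i` at the same location that, for `k ≠ 0`,
have the same moments of order at most two as `ν k / 2π`. All the points together are separated at
the scale `rho`. The piece `k = 0` is exempt from the moment conditions so that one of its points can
be prescribed. -/
structure Pieces (μ : Measure ℂ) (c : ℕ → ℂ) (ν : ℕ → Measure ℂ) (x : ℕ → Fin 3 → ℂ)
    (L A δ : ℝ) : Prop where
  one_le : 1 ≤ L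
  pos : 0 < δ
  sum_eq : Measure.sum ν = μ
  mass : ∀ k, ν k univ = ENNReal.ofReal (6 * Real.pi)
  supp : ∀ k, ν k (closedBall (c k) (L * rho μ (c k)))ᶜ = 0
  loc : ∀ k i, dist (x k i) (c k) ≤ L * rho μ (c k)
  sep : ∀ k i l j, (k, i) ≠ (l, j) →
    δ * max (rho μ (c k)) (rho μ (c l)) ≤ dist (x k i) (x l j)
  moment_one : ∀ k, k ≠ 0 → ∑ i, (x k i - c k) = (2 * Real.pi : ℂ)⁻¹ * ∫ ζ, (ζ - c k) ∂(ν k)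
  moment_two : ∀ k, k ≠ 0 →
    ∑ i, (x k i - c k) ^ 2 = (2 * Real.pi : ℂ)⁻¹ * ∫ ζ, (ζ - c k) ^ 2 ∂(ν k)
  decay : ∀ z, Summable (fun k => decay μ (c k) z) ∧ ∑' k, decay μ (c k) z ≤ A

variable {μ : Measure ℂ} [IsLocallyFiniteMeasure μ] {C q : ℝ}

/-- Only boundedly many of the points `c j` are within a bounded multiple of the scale of `c k`. -/
theorem DoublingBounds.exists_card_le (B : DoublingBounds μ C q) {c : ℕ → ℂ} {A : ℝ}
    (hA : ∀ z, Summable (fun k => decay μ (c k) z) ∧ ∑' k, decay μ (c k) z ≤ A) (T : ℝ) :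
    ∃ N : ℕ, ∀ (z : ℂ) (S : Finset ℕ), (∀ j ∈ S, dist z (c j) ≤ T * max (rho μ z) (rho μ (c j))) →
      S.card ≤ N := by
  obtain ⟨K, hK1, hK⟩ := B.exists_comparable T
  set η : ℝ := (1 / (1 + |T| * K)) ^ 3 with hη
  have hη0 : 0 < η := by positivity
  obtain ⟨N, hN⟩ := exists_nat_ge (A / η)
  refine ⟨N, fun z S hS => ?_⟩
  have h1 : ∀ j ∈ S, η ≤ FockMultiplier.decay μ (c j) z := by
    intro j hj
    have hj0 := B.rho_pos (c j)
    have hd : 0 ≤ dist z (c j) := dist_nonneg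
    have h2 := hK z (c j) (hS j hj)
    have h3 : max (rho μ z) (rho μ (c j)) ≤ K * rho μ (c j) :=
      max_le h2 (by nlinarith)
    have h4 : dist z (c j) ≤ |T| * (K * rho μ (c j)) :=
      (hS j hj).trans (mul_le_mul (le_abs_self T) h3 (le_max_of_le_right hj0.le) (abs_nonneg T))
    rw [hη, FockMultiplier.decay]
    apply pow_le_pow_left₀ (by positivity)
    rw [div_le_div_iff₀ (by positivity) (by positivity)]
    linarith
  have h2 : (S.card : ℝ) * η ≤ A := by
    calc (S.card : ℝ) * η = ∑ j ∈ S, η := by simp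
      _ ≤ ∑ j ∈ S, FockMultiplier.decay μ (c j) z := Finset.sum_le_sum h1
      _ ≤ ∑' k, FockMultiplier.decay μ (c k) z :=
          (hA z).1.sum_le_tsum S fun j _ => (B.decay_pos _ _).le
      _ ≤ A := (hA z).2
  rw [← le_div_iff₀ hη0] at h2
  exact_mod_cast h2.trans hN

/-- A discretization exists, with one of the points prescribed. The triples are found greedily: each
has the two moments of its piece, and the free parameter of `exists_three_points` is used to avoid
the boundedly many points already placed nearby. -/
theorem DoublingBounds.exists_pieces (B : DoublingBounds μ C q) (z₀ : ℂ) :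
    ∃ c ν x L A δ, Pieces μ c ν x L A δ ∧ x 0 0 = z₀ := by
  obtain ⟨M, c, ν, hM, hsum, hmass, hsupp⟩ :=
    B.exists_decomposition (m := 6 * Real.pi) (by positivity)
  obtain ⟨A, hA, hdec⟩ := B.exists_tsum_decay_le (by linarith) (by positivity) hsum hmass hsupp
  have hρ : ∀ k, 0 < rho μ (c k) := fun k => B.rho_pos (c k)
  set L₀ : ℝ := dist z₀ (c 0) / rho μ (c 0) + 2 with hL₀
  -- the moments that the triples have to match
  set p₁ : ℕ → ℂ := fun k => (2 * Real.pi : ℂ)⁻¹ * ∫ ζ, (ζ - c k) ∂(ν k) with hp₁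
  set p₂ : ℕ → ℂ := fun k => (2 * Real.pi : ℂ)⁻¹ * ∫ ζ, (ζ - c k) ^ 2 ∂(ν k) with hp₂
  have hmom : ∀ k (f : ℂ → ℂ) (b : ℝ), (∀ ζ ∈ closedBall (c k) (M * rho μ (c k)), ‖f ζ‖ ≤ b) →
      ‖(2 * Real.pi : ℂ)⁻¹ * ∫ ζ, f ζ ∂(ν k)‖ ≤ 3 * b := by
    intro k f b hf
    have hfin : IsFiniteMeasure (ν k) := ⟨by rw [hmass]; exact ENNReal.ofReal_lt_top⟩
    have hae : ∀ᵐ ζ ∂(ν k), ‖f ζ‖ ≤ b := by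
      have : ∀ᵐ ζ ∂(ν k), ζ ∈ closedBall (c k) (M * rho μ (c k)) := by
        rw [ae_iff]; exact hsupp k
      filter_upwards [this] with ζ hζ using hf ζ hζ
    have h1 := norm_integral_le_of_norm_le_const hae
    rw [Measure.real, hmass, ENNReal.toReal_ofReal (by positivity)] at h1
    have hpi := Real.pi_pos
    have h2 : ‖(2 * Real.pi : ℂ)⁻¹‖ = (2 * Real.pi)⁻¹ := by
      rw [norm_inv, norm_mul, Complex.norm_real, Real.norm_of_nonneg hpi.le, Complex.norm_ofNat]
    rw [norm_mul, h2]
    calc (2 * Real.pi)⁻¹ * ‖∫ ζ, f ζ ∂(ν k)‖ ≤ (2 * Real.pi)⁻¹ * (b * (6 * Real.pi)) := by gcongr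
      _ = _ := by field_simp; ring
  have hp₁b : ∀ k, ‖p₁ k‖ ≤ 3 * M * rho μ (c k) := by
    intro k
    rw [mul_assoc]
    exact hmom k (fun ζ => ζ - c k) _ fun ζ hζ => by
      rw [← dist_eq_norm]; exact hζ
  have hp₂b : ∀ k, ‖p₂ k‖ ≤ 3 * (M * rho μ (c k)) ^ 2 := by
    intro k
    exact hmom k (fun ζ => (ζ - c k) ^ 2) _ fun ζ hζ => by
      rw [norm_pow, ← dist_eq_norm]
      have : dist ζ (c k) ≤ M * rho μ (c k) := hζ
      gcongr
  -- the range over which separation has to be arranged depends on the localization constant,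
  -- which by the lemma on triples does not depend on the number of points to avoid
  obtain ⟨L₁, hL₁1, htri⟩ := exists_three_points hM
  obtain ⟨L, hLL₁, hLL₀, hLM⟩ : ∃ L : ℝ, L₁ ≤ L ∧ L₀ ≤ L ∧ M ≤ L :=
    ⟨max L₁ (max L₀ M), le_max_left _ _, (le_max_left _ _).trans (le_max_right _ _),
      (le_max_right _ _).trans (le_max_right _ _)⟩
  have hL1 : 1 ≤ L := hL₁1.trans hLL₁
  obtain ⟨N, hN⟩ := B.exists_card_le hdec (4 * L)
  obtain ⟨δ, hδ, hpts⟩ := htri (N * 3)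
  obtain ⟨K, hK1, hK⟩ := B.exists_comparable (4 * L)
  classical
  set near : ℕ → Finset ℕ := fun k => (Finset.range k).filter fun j =>
    dist (c k) (c j) ≤ 4 * L * max (rho μ (c k)) (rho μ (c j)) with hnear
  set F : ℕ → (ℕ → Fin 3 → ℂ) → Finset ℂ := fun k y =>
    (near k ×ˢ Finset.univ).image fun p => y p.1 p.2 with hF
  have hFcard : ∀ k y, (F k y).card ≤ N * 3 := by
    intro k y
    refine Finset.card_image_le.trans ?_
    rw [Finset.card_product, Finset.card_univ, Fintype.card_fin]
    gcongr
    apply hN (c k)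
    intro j hj
    exact (Finset.mem_filter.1 hj).2
  choose step hs1 hs2 hs3 hs4 hs5 using fun (k : ℕ) (y : ℕ → Fin 3 → ℂ) =>
    hpts (rho μ (c k)) (c k) (p₁ k) (p₂ k) (F k y) (hρ k) (hp₁b k) (hp₂b k) (hFcard k y)
  -- the triples are chosen one after the other, each avoiding the nearby earlier ones
  obtain ⟨x, hx0, hx⟩ : ∃ x : ℕ → Fin 3 → ℂ, (x 0 = fun i : Fin 3 => z₀ + (((i : ℕ) : ℝ) *
      rho μ (c 0) : ℝ)) ∧ ∀ k, k ≠ 0 → x k = step k fun j => if j < k then x j else 0 := by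
    set x : ℕ → Fin 3 → ℂ := fun k => Nat.strongRec (motive := fun _ => Fin 3 → ℂ)
      (fun k ih => if k = 0 then fun i : Fin 3 => z₀ + (((i : ℕ) : ℝ) * rho μ (c 0) : ℝ)
        else step k fun j => if h : j < k then ih j h else 0) k with hx
    have hxk : ∀ k, x k = if k = 0 then fun i : Fin 3 => z₀ + (((i : ℕ) : ℝ) * rho μ (c 0) : ℝ)
        else step k fun j => if j < k then x j else 0 := by
      intro k
      rw [hx]
      simp only
      rw [Nat.strongRec_eq]
      simp only [dite_eq_ite]
    refine ⟨x, by rw [hxk, if_pos rfl], fun k hk => ?_⟩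
    rw [hxk, if_neg hk]
  have hloc : ∀ k i, dist (x k i) (c k) ≤ L * rho μ (c k) := by
    intro k i
    by_cases hk : k = 0
    · subst hk
      rw [hx0]
      simp only
      have h1 : dist (z₀ + ((((i : ℕ) : ℝ) * rho μ (c 0) : ℝ) : ℂ)) z₀ ≤ 2 * rho μ (c 0) := by
        rw [dist_eq_norm, add_sub_cancel_left, Complex.norm_real,
          Real.norm_of_nonneg (by have := hρ 0; positivity)]
        have h2 : ((i : ℕ) : ℝ) ≤ 2 := by
          have : (i : ℕ) ≤ 2 := by omega
          exact_mod_cast this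
        have := hρ 0
        gcongr
      have h3 : dist z₀ (c 0) + 2 * rho μ (c 0) = L₀ * rho μ (c 0) := by
        have := (hρ 0).ne'
        rw [hL₀]; field_simp
      have h4 : L₀ * rho μ (c 0) ≤ L * rho μ (c 0) := by
        have := hρ 0
        gcongr
      linarith [dist_triangle (z₀ + ((((i : ℕ) : ℝ) * rho μ (c 0) : ℝ) : ℂ)) z₀ (c 0)]
    · rw [hx k hk]
      refine (hs3 _ _ i).trans ?_
      have := hρ k
      gcongr
  set δ' : ℝ := min (min δ 1 / K) 1 with hδ'
  have hδ'0 : 0 < δ' := by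
    have : 0 < min δ 1 := lt_min hδ one_pos
    rw [hδ']
    positivity
  have hδ'1 : δ' ≤ 1 := min_le_right _ _
  have hδ'K : δ' * K ≤ δ := by
    calc δ' * K ≤ (min δ 1 / K) * K := by gcongr; exact min_le_left _ _
      _ = min δ 1 := div_mul_cancel₀ _ (by positivity)
      _ ≤ δ := min_le_left _ _
  have hδ'δ : δ' ≤ δ := (le_mul_of_one_le_right hδ'0.le hK1).trans hδ'K
  have hsame : ∀ k i j, i ≠ j → δ' * rho μ (c k) ≤ dist (x k i) (x k j) := by
    intro k i j hij
    have hk' := hρ k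
    by_cases hk : k = 0
    · subst hk
      rw [hx0]
      simp only
      rw [dist_add_left, dist_eq_norm, ← Complex.ofReal_sub, Complex.norm_real, ← sub_mul,
        norm_mul, Real.norm_of_nonneg hk'.le]
      have h1 : (1:ℝ) ≤ ‖((i : ℕ) : ℝ) - ((j : ℕ) : ℝ)‖ := by
        have h2 : (1:ℤ) ≤ |((i : ℕ) : ℤ) - ((j : ℕ) : ℤ)| := by
          apply Int.one_le_abs
          intro h
          apply hij
          ext
          omega
        rw [Real.norm_eq_abs]
        exact_mod_cast h2
      exact mul_le_mul_of_nonneg_right (hδ'1.trans h1) hk'.le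
    · rw [hx k hk]
      exact (mul_le_mul_of_nonneg_right hδ'δ hk'.le).trans (hs4 k _ i j hij)
  have hlt : ∀ k i l j, l < k →
      δ' * max (rho μ (c k)) (rho μ (c l)) ≤ dist (x k i) (x l j) := by
    intro k i l j hlk
    have hk' := hρ k
    have hl' := hρ l
    by_cases hd : dist (c k) (c l) ≤ 4 * L * max (rho μ (c k)) (rho μ (c l))
    · have hk0 : k ≠ 0 := by omega
      have h1 : x l j ∈ F k fun j => if j < k then x j else 0 := by
        rw [hF]
        refine Finset.mem_image.2 ⟨(l, j), ?_, by simp [hlk]⟩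
        rw [Finset.mem_product]
        exact ⟨Finset.mem_filter.2 ⟨Finset.mem_range.2 hlk, hd⟩, Finset.mem_univ _⟩
      have h2 : δ * rho μ (c k) ≤ dist (x k i) (x l j) := by
        rw [hx k hk0]
        exact hs5 k _ _ h1 i
      have h3 : max (rho μ (c k)) (rho μ (c l)) ≤ K * rho μ (c k) := by
        apply max_le (by nlinarith)
        apply hK
        rw [dist_comm, max_comm]; exact hd
      calc δ' * max (rho μ (c k)) (rho μ (c l)) ≤ δ' * (K * rho μ (c k)) := by gcongr
        _ = (δ' * K) * rho μ (c k) := by ring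
        _ ≤ δ * rho μ (c k) := by gcongr
        _ ≤ _ := h2
    · push Not at hd
      have h1 := hloc k i
      have h2 := hloc l j
      have h3 := dist_triangle4 (c k) (x k i) (x l j) (c l)
      rw [dist_comm (c k) (x k i)] at h3
      have h4 := le_max_left (rho μ (c k)) (rho μ (c l))
      have h5 := le_max_right (rho μ (c k)) (rho μ (c l))
      have h6 : L * rho μ (c k) ≤ L * max (rho μ (c k)) (rho μ (c l)) := by gcongr
      have h7 : L * rho μ (c l) ≤ L * max (rho μ (c k)) (rho μ (c l)) := by gcongr
      have h8 : δ' * max (rho μ (c k)) (rho μ (c l)) ≤ L * max (rho μ (c k)) (rho μ (c l)) := by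
        gcongr
        linarith
      have h9 : 0 < L * max (rho μ (c k)) (rho μ (c l)) := by positivity
      linarith
  refine ⟨c, ν, x, L, A, δ', ⟨hL1, hδ'0, hsum, hmass, ?_, hloc, ?_, ?_, ?_, hdec⟩, ?_⟩
  · intro k
    refine measure_mono_null ?_ (hsupp k)
    apply compl_subset_compl.2
    apply closedBall_subset_closedBall
    have := hρ k
    gcongr
  · intro k i l j hne
    rcases lt_trichotomy k l with h | h | h
    · rw [max_comm, dist_comm]; exact hlt l j k i h
    · subst h
      rw [max_self]
      exact hsame k i j fun hij => hne (by rw [hij])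
    · exact hlt k i l j h
  · intro k hk
    rw [hx k hk]; exact hs1 k _
  · intro k hk
    rw [hx k hk]; exact hs2 k _
  · rw [hx0]; simp

end Pieces

/-! ### Potentials of compensated pieces -/

section Potentials

/-- The difference of the logarithmic potentials of three unit masses at the points `x i` and of the
measure `ν / 2π`. -/
def potentialDiff (ν : Measure ℂ) (x : Fin 3 → ℂ) (z : ℂ) : ℝ :=
  ∑ i, Real.log ‖z - x i‖ - (2 * Real.pi)⁻¹ * ∫ ζ, Real.log ‖z - ζ‖ ∂ν

/-- The part of `potentialDiff` that is unbounded near the points `x i`, at the scale `s`. -/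
def localLog (s : ℝ) (x : Fin 3 → ℂ) (z : ℂ) : ℝ :=
  ∑ i, Real.log (min 1 (‖z - x i‖ / s))

theorem localLog_eq_zero {s : ℝ} {x : Fin 3 → ℂ} {z : ℂ} (hs : 0 < s)
    (h : ∀ i, s ≤ ‖z - x i‖) : localLog s x z = 0 := by
  refine Finset.sum_eq_zero fun i _ => ?_
  rw [min_eq_left ((one_le_div hs).2 (h i)), Real.log_one]

theorem DoublingBounds.measure_singleton {μ : Measure ℂ} {C q : ℝ} (B : DoublingBounds μ C q) (z : ℂ) : μ {z} = 0 := by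
  refine measure_mono_null ?_ (B.sphere (z + 1) 1 one_pos)
  simp

section PiecesBasic

variable {μ : Measure ℂ} {c : ℕ → ℂ} {ν : ℕ → Measure ℂ} {x : ℕ → Fin 3 → ℂ} {L A δ : ℝ}

theorem Pieces.le (P : Pieces μ c ν x L A δ) (k : ℕ) : ν k ≤ μ := by
  conv_rhs => rw [← P.sum_eq]
  exact Measure.le_sum ν k

theorem Pieces.isFiniteMeasure (P : Pieces μ c ν x L A δ) (k : ℕ) : IsFiniteMeasure (ν k) :=
  ⟨by rw [P.mass]; exact ENNReal.ofReal_lt_top⟩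

theorem Pieces.real_mass (P : Pieces μ c ν x L A δ) (k : ℕ) :
    (ν k).real univ = 6 * Real.pi := by
  rw [Measure.real, P.mass, ENNReal.toReal_ofReal (by positivity)]

/-- The bound for the total contribution of the `k`-th piece. The piece `k = 0` has no moment
conditions, so that its contribution is bounded but need not decay. -/
def pieceBound (μ : Measure ℂ) (c : ℕ → ℂ) (k : ℕ) (z : ℂ) : ℝ :=
  decay μ (c k) z + if k = 0 then 1 else 0

theorem Pieces.summable_pieceBound (P : Pieces μ c ν x L A δ) (z : ℂ) :
    Summable (fun k => pieceBound μ c k z) ∧ ∑' k, pieceBound μ c k z ≤ A + 1 := by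
  have h1 := (hasSum_ite_eq (0:ℕ) (1:ℝ))
  refine ⟨(P.decay z).1.add h1.summable, ?_⟩
  have h2 := (P.decay z).1.tsum_add h1.summable
  simp only [pieceBound]
  rw [h2, h1.tsum_eq]
  linarith [(P.decay z).2]

end PiecesBasic

variable {μ : Measure ℂ} [IsLocallyFiniteMeasure μ] {C q : ℝ}

/-- Uniformly in `z` at a bounded distance from `c`, in units of `rho μ c`, the potential of a piece
of `μ` located at `c` differs by a bounded amount from that of its mass at distance `rho μ c`. -/
theorem DoublingBounds.exists_lintegral_log_norm_le (B : DoublingBounds μ C q) (L M : ℝ) :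
    ∃ A : ℝ, 0 < A ∧ ∀ (c z : ℂ) (ν : Measure ℂ), dist z c ≤ L * rho μ c → ν ≤ μ →
      ν (closedBall c (M * rho μ c))ᶜ = 0 →
      ∫⁻ ζ, ‖Real.log ‖z - ζ‖ - Real.log (rho μ c)‖ₑ ∂ν ≤ ENNReal.ofReal A := by
  obtain ⟨A, hA, h⟩ := B.exists_lintegral_log_le L M
  refine ⟨A, hA, fun c z ν hz hν hs => le_trans (le_of_eq ?_) (h c z ν hz hν hs)⟩
  apply lintegral_congr_ae
  have h0 : ν {z} = 0 := le_antisymm ((hν _).trans (B.measure_singleton z).le) zero_le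
  have h1 : ∀ᵐ ζ ∂ν, ζ ≠ z := by
    rw [ae_iff]; simpa using h0
  filter_upwards [h1] with ζ hζ
  rw [Real.enorm_eq_ofReal_abs, dist_eq_norm,
    Real.log_div (norm_ne_zero_iff.2 (sub_ne_zero.2 hζ.symm)) (B.rho_pos c).ne']

theorem measurable_log_norm_sub : Measurable fun p : ℂ × ℂ => Real.log ‖p.1 - p.2‖ := by
  fun_prop

/-- The potential of a compactly supported piece of `μ` is bounded on bounded sets. -/
theorem DoublingBounds.exists_lintegral_enorm_log_le (B : DoublingBounds μ C q) {c : ℂ} {M : ℝ}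
    {ν : Measure ℂ} [IsFiniteMeasure ν] (hν : ν ≤ μ)
    (hs : ν (closedBall c (M * rho μ c))ᶜ = 0) (r : ℝ) :
    ∃ A : ℝ, 0 < A ∧ ∀ z ∈ ball 0 r, ∫⁻ ζ, ‖Real.log ‖z - ζ‖‖ₑ ∂ν ≤ ENNReal.ofReal A := by
  have hc := B.rho_pos c
  obtain ⟨A, hA, h⟩ := B.exists_lintegral_log_norm_le ((r + ‖c‖) / rho μ c) M
  refine ⟨A + |Real.log (rho μ c)| * ν.real univ, by positivity, fun z hz => ?_⟩
  have hz' : dist z c ≤ (r + ‖c‖) / rho μ c * rho μ c := by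
    rw [div_mul_cancel₀ _ hc.ne', dist_eq_norm]
    have : ‖z‖ < r := by simpa using hz
    linarith [norm_sub_le z c]
  have h1 : ∀ ζ, ‖Real.log ‖z - ζ‖‖ₑ ≤
      ‖Real.log ‖z - ζ‖ - Real.log (rho μ c)‖ₑ + ‖Real.log (rho μ c)‖ₑ := by
    intro ζ
    calc ‖Real.log ‖z - ζ‖‖ₑ
        = ‖(Real.log ‖z - ζ‖ - Real.log (rho μ c)) + Real.log (rho μ c)‖ₑ := by
          rw [sub_add_cancel]
      _ ≤ _ := enorm_add_le _ _
  calc ∫⁻ ζ, ‖Real.log ‖z - ζ‖‖ₑ ∂ν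
      ≤ ∫⁻ ζ, (‖Real.log ‖z - ζ‖ - Real.log (rho μ c)‖ₑ + ‖Real.log (rho μ c)‖ₑ) ∂ν :=
        lintegral_mono h1
    _ = ∫⁻ ζ, ‖Real.log ‖z - ζ‖ - Real.log (rho μ c)‖ₑ ∂ν + ‖Real.log (rho μ c)‖ₑ * ν univ := by
        rw [lintegral_add_right _ measurable_const, lintegral_const]
    _ ≤ ENNReal.ofReal A + ‖Real.log (rho μ c)‖ₑ * ν univ := by
        gcongr; exact h c z ν hz' hν hs
    _ = ENNReal.ofReal (A + |Real.log (rho μ c)| * ν.real univ) := by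
        rw [ENNReal.ofReal_add hA.le (by positivity), ENNReal.ofReal_mul (abs_nonneg _),
          Real.enorm_eq_ofReal_abs, ofReal_measureReal]

theorem DoublingBounds.integrable_log_norm_sub (B : DoublingBounds μ C q) {c : ℂ} {M : ℝ}
    {ν : Measure ℂ} [IsFiniteMeasure ν] (hν : ν ≤ μ)
    (hs : ν (closedBall c (M * rho μ c))ᶜ = 0) (z : ℂ) :
    Integrable (fun ζ => Real.log ‖z - ζ‖) ν := by
  obtain ⟨A, hA, h⟩ := B.exists_lintegral_enorm_log_le hν hs (‖z‖ + 1)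
  refine ⟨(measurable_log_norm_sub.comp measurable_prodMk_left).aestronglyMeasurable, ?_⟩
  exact (h z (by simp)).trans_lt ENNReal.ofReal_lt_top

theorem measurable_potentialDiff (ν : Measure ℂ) [IsFiniteMeasure ν] (x : Fin 3 → ℂ) :
    Measurable (potentialDiff ν x) := by
  have h1 : StronglyMeasurable fun z => ∫ ζ, Real.log ‖z - ζ‖ ∂ν :=
    measurable_log_norm_sub.stronglyMeasurable.integral_prod_right
  have h2 := h1.measurable
  unfold potentialDiff
  fun_prop

/-- The second order expansion of the logarithm at a point far from the origin. -/
theorem abs_log_norm_sub_le {a w : ℂ} (ha : a ≠ 0) (h : 2 * ‖w‖ ≤ ‖a‖) :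
    |Real.log ‖a - w‖ - Real.log ‖a‖ + (w / a + (w / a) ^ 2 / 2).re| ≤ (‖w‖ / ‖a‖) ^ 3 := by
  have ha0 : 0 < ‖a‖ := norm_pos_iff.2 ha
  set y := -(w / a) with hy
  have hyn : ‖y‖ = ‖w‖ / ‖a‖ := by rw [hy, norm_neg, norm_div]
  have hy2 : ‖y‖ ≤ 1 / 2 := by
    rw [hyn, div_le_iff₀ ha0]; linarith
  have h1 := Complex.norm_log_sub_logTaylor_le 2 (z := y) (by linarith)
  have h2 : (1 - ‖y‖)⁻¹ ≤ 2 := by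
    rw [inv_le_comm₀ (by linarith) two_pos]; linarith
  have h3 : 1 + y ≠ 0 := by
    intro h0
    have : ‖y‖ = 1 := by
      rw [show y = -1 by linear_combination h0, norm_neg, norm_one]
    linarith
  have h4 : Real.log ‖a - w‖ = Real.log ‖a‖ + (Complex.log (1 + y)).re := by
    rw [Complex.log_re, ← Real.log_mul ha0.ne' (norm_ne_zero_iff.2 h3), ← norm_mul]
    congr 2
    rw [hy]; field_simp; ring
  have h5 : Complex.logTaylor 3 y = -(w / a + (w / a) ^ 2 / 2) := by
    simp only [Complex.logTaylor, Finset.sum_range_succ, Finset.sum_range_zero, hy]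
    push_cast
    ring
  rw [h4, ← hyn]
  have h6 : Real.log ‖a‖ + (Complex.log (1 + y)).re - Real.log ‖a‖ +
      (w / a + (w / a) ^ 2 / 2).re = (Complex.log (1 + y) - Complex.logTaylor (2 + 1) y).re := by
    rw [show 2 + 1 = 3 from rfl, h5, Complex.sub_re, Complex.neg_re]
    ring
  rw [h6]
  refine (Complex.abs_re_le_norm _).trans (h1.trans ?_)
  have h7 : 0 ≤ ‖y‖ ^ 3 := by positivity
  have h8 : ‖y‖ ^ (2 + 1) * (1 - ‖y‖)⁻¹ ≤ ‖y‖ ^ 3 * 2 := by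
    apply mul_le_mul_of_nonneg_left h2 h7
  rw [div_le_iff₀ (by positivity)]
  push_cast
  linarith

/-- The zeroth order version, for the piece without moment conditions. -/
theorem abs_log_norm_sub_le_one {a w : ℂ} (ha : a ≠ 0) (h : 2 * ‖w‖ ≤ ‖a‖) :
    |Real.log ‖a - w‖ - Real.log ‖a‖| ≤ 1 := by
  have ha0 : 0 < ‖a‖ := norm_pos_iff.2 ha
  have h1 := norm_sub_le a w
  have h2 := norm_sub_norm_le a w
  have h3 : 0 < ‖a - w‖ := by linarith
  rw [← Real.log_div h3.ne' ha0.ne']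
  set t := ‖a - w‖ / ‖a‖ with ht
  have h4 : 1 / 2 ≤ t := by rw [ht, le_div_iff₀ ha0]; linarith
  have h5 : t ≤ 2 := by rw [ht, div_le_iff₀ ha0]; linarith
  have h6 := Real.log_le_sub_one_of_pos (show 0 < t by linarith)
  have h7 := Real.one_sub_inv_le_log_of_pos (show 0 < t by linarith)
  have h8 : t⁻¹ ≤ 2 := by rw [inv_le_comm₀ (by linarith) two_pos]; linarith
  rw [abs_le]
  constructor <;> linarith

/-- If a function `P` has the same moments against the three points and against `ν / 2π`, then the
difference of the potentials is controlled by how well `-P` approximates the logarithm up to a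
constant. -/
theorem abs_potentialDiff_le {ν : Measure ℂ} [IsFiniteMeasure ν] {x : Fin 3 → ℂ} {z c : ℂ}
    {R e b : ℝ} {P : ℂ → ℝ} (hm : ν.real univ = 6 * Real.pi) (hs : ν (closedBall c R)ᶜ = 0)
    (hx : ∀ i, dist (x i) c ≤ R) (hlog : Integrable (fun ζ => Real.log ‖z - ζ‖) ν)
    (hP : Integrable P ν) (hmom : ∑ i, P (x i) = (2 * Real.pi)⁻¹ * ∫ ζ, P ζ ∂ν)
    (hE : ∀ ζ ∈ closedBall c R, |Real.log ‖z - ζ‖ - b + P ζ| ≤ e) :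
    |potentialDiff ν x z| ≤ 6 * e := by
  have hpi := Real.pi_pos
  have h1 : ∫ ζ, (Real.log ‖z - ζ‖ - b + P ζ) ∂ν =
      ∫ ζ, Real.log ‖z - ζ‖ ∂ν - b * (6 * Real.pi) + ∫ ζ, P ζ ∂ν := by
    rw [integral_add (f := fun ζ => Real.log ‖z - ζ‖ - b) (hlog.sub (integrable_const b)) hP, integral_sub hlog (integrable_const _),
      integral_const, hm, smul_eq_mul, mul_comm b]
  have h2 : potentialDiff ν x z = ∑ i, (Real.log ‖z - x i‖ - b + P (x i)) -
      (2 * Real.pi)⁻¹ * ∫ ζ, (Real.log ‖z - ζ‖ - b + P ζ) ∂ν := by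
    rw [h1, Finset.sum_add_distrib, Finset.sum_sub_distrib, hmom, potentialDiff]
    simp only [Finset.sum_const, Finset.card_univ, Fintype.card_fin, nsmul_eq_mul]
    field_simp
    push_cast
    ring
  have h3 : |∫ ζ, (Real.log ‖z - ζ‖ - b + P ζ) ∂ν| ≤ e * (6 * Real.pi) := by
    rw [← hm, ← Real.norm_eq_abs]
    apply norm_integral_le_of_norm_le_const
    have : ∀ᵐ ζ ∂ν, ζ ∈ closedBall c R := by
      rw [ae_iff]; exact hs
    filter_upwards [this] with ζ hζ using hE ζ hζ
  have h4 : |∑ i, (Real.log ‖z - x i‖ - b + P (x i))| ≤ 3 * e := by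
    refine (Finset.abs_sum_le_sum_abs _ _).trans ?_
    refine (Finset.sum_le_card_nsmul _ _ e fun i _ => hE (x i) (hx i)).trans ?_
    simp
  have h5 : |(2 * Real.pi)⁻¹ * ∫ ζ, (Real.log ‖z - ζ‖ - b + P ζ) ∂ν| ≤ 3 * e := by
    rw [abs_mul, abs_of_pos (by positivity)]
    calc (2 * Real.pi)⁻¹ * |∫ ζ, (Real.log ‖z - ζ‖ - b + P ζ) ∂ν|
        ≤ (2 * Real.pi)⁻¹ * (e * (6 * Real.pi)) := by gcongr
      _ = 3 * e := by field_simp; ring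
  rw [h2]
  refine (abs_sub _ _).trans ?_
  linarith

section PiecesPotential

variable {c : ℕ → ℂ} {ν : ℕ → Measure ℂ} {x : ℕ → Fin 3 → ℂ} {L A δ : ℝ}

theorem DoublingBounds.pieceBound_pos (B : DoublingBounds μ C q) (c : ℕ → ℂ) (k : ℕ) (z : ℂ) :
    0 < pieceBound μ c k z := by
  have h1 := B.decay_pos (c k) z
  rw [pieceBound]
  split_ifs <;> linarith

/-- Near its location, a triple cancels the potential of its piece up to `localLog` and a bounded
term. Far away the mass and the first two moments cancel, which leaves the cube of the ratio of
scale and distance. -/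
theorem DoublingBounds.exists_abs_potentialDiff_sub_le (B : DoublingBounds μ C q)
    (P : Pieces μ c ν x L A δ) :
    ∃ A' : ℝ, 0 < A' ∧ ∀ k z, (∀ i, z ≠ x k i) →
      |potentialDiff (ν k) (x k) z - localLog (rho μ (c k)) (x k) z| ≤
        A' * pieceBound μ c k z := by
  have hL := P.one_le
  have hpi := Real.pi_pos
  obtain ⟨A₁, hA₁, hpot⟩ := B.exists_lintegral_log_norm_le (2 * L) L
  have hlog3 : 0 ≤ Real.log (3 * L) := Real.log_nonneg (by linarith)
  set D := 3 * Real.log (3 * L) + (2 * Real.pi)⁻¹ * A₁ with hD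
  have hD0 : 0 < D := by positivity
  refine ⟨D * (1 + 2 * L) ^ 3 + 48 * L ^ 3 + 6, by positivity, fun k z hz => ?_⟩
  have hfin := P.isFiniteMeasure k
  set s := rho μ (c k) with hs
  have hs0 : 0 < s := B.rho_pos (c k)
  have hdec0 := B.decay_pos (c k) z
  have hint : Integrable (fun ζ => Real.log ‖z - ζ‖) (ν k) :=
    B.integrable_log_norm_sub (P.le k) (P.supp k) z
  have hif : (0:ℝ) ≤ if k = 0 then 1 else 0 := by split_ifs <;> norm_num
  have hb : decay μ (c k) z ≤ pieceBound μ c k z := by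
    rw [pieceBound]; linarith
  have hb0 : 0 < pieceBound μ c k z := hdec0.trans_le hb
  rcases le_or_gt (dist z (c k)) (2 * L * s) with hnear | hfar
  · have h1 : |∫ ζ, Real.log ‖z - ζ‖ ∂(ν k) - 6 * Real.pi * Real.log s| ≤ A₁ := by
      have h2 : ∫ ζ, Real.log ‖z - ζ‖ ∂(ν k) - 6 * Real.pi * Real.log s =
          ∫ ζ, (Real.log ‖z - ζ‖ - Real.log s) ∂(ν k) := by
        rw [integral_sub hint (integrable_const _), integral_const, P.real_mass, smul_eq_mul]
      rw [h2, ← Real.norm_eq_abs]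
      have h3 := (enorm_integral_le_lintegral_enorm _).trans
        (hpot (c k) z (ν k) hnear (P.le k) (P.supp k))
      rw [Real.enorm_eq_ofReal_abs] at h3
      exact (ENNReal.ofReal_le_ofReal_iff hA₁.le).1 h3
    have h2 : ∀ i, |Real.log ‖z - x k i‖ - Real.log s - Real.log (min 1 (‖z - x k i‖ / s))| ≤
        Real.log (3 * L) := by
      intro i
      have hn : 0 < ‖z - x k i‖ := norm_pos_iff.2 (sub_ne_zero.2 (hz i))
      rw [← Real.log_div hn.ne' hs0.ne']
      rcases le_total 1 (‖z - x k i‖ / s) with h | h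
      · rw [min_eq_left h, Real.log_one, sub_zero, abs_of_nonneg (Real.log_nonneg h)]
        apply Real.log_le_log (by positivity)
        rw [div_le_iff₀ hs0, ← dist_eq_norm]
        have := dist_triangle_right z (x k i) (c k)
        have := P.loc k i
        linarith
      · rw [min_eq_right h, sub_self, abs_zero]
        exact hlog3
    have h3 : potentialDiff (ν k) (x k) z - localLog s (x k) z =
        ∑ i, (Real.log ‖z - x k i‖ - Real.log s - Real.log (min 1 (‖z - x k i‖ / s))) -
        (2 * Real.pi)⁻¹ * (∫ ζ, Real.log ‖z - ζ‖ ∂(ν k) - 6 * Real.pi * Real.log s) := by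
      rw [potentialDiff, localLog, Finset.sum_sub_distrib, Finset.sum_sub_distrib]
      simp only [Finset.sum_const, Finset.card_univ, Fintype.card_fin, nsmul_eq_mul]
      field_simp
      push_cast
      ring
    have h4 : |potentialDiff (ν k) (x k) z - localLog s (x k) z| ≤ D := by
      rw [h3, hD]
      refine (abs_sub _ _).trans (add_le_add ?_ ?_)
      · refine (Finset.abs_sum_le_sum_abs _ _).trans ?_
        refine (Finset.sum_le_card_nsmul _ _ _ fun i _ => h2 i).trans ?_
        simp
      · rw [abs_mul, abs_of_pos (by positivity)]
        gcongr
    have h5 : 1 ≤ (1 + 2 * L) ^ 3 * decay μ (c k) z := by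
      rw [decay, ← mul_pow]
      apply one_le_pow₀
      rw [mul_div_assoc', one_le_div (by positivity)]
      linarith
    calc _ ≤ D := h4
      _ ≤ D * ((1 + 2 * L) ^ 3 * decay μ (c k) z) := le_mul_of_one_le_right hD0.le h5
      _ = D * (1 + 2 * L) ^ 3 * decay μ (c k) z := by ring
      _ ≤ (D * (1 + 2 * L) ^ 3 + 48 * L ^ 3 + 6) * pieceBound μ c k z := by
        gcongr
        have : 0 ≤ 48 * L ^ 3 := by positivity
        linarith
  · have hd0 : 0 < dist z (c k) := lt_trans (by positivity) hfar
    have hne : z - c k ≠ 0 := sub_ne_zero.2 (dist_pos.1 hd0)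
    have hsL : s ≤ L * s := le_mul_of_one_le_left hs0.le hL
    have hloc : localLog s (x k) z = 0 := by
      refine localLog_eq_zero hs0 fun i => ?_
      rw [← dist_eq_norm]
      have := dist_triangle z (x k i) (c k)
      have := P.loc k i
      linarith
    have hw : ∀ ζ ∈ closedBall (c k) (L * s), 2 * ‖ζ - c k‖ ≤ ‖z - c k‖ := by
      intro ζ hζ
      rw [← dist_eq_norm, ← dist_eq_norm]
      have : dist ζ (c k) ≤ L * s := hζ
      linarith
    rw [hloc, sub_zero]
    by_cases hk : k = 0
    · have h1 : |potentialDiff (ν k) (x k) z| ≤ 6 * 1 := by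
        apply abs_potentialDiff_le (P := fun _ => 0) (b := Real.log ‖z - c k‖) (P.real_mass k)
          (P.supp k) (P.loc k) hint (integrable_zero _ _ _) (by simp)
        intro ζ hζ
        rw [add_zero]
        have := abs_log_norm_sub_le_one hne (hw ζ hζ)
        rwa [sub_sub_sub_cancel_right] at this
      have h2 : 1 ≤ pieceBound μ c k z := by
        rw [pieceBound, if_pos hk]; linarith
      refine h1.trans (mul_le_mul ?_ h2 zero_le_one (by positivity))
      have : 0 ≤ D * (1 + 2 * L) ^ 3 + 48 * L ^ 3 := by positivity
      linarith
    · have hae : ∀ᵐ ζ ∂(ν k), ζ ∈ closedBall (c k) (L * s) := by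
        rw [ae_iff]; exact P.supp k
      have hi : ∀ n : ℕ, Integrable (fun ζ => (ζ - c k) ^ n) (ν k) := by
        intro n
        refine Integrable.of_bound (by fun_prop) ((L * s) ^ n) ?_
        filter_upwards [hae] with ζ hζ
        rw [norm_pow, ← dist_eq_norm]
        exact pow_le_pow_left₀ dist_nonneg hζ n
      have hi1 : Integrable (fun ζ => ζ - c k) (ν k) := by simpa using hi 1
      have hiP : Integrable (fun ζ => (ζ - c k) / (z - c k) + ((ζ - c k) / (z - c k)) ^ 2 / 2)
          (ν k) := by
        simp only [div_pow]
        exact (hi1.div_const _).add (((hi 2).div_const _).div_const _)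
      have h1 : |potentialDiff (ν k) (x k) z| ≤ 6 * (L * s / ‖z - c k‖) ^ 3 := by
        apply abs_potentialDiff_le (b := Real.log ‖z - c k‖)
          (P := fun ζ => ((ζ - c k) / (z - c k) + ((ζ - c k) / (z - c k)) ^ 2 / 2).re)
          (P.real_mass k) (P.supp k) (P.loc k) hint hiP.re
        · have h2 := integral_re hiP
          simp only [RCLike.re_eq_complex_re] at h2
          rw [h2, ← Complex.re_sum, ← Complex.re_ofReal_mul]
          congr 1
          simp only [div_pow]
          rw [integral_add (hi1.div_const _) (((hi 2).div_const _).div_const _),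
            integral_div, integral_div, integral_div, Finset.sum_add_distrib, ← Finset.sum_div,
            ← Finset.sum_div, ← Finset.sum_div, P.moment_one k hk, P.moment_two k hk]
          push_cast
          ring
        · intro ζ hζ
          have h2 := abs_log_norm_sub_le hne (hw ζ hζ)
          rw [sub_sub_sub_cancel_right] at h2
          refine h2.trans ?_
          have : ‖ζ - c k‖ ≤ L * s := by rw [← dist_eq_norm]; exact hζ
          gcongr
      have h2 : (L * s / ‖z - c k‖) ^ 3 ≤ 8 * L ^ 3 * decay μ (c k) z := by
        have h3 : L * s / ‖z - c k‖ ≤ (2 * L) * (s / (s + dist z (c k))) := by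
          rw [← dist_eq_norm, mul_div_assoc', div_le_div_iff₀ hd0 (by positivity)]
          have : L * s * (s + dist z (c k)) ≤ L * s * (2 * dist z (c k)) := by
            gcongr
            linarith
          linarith
        calc (L * s / ‖z - c k‖) ^ 3 ≤ ((2 * L) * (s / (s + dist z (c k)))) ^ 3 := by gcongr
          _ = 8 * L ^ 3 * decay μ (c k) z := by rw [decay]; ring
      calc |potentialDiff (ν k) (x k) z| ≤ 6 * (8 * L ^ 3 * decay μ (c k) z) := h1.trans (by gcongr)
        _ = 48 * L ^ 3 * decay μ (c k) z := by ring
        _ ≤ (D * (1 + 2 * L) ^ 3 + 48 * L ^ 3 + 6) * pieceBound μ c k z := by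
          gcongr
          have : 0 ≤ D * (1 + 2 * L) ^ 3 := by positivity
          linarith

end PiecesPotential

end Potentials

/-! ### The compensating potential and its distributional Laplacian -/

section Distribution
open Laplacian

theorem locallyIntegrable_of_forall_ball {v : ℂ → ℝ} (h : ∀ r : ℝ, IntegrableOn v (ball 0 r)) :
    LocallyIntegrable v := fun z =>
  ⟨ball 0 (‖z‖ + 1), isOpen_ball.mem_nhds (by simp), h _⟩

theorem integrable_mul_of_hasCompactSupport {v g : ℂ → ℝ} (hv : LocallyIntegrable v)
    (hg : Continuous g) (hgc : HasCompactSupport g) : Integrable (fun z => v z * g z) := by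
  simpa using hv.integrable_smul_right_of_hasCompactSupport hg hgc

theorem exists_subset_ball_of_hasCompactSupport {g : ℂ → ℝ} (hg : HasCompactSupport g) :
    ∃ r : ℝ, tsupport g ⊆ ball 0 r := by
  obtain ⟨r, hr⟩ := hg.isBounded.subset_ball (0:ℂ)
  exact ⟨r, hr⟩

/-- Bounded measurable functions on discs are integrable. -/
theorem integrableOn_ball_of_bound {v : ℂ → ℝ} (hv : Measurable v) {r A : ℝ}
    (h : ∀ z ∈ ball 0 r, |v z| ≤ A) : IntegrableOn v (ball 0 r) := by
  refine Measure.integrableOn_of_bounded (M := A) measure_ball_lt_top.ne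
    hv.aestronglyMeasurable ?_
  exact (ae_restrict_iff' measurableSet_ball).2 (Eventually.of_forall h)

theorem locallyIntegrable_sum_log (x : Fin 3 → ℂ) :
    LocallyIntegrable (fun z : ℂ => ∑ i, Real.log ‖z - x i‖) := by
  have := locallyIntegrable_finsetSum (μ := (volume : Measure ℂ)) Finset.univ
    (f := fun i (z : ℂ) => Real.log ‖z - x i‖)
    fun i _ => locallyIntegrable_log_norm_sub (x i)
  simpa using this

theorem integral_sum_log_mul_laplacian {f : ℂ → ℝ} (hf : ContDiff ℝ (⊤ : ℕ∞) f)
    (hfc : HasCompactSupport f) (x : Fin 3 → ℂ) :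
    ∫ z, (∑ i, Real.log ‖z - x i‖) * laplacian f z = 2 * Real.pi * ∑ i, f (x i) := by
  simp_rw [Finset.sum_mul]
  rw [integral_finsetSum _ fun i _ => integrable_mul_of_hasCompactSupport
    (locallyIntegrable_log_norm_sub (x i)) (contDiff_laplacian hf).continuous
    (hasCompactSupport_laplacian hfc), Finset.mul_sum]
  exact Finset.sum_congr rfl fun i _ => integral_log_norm_mul_laplacian hf hfc (x i)

variable {μ : Measure ℂ} [IsLocallyFiniteMeasure μ] {C q : ℝ}

theorem DoublingBounds.locallyIntegrable_potential (B : DoublingBounds μ C q) {c : ℂ} {M : ℝ}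
    {ν : Measure ℂ} [IsFiniteMeasure ν] (hν : ν ≤ μ)
    (hs : ν (closedBall c (M * rho μ c))ᶜ = 0) :
    LocallyIntegrable (fun z => ∫ ζ, Real.log ‖z - ζ‖ ∂ν) := by
  have h1 : StronglyMeasurable fun z => ∫ ζ, Real.log ‖z - ζ‖ ∂ν :=
    measurable_log_norm_sub.stronglyMeasurable.integral_prod_right
  refine locallyIntegrable_of_forall_ball fun r => ?_
  obtain ⟨A, hA, h⟩ := B.exists_lintegral_enorm_log_le hν hs r
  refine integrableOn_ball_of_bound h1.measurable (A := A) fun z hz => ?_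
  have h2 := (enorm_integral_le_lintegral_enorm _).trans (h z hz)
  rw [Real.enorm_eq_ofReal_abs] at h2
  exact (ENNReal.ofReal_le_ofReal_iff hA.le).1 h2

/-- The distributional Laplacian of the logarithmic potential of `ν` is `2π ν`. -/
theorem DoublingBounds.integral_potential_mul_laplacian (B : DoublingBounds μ C q) {c : ℂ} {M : ℝ}
    {ν : Measure ℂ} [IsFiniteMeasure ν] (hν : ν ≤ μ)
    (hs : ν (closedBall c (M * rho μ c))ᶜ = 0) {f : ℂ → ℝ} (hf : ContDiff ℝ (⊤ : ℕ∞) f)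
    (hfc : HasCompactSupport f) :
    ∫ z, (∫ ζ, Real.log ‖z - ζ‖ ∂ν) * laplacian f z = 2 * Real.pi * ∫ ζ, f ζ ∂ν := by
  have hΔ := (contDiff_laplacian hf).continuous
  have hΔc := hasCompactSupport_laplacian hfc
  obtain ⟨r, hr⟩ := exists_subset_ball_of_hasCompactSupport hΔc
  obtain ⟨A, hA, h⟩ := B.exists_lintegral_enorm_log_le hν hs r
  have hmeas : Measurable (Function.uncurry fun z ζ : ℂ => Real.log ‖z - ζ‖ * laplacian f z) :=
    measurable_log_norm_sub.mul (hΔ.measurable.comp measurable_fst)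
  have hint : Integrable (Function.uncurry fun z ζ : ℂ => Real.log ‖z - ζ‖ * laplacian f z)
      ((volume : Measure ℂ).prod ν) := by
    refine ⟨hmeas.aestronglyMeasurable, ?_⟩
    rw [hasFiniteIntegral_iff_enorm, lintegral_prod _ hmeas.enorm.aemeasurable]
    have h1 : ∀ z, ∫⁻ ζ, ‖Function.uncurry (fun z ζ : ℂ => Real.log ‖z - ζ‖ * laplacian f z)
        (z, ζ)‖ₑ ∂ν ≤ ENNReal.ofReal A * ‖laplacian f z‖ₑ := by
      intro z
      simp only [Function.uncurry_apply_pair, enorm_mul]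
      rw [lintegral_mul_const' _ _ enorm_ne_top]
      by_cases hz : z ∈ tsupport (laplacian f)
      · gcongr; exact h z (hr hz)
      · rw [image_eq_zero_of_notMem_tsupport hz]; simp
    refine (lintegral_mono h1).trans_lt ?_
    rw [lintegral_const_mul' _ _ ENNReal.ofReal_ne_top]
    exact ENNReal.mul_lt_top ENNReal.ofReal_lt_top (hΔ.integrable_of_hasCompactSupport hΔc).2
  have h1 := integral_integral_swap hint
  simp only [integral_mul_const] at h1
  rw [h1, ← integral_const_mul]
  exact integral_congr_ae (Eventually.of_forall fun ζ => integral_log_norm_mul_laplacian hf hfc ζ)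

theorem DoublingBounds.locallyIntegrable_potentialDiff (B : DoublingBounds μ C q) {c : ℂ} {M : ℝ}
    {ν : Measure ℂ} [IsFiniteMeasure ν] (hν : ν ≤ μ)
    (hs : ν (closedBall c (M * rho μ c))ᶜ = 0) (x : Fin 3 → ℂ) :
    LocallyIntegrable (potentialDiff ν x) :=
  (locallyIntegrable_sum_log x).sub
    (((B.locallyIntegrable_potential hν hs)).smul ((2 * Real.pi)⁻¹))

/-- The distributional Laplacian of `potentialDiff ν x` is `2π ∑ δ_{x i} - ν`. -/
theorem DoublingBounds.integral_potentialDiff_mul_laplacian (B : DoublingBounds μ C q) {c : ℂ}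
    {M : ℝ} {ν : Measure ℂ} [IsFiniteMeasure ν] (hν : ν ≤ μ)
    (hs : ν (closedBall c (M * rho μ c))ᶜ = 0) (x : Fin 3 → ℂ) {f : ℂ → ℝ}
    (hf : ContDiff ℝ (⊤ : ℕ∞) f) (hfc : HasCompactSupport f) :
    ∫ z, potentialDiff ν x z * laplacian f z =
      2 * Real.pi * ∑ i, f (x i) - ∫ ζ, f ζ ∂ν := by
  have hΔ := (contDiff_laplacian hf).continuous
  have hΔc := hasCompactSupport_laplacian hfc
  simp_rw [potentialDiff, sub_mul, mul_assoc]
  rw [integral_sub (integrable_mul_of_hasCompactSupport (locallyIntegrable_sum_log x) hΔ hΔc)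
    ((integrable_mul_of_hasCompactSupport (B.locallyIntegrable_potential hν hs) hΔ hΔc).const_mul _),
    integral_const_mul, B.integral_potential_mul_laplacian hν hs hf hfc,
    integral_sum_log_mul_laplacian hf hfc]
  have := Real.pi_pos
  field_simp

/-- The compensating potential of a family of pieces. -/
def potentialSum (ν : ℕ → Measure ℂ) (x : ℕ → Fin 3 → ℂ) (z : ℂ) : ℝ :=
  ∑' k, potentialDiff (ν k) (x k) z

variable {c : ℕ → ℂ} {ν : ℕ → Measure ℂ} {x : ℕ → Fin 3 → ℂ} {L A δ : ℝ}

/-- Only finitely many of the triples come close to a given disc. -/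
theorem DoublingBounds.exists_finset_far (B : DoublingBounds μ C q) (P : Pieces μ c ν x L A δ)
    (r : ℝ) : ∃ F : Finset ℕ, ∀ k ∉ F, ∀ z ∈ ball 0 r, ∀ i, rho μ (c k) ≤ ‖z - x k i‖ := by
  have hL := P.one_le
  obtain ⟨K, hK1, hK⟩ := B.exists_comparable (1 + L)
  obtain ⟨m, hm0, hm⟩ := (isCompact_closedBall (0:ℂ) r).exists_forall_le'
    B.continuous_rho.continuousOn (a := 0) fun z _ => B.rho_pos z
  set η : ℝ := 1 / (2 + L + |r| * K / m) with hη
  have hη0 : 0 < η := by positivity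
  have hfin : {k | ¬ decay μ (c k) 0 < η ^ 3}.Finite := by
    have := (P.decay 0).1.tendsto_cofinite_zero.eventually (gt_mem_nhds (show 0 < η ^ 3 by positivity))
    exact eventually_cofinite.1 this
  refine ⟨hfin.toFinset, fun k hk z hz i => ?_⟩
  rw [hfin.mem_toFinset, mem_ofPred_eq, not_not] at hk
  by_contra! hcon
  have hk0 := B.rho_pos (c k)
  have hzr : ‖z‖ < r := by simpa using hz
  have h1 : dist z (c k) ≤ (1 + L) * rho μ (c k) := by
    have h2 := dist_triangle z (x k i) (c k)
    have h3 := P.loc k i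
    rw [dist_eq_norm z] at h2
    rw [← dist_eq_norm] at h2 hcon
    linarith
  have h2 : m ≤ K * rho μ (c k) := by
    refine (hm z (ball_subset_closedBall hz)).trans (hK z (c k) (h1.trans ?_))
    gcongr
    exact le_max_right _ _
  have h3 : dist 0 (c k) ≤ |r| + (1 + L) * rho μ (c k) := by
    have := dist_triangle 0 z (c k)
    rw [dist_zero_left z] at this
    linarith [le_abs_self r]
  have h4 : |r| ≤ |r| * K / m * rho μ (c k) := by
    rw [div_mul_eq_mul_div, le_div_iff₀ hm0, mul_assoc]
    gcongr
  refine hk.not_ge ?_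
  rw [decay]
  apply pow_le_pow_left₀ hη0.le
  have hd : 0 ≤ dist 0 (c k) := dist_nonneg
  rw [hη, div_le_div_iff₀ (by positivity) (by positivity)]
  linarith

/-- On every disc, all but finitely many of the terms of the compensating potential are bounded by
`pieceBound`, with a factor that does not depend on the disc. -/
theorem DoublingBounds.exists_tail_le (B : DoublingBounds μ C q) (P : Pieces μ c ν x L A δ) :
    ∃ A' : ℝ, 0 < A' ∧ ∀ r : ℝ, ∃ F : Finset ℕ,
      (∀ k ∉ F, ∀ z ∈ ball 0 r, ∀ i, rho μ (c k) ≤ ‖z - x k i‖) ∧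
      ∀ k ∉ F, ∀ z ∈ ball 0 r, |potentialDiff (ν k) (x k) z| ≤ A' * pieceBound μ c k z := by
  obtain ⟨A', hA', h⟩ := B.exists_abs_potentialDiff_sub_le P
  refine ⟨A', hA', fun r => ?_⟩
  obtain ⟨F, hF⟩ := B.exists_finset_far P r
  refine ⟨F, hF, fun k hk z hz => ?_⟩
  have h1 := h k z fun i hi => by
    have := hF k hk z hz i
    rw [hi, sub_self, norm_zero] at this
    exact this.not_gt (B.rho_pos _)
  rwa [localLog_eq_zero (B.rho_pos _) (hF k hk z hz), sub_zero] at h1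

theorem DoublingBounds.summable_potentialDiff (B : DoublingBounds μ C q)
    (P : Pieces μ c ν x L A δ) (z : ℂ) : Summable fun k => potentialDiff (ν k) (x k) z := by
  obtain ⟨A', -, h⟩ := B.exists_tail_le P
  obtain ⟨F, -, hF⟩ := h (‖z‖ + 1)
  refine Summable.of_norm_bounded_eventually ((P.summable_pieceBound z).1.mul_left A') ?_
  refine eventually_cofinite.2 (F.finite_toSet.subset fun k hk => ?_)
  by_contra hkF
  exact hk (hF k hkF z (by simp))

theorem DoublingBounds.measurable_potentialSum (B : DoublingBounds μ C q)
    (P : Pieces μ c ν x L A δ) : Measurable (potentialSum ν x) := by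
  have hfin := P.isFiniteMeasure
  refine measurable_of_tendsto_metrizable
    (f := fun n z => ∑ k ∈ Finset.range n, potentialDiff (ν k) (x k) z)
    (fun n => Finset.measurable_fun_sum _ fun k _ => measurable_potentialDiff (ν k) (x k)) ?_
  exact tendsto_pi_nhds.2 fun z => (B.summable_potentialDiff P z).hasSum.tendsto_sum_nat

theorem DoublingBounds.locallyIntegrable_potentialSum (B : DoublingBounds μ C q)
    (P : Pieces μ c ν x L A δ) : LocallyIntegrable (potentialSum ν x) := by
  have hfin := P.isFiniteMeasure
  obtain ⟨A', hA', h⟩ := B.exists_tail_le P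
  refine locallyIntegrable_of_forall_ball fun r => ?_
  obtain ⟨F, -, hF⟩ := h r
  set S : ℂ → ℝ := fun z => ∑ k ∈ F, potentialDiff (ν k) (x k) z with hS
  have hSm : Measurable S :=
    Finset.measurable_fun_sum _ fun k _ => measurable_potentialDiff (ν k) (x k)
  have hSi : IntegrableOn S (ball 0 r) := by
    have h1 : LocallyIntegrable S := by
      have := locallyIntegrable_finsetSum (μ := (volume : Measure ℂ)) F
        (f := fun k => potentialDiff (ν k) (x k))
        fun k _ => B.locallyIntegrable_potentialDiff (P.le k) (P.supp k) (x k)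
      simpa [hS] using this
    exact (h1.integrableOn_isCompact (isCompact_closedBall 0 r)).mono_set ball_subset_closedBall
  have hb : ∀ z ∈ ball 0 r, |(potentialSum ν x - S) z| ≤ A' * (A + 1) := by
    intro z hz
    have h1 := (B.summable_potentialDiff P z).sum_add_tsum_compl (s := F)
    have hb := (P.summable_pieceBound z).1.mul_left A'
    rw [Pi.sub_apply, potentialSum, ← h1, hS, add_sub_cancel_left, ← Real.norm_eq_abs]
    have hb' : Summable fun k : ((F : Set ℕ)ᶜ : Set ℕ) => A' * pieceBound μ c k z := hb.subtype _
    calc ‖∑' k : ((F : Set ℕ)ᶜ : Set ℕ), potentialDiff (ν k) (x k) z‖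
        ≤ ∑' k : ((F : Set ℕ)ᶜ : Set ℕ), A' * pieceBound μ c k z :=
          tsum_of_norm_bounded hb'.hasSum fun k => hF k k.2 z hz
      _ ≤ ∑' k, A' * pieceBound μ c k z := by
          refine hb.tsum_subtype_le (fun k => A' * pieceBound μ c k z) _ (fun k => ?_)
          have := B.pieceBound_pos c k z
          positivity
      _ ≤ A' * (A + 1) := by
          rw [tsum_mul_left]
          gcongr
          exact (P.summable_pieceBound z).2
  have h1 := (integrableOn_ball_of_bound ((B.measurable_potentialSum P).sub hSm) hb).add hSi
  simpa using h1

/-- The series of compensated potentials may be integrated term by term against test functions. -/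
theorem DoublingBounds.hasSum_integral_potentialDiff (B : DoublingBounds μ C q)
    (P : Pieces μ c ν x L A δ) {g : ℂ → ℝ} (hg : Continuous g) (hgc : HasCompactSupport g) :
    HasSum (fun k => ∫ z, potentialDiff (ν k) (x k) z * g z)
      (∫ z, potentialSum ν x z * g z) := by
  have hfin := P.isFiniteMeasure
  obtain ⟨A', hA', h⟩ := B.exists_tail_le P
  obtain ⟨r, hr⟩ := exists_subset_ball_of_hasCompactSupport hgc
  obtain ⟨F, -, hF⟩ := h r
  have hgi := hg.integrable_of_hasCompactSupport hgc (μ := (volume : Measure ℂ))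
  have hi : ∀ k, Integrable fun z => potentialDiff (ν k) (x k) z * g z := fun k =>
    integrable_mul_of_hasCompactSupport
      (B.locallyIntegrable_potentialDiff (P.le k) (P.supp k) (x k)) hg hgc
  have hbc : ∀ k, Continuous (pieceBound μ c k) := fun k =>
    (B.continuous_decay_right (c k)).add continuous_const
  have hbi : ∀ k, Integrable fun z => pieceBound μ c k z * |g z| := fun k =>
    ((hbc k).mul hg.abs).integrable_of_hasCompactSupport
      (hgc.comp_left (g := fun t : ℝ => |t|) abs_zero).mul_left
  have hsum : Summable fun k => ∫ z, pieceBound μ c k z * |g z| := by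
    refine summable_of_sum_le (c := ∫ z, (A + 1) * |g z|)
      (fun k => integral_nonneg fun z => ?_) fun S => ?_
    · have := B.pieceBound_pos c k z
      positivity
    · rw [← integral_finsetSum _ fun k _ => hbi k]
      refine integral_mono (integrable_finsetSum _ fun k _ => hbi k) (hgi.abs.const_mul _)
        fun z => ?_
      simp only
      rw [← Finset.sum_mul]
      gcongr
      exact ((P.summable_pieceBound z).1.sum_le_tsum S
        fun k _ => (B.pieceBound_pos c k z).le).trans (P.summable_pieceBound z).2
  have h1 := hasSum_integral_of_summable_integral_norm hi (by
    refine Summable.of_norm_bounded_eventually (hsum.mul_left A') ?_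
    refine eventually_cofinite.2 (F.finite_toSet.subset fun k hk => ?_)
    by_contra hkF
    apply hk
    rw [Real.norm_of_nonneg (integral_nonneg fun z => norm_nonneg _), ← integral_const_mul]
    refine integral_mono (hi k).norm ((hbi k).const_mul _) fun z => ?_
    simp only [norm_mul, Real.norm_eq_abs]
    rw [← mul_assoc]
    by_cases hz : z ∈ tsupport g
    · gcongr
      exact hF k hkF z (hr hz)
    · rw [image_eq_zero_of_notMem_tsupport hz]; simp)
  simp only [tsum_mul_right] at h1
  exact h1

end Distribution

/-! ### Holomorphic functions with prescribed modulus -/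

section Gluing
open Laplacian

variable {μ : Measure ℂ} [IsLocallyFiniteMeasure μ] {C q : ℝ}
variable {c : ℕ → ℂ} {ν : ℕ → Measure ℂ} {x : ℕ → Fin 3 → ℂ} {L A δ : ℝ}

theorem ae_ne_points (x : ℕ → Fin 3 → ℂ) : ∀ᵐ z : ℂ, ∀ k i, z ≠ x k i := by
  rw [ae_all_iff]
  intro k
  rw [ae_all_iff]
  intro i
  rw [ae_iff]
  simp

/-- In every disc, `φ + potentialSum ν x` is almost everywhere the logarithm of the modulus of a
holomorphic function with zeros exactly at the points `x k i`. -/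
theorem DoublingBounds.exists_differentiableOn_ball (B : DoublingBounds μ C q)
    (P : Pieces μ c ν x L A δ) {φ : ℂ → EReal} (hφ : HasDistribLaplacian φ μ) (r : ℝ) :
    ∃ G : ℂ → ℂ, DifferentiableOn ℂ G (ball 0 r) ∧
      (∀ᵐ z, z ∈ ball (0:ℂ) r → ‖G z‖ = Real.exp ((φ z).toReal + potentialSum ν x z)) ∧
      ∀ z, z ∈ ball (0:ℂ) r → (G z = 0 ↔ ∃ k i, z = x k i) := by
  have hfin := P.isFiniteMeasure
  obtain ⟨F, hF⟩ := B.exists_finset_far P (r + 1)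
  have hout : ∀ k ∉ F, ∀ i, x k i ∉ ball (0:ℂ) (r + 1) := by
    intro k hk i hi
    have := hF k hk _ hi i
    rw [sub_self, norm_zero] at this
    exact this.not_gt (B.rho_pos _)
  set T : ℂ → ℝ := fun z => ∑ k ∈ F, ∑ i, Real.log ‖z - x k i‖ with hT
  have hTl : LocallyIntegrable T := by
    have := locallyIntegrable_finsetSum (μ := (volume : Measure ℂ)) F
      (f := fun k z => ∑ i, Real.log ‖z - x k i‖) fun k _ => locallyIntegrable_sum_log (x k)
    simpa [hT] using this
  have hU := B.locallyIntegrable_potentialSum P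
  have hv : LocallyIntegrable fun z => (φ z).toReal + potentialSum ν x z - T z :=
    (hφ.locallyIntegrable.add hU).sub hTl
  obtain ⟨H, hH, hHe⟩ := weyl hv (r := r + 1) (by
    intro f hf hfc hfr
    have hΔ := (contDiff_laplacian hf).continuous
    have hΔc := hasCompactSupport_laplacian hfc
    have hfi : Integrable f (Measure.sum ν) := by
      rw [P.sum_eq]; exact hf.continuous.integrable_of_hasCompactSupport hfc
    have h1 := hasSum_integral_measure hfi
    rw [P.sum_eq, ← hφ.integral_laplacian f hf hfc] at h1
    have h2 := B.hasSum_integral_potentialDiff P hΔ hΔc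
    simp only [B.integral_potentialDiff_mul_laplacian (P.le _) (P.supp _) (x _) hf hfc] at h2
    have h3 := h1.add h2
    simp only [add_sub_cancel] at h3
    have h4 := hasSum_sum_of_ne_finset_zero (L := .unconditional ℕ) (s := F) (f := fun k => 2 * Real.pi * ∑ i, f (x k i))
      fun k hk => by
        rw [Finset.sum_eq_zero, mul_zero]
        intro i _
        exact image_eq_zero_of_notMem_tsupport fun hi => hout k hk i (hfr hi)
    have h5 := h3.unique h4
    have i1 := integrable_mul_of_hasCompactSupport hφ.locallyIntegrable hΔ hΔc
    have i2 := integrable_mul_of_hasCompactSupport hU hΔ hΔc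
    have i3 := integrable_mul_of_hasCompactSupport hTl hΔ hΔc
    have h6 : ∫ z, T z * laplacian f z = ∑ k ∈ F, 2 * Real.pi * ∑ i, f (x k i) := by
      simp only [hT, Finset.sum_mul F]
      rw [integral_finsetSum _ fun k _ =>
        integrable_mul_of_hasCompactSupport (locallyIntegrable_sum_log (x k)) hΔ hΔc]
      exact Finset.sum_congr rfl fun k _ => integral_sum_log_mul_laplacian hf hfc (x k)
    simp_rw [sub_mul, add_mul]
    have i12 : Integrable fun z => (φ z).toReal * laplacian f z +
        potentialSum ν x z * laplacian f z := i1.add i2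
    rw [integral_sub i12 i3, integral_add i1 i2, h6, h5, sub_self])
  rw [add_sub_cancel_right] at hH hHe
  refine ⟨fun z => Complex.exp (H z) * ∏ k ∈ F, ∏ i, (z - x k i), ?_, ?_, fun z hz => ?_⟩
  · exact hH.cexp.mul (by fun_prop)
  · filter_upwards [hHe, ae_ne_points x] with z hz hzx hzr
    have h1 : T z = Real.log (∏ k ∈ F, ∏ i, ‖z - x k i‖) := by
      rw [Real.log_prod fun k _ => Finset.prod_ne_zero_iff.2 fun i _ =>
        norm_ne_zero_iff.2 (sub_ne_zero.2 (hzx k i))]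
      refine Finset.sum_congr rfl fun k _ => ?_
      rw [Real.log_prod fun i _ => norm_ne_zero_iff.2 (sub_ne_zero.2 (hzx k i))]
    have h2 : 0 < ∏ k ∈ F, ∏ i, ‖z - x k i‖ :=
      Finset.prod_pos fun k _ => Finset.prod_pos fun i _ =>
        norm_pos_iff.2 (sub_ne_zero.2 (hzx k i))
    rw [norm_mul, Complex.norm_exp, ← hz hzr, norm_prod]
    simp_rw [norm_prod]
    rw [← Real.exp_log h2, ← Real.exp_add, ← h1, sub_add_cancel]
  · simp only [mul_eq_zero, Complex.exp_ne_zero, false_or, Finset.prod_eq_zero_iff, sub_eq_zero,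
      Finset.mem_univ, true_and]
    constructor
    · rintro ⟨k, -, i, h⟩
      exact ⟨k, i, h⟩
    · rintro ⟨k, i, h⟩
      refine ⟨k, ?_, i, h⟩
      by_contra hk
      exact hout k hk i (h ▸ ball_subset_ball (by linarith) hz)

/-- Holomorphic functions on a connected open set with the same modulus and a common nonzero value
agree: their quotient has modulus one and is therefore locally constant. -/
theorem eqOn_of_norm_eq {f g : ℂ → ℂ} {U : Set ℂ} (hU : IsOpen U) (hUc : IsPreconnected U)
    (hf : DifferentiableOn ℂ f U) (hg : DifferentiableOn ℂ g U) (h : ∀ z ∈ U, ‖f z‖ = ‖g z‖)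
    {b : ℂ} (hb : b ∈ U) (hfg : f b = g b) (hb0 : g b ≠ 0) : EqOn f g U := by
  refine (hf.analyticOnNhd hU).eqOn_of_preconnected_of_eventuallyEq (hg.analyticOnNhd hU) hUc hb ?_
  have hgc : ContinuousAt g b := (hg.continuousOn.continuousAt (hU.mem_nhds hb))
  have hne : ∀ᶠ z in 𝓝 b, z ∈ U ∧ g z ≠ 0 := 
    (hU.eventually_mem hb).and (hgc.eventually_ne hb0)
  have h1 : ∀ᶠ z in 𝓝 b, DifferentiableAt ℂ (fun w => f w / g w) z := by
    filter_upwards [hne] with z hz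
    exact (hf.differentiableAt (hU.mem_nhds hz.1)).div (hg.differentiableAt (hU.mem_nhds hz.1)) hz.2
  have h2 : ∀ z ∈ U, g z ≠ 0 → ‖f z / g z‖ = 1 := by
    intro z hz hz0
    rw [norm_div, h z hz, div_self (norm_ne_zero_iff.2 hz0)]
  have h3 : IsLocalMax (norm ∘ fun w => f w / g w) b := by
    filter_upwards [hne] with z hz
    simp only [Function.comp_apply]
    rw [h2 z hz.1 hz.2, h2 b hb hb0]
  filter_upwards [Complex.eventually_eq_of_isLocalMax_norm h1 h3, hne] with z hz hz'
  rw [hfg, div_self hb0, div_eq_one_iff_eq hz'.2] at hz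
  exact hz

/-- Holomorphic functions on the discs `ball 0 n` whose moduli are given almost everywhere by one
positive function are, up to unimodular factors, the restrictions of
one entire function. -/
theorem exists_differentiable_of_norm_ae_eq {w : ℂ → ℝ} {G : ℕ → ℂ → ℂ} (hw : ∀ z, 0 < w z)
    (hG : ∀ n : ℕ, DifferentiableOn ℂ (G n) (ball 0 n))
    (hGw : ∀ n : ℕ, ∀ᵐ z, z ∈ ball (0:ℂ) n → ‖G n z‖ = w z) :
    ∃ g : ℂ → ℂ, Differentiable ℂ g ∧ ∀ n : ℕ, ∀ z ∈ ball (0:ℂ) n, ‖g z‖ = ‖G n z‖ := by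
  have hnorm : ∀ m n : ℕ, m ≤ n → ∀ z ∈ ball (0:ℂ) m, ‖G n z‖ = ‖G m z‖ := by
    intro m n hmn
    have hsub : ball (0:ℂ) m ⊆ ball 0 n := ball_subset_ball (by exact_mod_cast hmn)
    refine Measure.eqOn_open_of_ae_eq (μ := (volume : Measure ℂ)) ?_ isOpen_ball
      ((hG n).mono hsub).continuousOn.norm (hG m).continuousOn.norm
    refine (ae_restrict_iff' measurableSet_ball).2 ?_
    filter_upwards [hGw m, hGw n] with z h1 h2 hz
    rw [h1 hz, h2 (hsub hz)]
  obtain ⟨b, hb1, hb⟩ : ∃ b ∈ ball (0:ℂ) (1:ℕ), G 1 b ≠ 0 := by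
    by_contra! hcon
    have h1 : volume (ball (0:ℂ) (1:ℕ)) = 0 := by
      refine measure_mono_null (fun z hz => ?_) (ae_iff.1 (hGw 1))
      rw [mem_ofPred_eq, not_forall]
      refine ⟨hz, ?_⟩
      rw [hcon z hz, norm_zero]
      exact (hw z).ne
    exact (isOpen_ball.measure_pos volume ⟨0, by simp⟩).ne' h1
  have hbn : ∀ n : ℕ, 1 ≤ n → b ∈ ball (0:ℂ) n := fun n hn =>
    ball_subset_ball (by exact_mod_cast hn) hb1
  have hGb : ∀ n : ℕ, 1 ≤ n → G n b ≠ 0 := fun n hn => by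
    rw [← norm_ne_zero_iff, hnorm 1 n hn b hb1]
    exact norm_ne_zero_iff.2 hb
  -- the rotation that makes the value at `b` positive
  set h : ℕ → ℂ → ℂ := fun n z => (‖G n b‖ / G n b) * G n z with hh
  have hhd : ∀ n : ℕ, DifferentiableOn ℂ (h n) (ball 0 n) := fun n => (hG n).const_mul _
  have hhn : ∀ n : ℕ, 1 ≤ n → ∀ z, ‖h n z‖ = ‖G n z‖ := by
    intro n hn z
    have := norm_ne_zero_iff.2 (hGb n hn)
    rw [hh]
    simp only [norm_mul, norm_div, Complex.norm_real, norm_norm]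
    rw [div_self this, one_mul]
  have hhb : ∀ n : ℕ, 1 ≤ n → h n b = ‖G 1 b‖ := by
    intro n hn
    rw [hh]
    simp only
    rw [div_mul_cancel₀ _ (hGb n hn), hnorm 1 n hn b hb1]
  have hheq : ∀ m n : ℕ, 1 ≤ m → m ≤ n → EqOn (h n) (h m) (ball 0 m) := by
    intro m n hm hmn
    have hn := hm.trans hmn
    refine eqOn_of_norm_eq isOpen_ball (convex_ball _ _).isPreconnected
      ((hhd n).mono (ball_subset_ball (by exact_mod_cast hmn))) (hhd m) (fun z hz => ?_)
      (hbn m hm) ?_ ?_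
    · rw [hhn n hn, hhn m hm, hnorm m n hmn z hz]
    · rw [hhb n hn, hhb m hm]
    · rw [hhb m hm]
      exact_mod_cast norm_ne_zero_iff.2 hb
  set g : ℂ → ℂ := fun z => h (⌊‖z‖⌋₊ + 1) z with hg
  have hgn : ∀ n : ℕ, EqOn g (h n) (ball 0 n) := by
    intro n z hz
    have hz' : ‖z‖ < n := by simpa using hz
    have h1 : ⌊‖z‖⌋₊ + 1 ≤ n := (Nat.floor_lt (norm_nonneg z)).2 hz'
    rw [hg]
    refine (hheq _ n (by omega) h1 ?_).symm
    rw [mem_ball_zero_iff]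
    push_cast
    exact Nat.lt_floor_add_one _
  refine ⟨g, fun z => ?_, fun n z hz => ?_⟩
  · have hz : z ∈ ball (0:ℂ) (⌊‖z‖⌋₊ + 1 : ℕ) := by
      rw [mem_ball_zero_iff]
      push_cast
      exact Nat.lt_floor_add_one _
    have h1 := (hhd _).differentiableAt (isOpen_ball.mem_nhds hz)
    exact h1.congr_of_eventuallyEq ((hgn _).eventuallyEq_of_mem (isOpen_ball.mem_nhds hz))
  · have hn : 1 ≤ n := by
      have : ‖z‖ < n := by simpa using hz
      have : (0:ℝ) < n := (norm_nonneg z).trans_lt this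
      exact_mod_cast this
    rw [hgn n hz, hhn n hn]

/-- `φ + potentialSum ν x` is almost everywhere the logarithm of the modulus of an entire function
with zeros exactly at the points `x k i`. -/
theorem DoublingBounds.exists_entire (B : DoublingBounds μ C q) (P : Pieces μ c ν x L A δ)
    {φ : ℂ → EReal} (hφ : HasDistribLaplacian φ μ) :
    ∃ g : ℂ → ℂ, Differentiable ℂ g ∧
      (∀ᵐ z, ‖g z‖ = Real.exp ((φ z).toReal + potentialSum ν x z)) ∧
      ∀ z, g z = 0 ↔ ∃ k i, z = x k i := by
  choose G hG hGw hG0 using fun n : ℕ => B.exists_differentiableOn_ball P hφ n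
  obtain ⟨g, hg, hgn⟩ := exists_differentiable_of_norm_ae_eq (fun z => Real.exp_pos _) hG hGw
  have hmem : ∀ z : ℂ, z ∈ ball (0:ℂ) (⌊‖z‖⌋₊ + 1 : ℕ) := fun z => by
    rw [mem_ball_zero_iff]
    push_cast
    exact Nat.lt_floor_add_one _
  refine ⟨g, hg, ?_, fun z => ?_⟩
  · have h1 := ae_all_iff.2 hGw
    filter_upwards [h1] with z hz
    rw [hgn _ z (hmem z), hz _ (hmem z)]
  · rw [← hG0 _ z (hmem z), ← norm_eq_zero, hgn _ z (hmem z), norm_eq_zero]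

end Gluing

/-! ### From almost everywhere to everywhere -/

section Everywhere

/-- A property that holds almost everywhere in the plane holds almost everywhere on almost every
circle with a given centre. -/
theorem ae_ae_circleMap {p : ℂ → Prop} (h : ∀ᵐ w, p w) (z : ℂ) :
    ∀ᵐ r : ℝ, 0 < r → ∀ᵐ θ ∂(volume.restrict (Ioc 0 (2 * Real.pi))), p (circleMap z r θ) := by
  have hpi := Real.pi_pos
  have h' : ∀ᵐ u, p (z - u) :=
    (volume.measurePreserving_sub_left z).quasiMeasurePreserving.ae h
  obtain ⟨s, hs, hsm, hs0⟩ := exists_measurable_superset_of_null (ae_iff.1 h')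
  have h1 : ∫⁻ q in polarCoord.target, ENNReal.ofReal q.1 •
      s.indicator (fun _ => (1 : ℝ≥0∞)) (Complex.polarCoord.symm q) = 0 := by
    rw [Complex.lintegral_comp_polarCoord_symm, lintegral_indicator hsm, setLIntegral_one, hs0]
  have hcont : Continuous fun q : ℝ × ℝ => Complex.polarCoord.symm q := by
    simp only [Complex.polarCoord_symm_apply]
    fun_prop
  have hmeas : Measurable fun q : ℝ × ℝ => ENNReal.ofReal q.1 •
      s.indicator (fun _ => (1 : ℝ≥0∞)) (Complex.polarCoord.symm q) :=
    (ENNReal.measurable_ofReal.comp measurable_fst).mul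
      ((measurable_const.indicator hsm).comp hcont.measurable)
  rw [lintegral_eq_zero_iff hmeas, polarCoord_target, Measure.volume_eq_prod,
    ← Measure.prod_restrict] at h1
  have h2 := (ae_restrict_iff' measurableSet_Ioi).1 (Measure.ae_ae_of_ae_prod h1)
  filter_upwards [h2] with r hr hr0
  have h3 := (ae_restrict_iff' measurableSet_Ioo).1 (hr hr0)
  have h4 := (measurePreserving_sub_right volume Real.pi).quasiMeasurePreserving.ae h3
  refine (ae_restrict_iff' measurableSet_Ioc).2 ?_
  have h5 : ∀ᵐ θ : ℝ, θ ≠ 2 * Real.pi := by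
    rw [ae_iff]; simp
  filter_upwards [h4, h5] with θ hθ hθ2 hmem
  have h6 := hθ ⟨by linarith [hmem.1], by
    have := lt_of_le_of_ne hmem.2 hθ2
    linarith⟩
  have h7 : Complex.polarCoord.symm (r, θ - Real.pi) ∉ s := by
    intro hin
    simp only [indicator_of_mem hin, smul_eq_mul, mul_one, Pi.zero_apply, ENNReal.ofReal_eq_zero]
      at h6
    exact h6.not_gt hr0
  have h8 : p (z - Complex.polarCoord.symm (r, θ - Real.pi)) := by
    by_contra hp
    exact h7 (hs hp)
  convert h8 using 1
  rw [Complex.polarCoord_symm_apply, circleMap, Real.cos_sub_pi, Real.sin_sub_pi, Complex.exp_mul_I]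
  push_cast
  ring

/-- The circle mean of a function that is almost everywhere at most `y` is at most `y`. -/
theorem circleMean_le {φ : ℂ → EReal} {z : ℂ} {r y : ℝ}
    (h : ∀ᵐ θ ∂(volume.restrict (Ioc 0 (2 * Real.pi))), φ (circleMap z r θ) ≤ y) :
    circleMean φ z r ≤ y := by
  have hne : NeZero (volume.restrict (Ioc 0 (2 * Real.pi)) : Measure ℝ) := by
    refine ⟨fun h0 => ?_⟩
    rw [Measure.restrict_eq_zero, Real.volume_Ioc, ENNReal.ofReal_eq_zero] at h0
    linarith [Real.pi_pos]
  have h1 : ⨍⁻ θ in Ioc 0 (2 * Real.pi), (φ (circleMap z r θ)).toENNReal ∂volume ≤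
      (y : EReal).toENNReal := by
    rw [← laverage_const (volume.restrict (Ioc 0 (2 * Real.pi))) (y : EReal).toENNReal]
    exact lintegral_mono_ae (Measure.ae_smul_measure (h.mono fun θ hθ =>
      EReal.toENNReal_le_toENNReal hθ) _)
  have h2 : (-(y : EReal)).toENNReal ≤
      ⨍⁻ θ in Ioc 0 (2 * Real.pi), (-φ (circleMap z r θ)).toENNReal ∂volume := by
    rw [← laverage_const (volume.restrict (Ioc 0 (2 * Real.pi))) (-(y : EReal)).toENNReal]
    exact lintegral_mono_ae (Measure.ae_smul_measure (h.mono fun θ hθ =>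
      EReal.toENNReal_le_toENNReal (EReal.neg_le_neg_iff.2 hθ)) _)
  refine (EReal.sub_le_sub (EReal.coe_ennreal_le_coe_ennreal_iff.2 h1)
    (EReal.coe_ennreal_le_coe_ennreal_iff.2 h2)).trans (le_of_eq ?_)
  rw [EReal.coe_toENNReal_eq_max, EReal.coe_toENNReal_eq_max]
  rcases le_total 0 y with hy | hy
  · rw [max_eq_right (by exact_mod_cast hy), max_eq_left (by
      rw [← EReal.coe_neg]; exact_mod_cast (by linarith : -y ≤ 0)), sub_zero]
  · rw [max_eq_left (by exact_mod_cast hy), max_eq_right (by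
      rw [← EReal.coe_neg]; exact_mod_cast (by linarith : 0 ≤ -y)), zero_sub, neg_neg]

/-- The sub-mean value inequality turns an upper bound almost everywhere into one at every point of
continuity of the bound. -/
theorem IsSubharmonic.le_of_ae_le {φ : ℂ → EReal} (hφ : IsSubharmonic φ) {s : ℂ → ℝ} {z : ℂ}
    (hs : ContinuousAt s z) (h : ∀ᵐ w, φ w ≤ s w) : φ z ≤ s z := by
  refine EReal.le_of_forall_lt_iff_le.1 fun y hy => ?_
  have hy' : s z < y := by exact_mod_cast hy
  obtain ⟨ε, hε, hb⟩ := Metric.eventually_nhds_iff.1 (hs.eventually (gt_mem_nhds hy'))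
  have h1 := ae_ae_circleMap h z
  obtain ⟨r, hr, hrε⟩ := (Measure.dense_of_ae h1).exists_mem_open (isOpen_Ioo (a := 0) (b := ε))
    (nonempty_Ioo.2 hε)
  refine (hφ.le_circleMean z r hrε.1).trans (circleMean_le ?_)
  filter_upwards [hr hrε.1] with θ hθ
  refine le_trans hθ ?_
  have : s (circleMap z r θ) < y := hb (by
    rw [dist_eq_norm, circleMap_sub_center, norm_circleMap_zero, abs_of_pos hrε.1]
    exact hrε.2)
  exact_mod_cast this.le

/-- An inequality for all real numbers above `a` passes to the limit, with value `0` of the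
exponential at `a = ⊥`. -/
theorem ennreal_le_exp_mul {a : EReal} (ha : a ≠ ⊤) {t d : ℝ}
    (h : ∀ y : ℝ, a < y → t ≤ Real.exp y * d) :
    ENNReal.ofReal t ≤ EReal.exp a * ENNReal.ofReal d := by
  induction a with
  | top => exact absurd rfl ha
  | bot =>
    have h1 : Tendsto (fun y : ℝ => Real.exp y * d) atBot (𝓝 (0 * d)) :=
      Real.tendsto_exp_atBot.mul_const d
    have h2 : t ≤ 0 * d := ge_of_tendsto h1 (Eventually.of_forall fun y => h y (EReal.bot_lt_coe y))
    rw [zero_mul] at h2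
    rw [ENNReal.ofReal_eq_zero.2 h2]
    exact zero_le
  | coe s =>
    have h1 : Tendsto (fun y : ℝ => Real.exp y * d) (𝓝[>] s) (𝓝 (Real.exp s * d)) :=
      ((Real.continuous_exp.tendsto s).mul_const d).mono_left nhdsWithin_le_nhds
    have h2 : t ≤ Real.exp s * d := ge_of_tendsto h1
      (eventually_mem_nhdsWithin.mono fun y hy => h y (by exact_mod_cast hy))
    rw [EReal.exp_coe, ← ENNReal.ofReal_mul (Real.exp_pos s).le]
    exact ENNReal.ofReal_le_ofReal h2

/-- Upper semicontinuity turns an upper bound by `exp φ` almost everywhere into one everywhere. -/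
theorem IsSubharmonic.norm_le_of_ae_le {φ : ℂ → EReal} (hφ : IsSubharmonic φ)
    (hfin : ∀ᵐ z, φ z ≠ ⊤ ∧ φ z ≠ ⊥) {g : ℂ → ℂ} (hg : Continuous g) {d : ℂ → ℝ}
    (hd : Continuous d) (hd0 : ∀ z, 0 ≤ d z)
    (h : ∀ᵐ z, ‖g z‖ ≤ Real.exp (φ z).toReal * d z) (z : ℂ) :
    ‖g z‖ₑ ≤ EReal.exp (φ z) * ENNReal.ofReal (d z) := by
  rw [← ofReal_norm]
  refine ennreal_le_exp_mul (hφ.ne_top z) fun y hy => ?_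
  by_contra! hcon
  have h1 : ∀ᶠ w in 𝓝 z, φ w < y ∧ Real.exp y * d w < ‖g w‖ :=
    (hφ.upperSemicontinuous z y hy).and
      ((continuous_const.mul hd).continuousAt.eventually_lt hg.norm.continuousAt hcon)
  obtain ⟨U, hU, hUo, hzU⟩ := _root_.eventually_nhds_iff.1 h1
  obtain ⟨w, hw, hwU⟩ := (Measure.dense_of_ae (h.and hfin)).exists_mem_open hUo ⟨z, hzU⟩
  obtain ⟨h2, h3⟩ := hU w hwU
  obtain ⟨h4, h5, h6⟩ := hw
  have h7 : (φ w).toReal ≤ y := by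
    rw [← EReal.coe_le_coe_iff, EReal.coe_toReal h5 h6]
    exact h2.le
  have h8 : Real.exp (φ w).toReal * d w ≤ Real.exp y * d w :=
    mul_le_mul_of_nonneg_right (Real.exp_le_exp.2 h7) (hd0 w)
  linarith

/-- The sub-mean value inequality turns a lower bound by `exp φ` almost everywhere into one
everywhere. -/
theorem IsSubharmonic.exp_mul_le_of_ae_le {φ : ℂ → EReal} (hφ : IsSubharmonic φ)
    (hfin : ∀ᵐ z, φ z ≠ ⊤ ∧ φ z ≠ ⊥) {g : ℂ → ℂ} (hg : Continuous g) {d : ℂ → ℝ}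
    (hd : Continuous d) (hd0 : ∀ z, 0 ≤ d z) (hd1 : ∀ᵐ z, 0 < d z) (hgd : ∀ z, g z = 0 → d z = 0)
    (h : ∀ᵐ z, Real.exp (φ z).toReal * d z ≤ ‖g z‖) (z : ℂ) :
    EReal.exp (φ z) * ENNReal.ofReal (d z) ≤ ‖g z‖ₑ := by
  rcases (hd0 z).eq_or_lt with hz | hz
  · rw [← hz]; simp
  have hg0 : 0 < ‖g z‖ := norm_pos_iff.2 fun h0 => hz.ne' (hgd z h0)
  have hs : ContinuousAt (fun w => Real.log ‖g w‖ - Real.log (d w)) z :=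
    (hg.norm.continuousAt.log hg0.ne').sub (hd.continuousAt.log hz.ne')
  have h1 := hφ.le_of_ae_le hs (by
    filter_upwards [h, hfin, hd1] with w hw hwf hwd
    have h2 : 0 < ‖g w‖ := lt_of_lt_of_le (by positivity) hw
    rw [← EReal.coe_toReal hwf.1 hwf.2, EReal.coe_le_coe_iff,
      ← Real.log_div h2.ne' hwd.ne', Real.le_log_iff_exp_le (by positivity), le_div_iff₀ hwd]
    exact hw)
  rw [← Real.log_div hg0.ne' hz.ne'] at h1
  calc EReal.exp (φ z) * ENNReal.ofReal (d z)
      ≤ EReal.exp (Real.log (‖g z‖ / d z) : ℝ) * ENNReal.ofReal (d z) := by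
        gcongr
    _ = ‖g z‖ₑ := by
        rw [EReal.exp_coe, Real.exp_log (by positivity), ← ENNReal.ofReal_mul (by positivity),
          div_mul_cancel₀ _ hz.ne', ofReal_norm]

end Everywhere

/-! ### Comparison of the compensating potential with the distance to the points -/

section Comparison

variable {μ : Measure ℂ} [IsLocallyFiniteMeasure μ] {C q : ℝ}

/-- For a closed set that is dense at the scale `rho`, the distance to the set in the metric
`rhoDist` is comparable to the Euclidean distance divided by `rho`. -/
theorem DoublingBounds.exists_rhoInfDist_comparable (B : DoublingBounds μ C q) {S : Set ℂ}
    (hS : S.Nonempty) (hSc : IsClosed S) {M : ℝ} (hM0 : 0 < M)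
    (hM : ∀ z, infDist z S ≤ M * rho μ z) :
    ∃ K : ℝ, 1 ≤ K ∧ ∀ z, rhoInfDist μ z S ≤ ENNReal.ofReal (K * (infDist z S / rho μ z)) ∧
      ENNReal.ofReal (infDist z S / rho μ z) ≤ ENNReal.ofReal K * rhoInfDist μ z S := by
  obtain ⟨K', hK', h⟩ := B.exists_rhoDist_le M
  refine ⟨K' + (1 + M), by linarith, fun z => ⟨?_, ?_⟩⟩
  · obtain ⟨a, ha, hd⟩ := hSc.exists_infDist_eq_dist hS z
    have hz := B.rho_pos z
    have h0 : 0 ≤ infDist z S / rho μ z := div_nonneg infDist_nonneg hz.le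
    refine (iInf₂_le a ha).trans ((h z a (hd ▸ hM z)).trans (ENNReal.ofReal_le_ofReal ?_))
    rw [← hd]
    gcongr
    linarith
  · have hz := B.rho_pos z
    have ht : 0 ≤ infDist z S := infDist_nonneg
    have h1 : ENNReal.ofReal (infDist z S / rho μ z / (K' + (1 + M))) ≤ rhoInfDist μ z S := by
      refine le_iInf₂ fun a ha => le_trans (ENNReal.ofReal_le_ofReal ?_) (B.le_rhoDist z a)
      have h2 := infDist_le_dist_of_mem ha (x := z)
      have h3 : 0 ≤ dist z a := dist_nonneg
      calc infDist z S / rho μ z / (K' + (1 + M)) ≤ infDist z S / (rho μ z + infDist z S) := by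
            rw [div_div]
            gcongr
            have := hM z
            nlinarith
        _ ≤ dist z a / (rho μ z + dist z a) := by
            rcases ht.eq_or_lt with h0 | h0
            · rw [← h0, zero_div]; positivity
            · rw [div_le_div_iff₀ (by positivity) (by positivity)]
              nlinarith
    calc ENNReal.ofReal (infDist z S / rho μ z)
        = ENNReal.ofReal (K' + (1 + M)) *
            ENNReal.ofReal (infDist z S / rho μ z / (K' + (1 + M))) := by
          rw [← ENNReal.ofReal_mul (by linarith), mul_div_cancel₀ _ (by linarith)]
      _ ≤ _ := by gcongr

variable {c : ℕ → ℂ} {ν : ℕ → Measure ℂ} {x : ℕ → Fin 3 → ℂ} {L A δ : ℝ}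

/-- The points of the pieces are dense at the scale `rho`, since every disc of radius `rho` is
charged by some piece. -/
theorem DoublingBounds.exists_infDist_le (B : DoublingBounds μ C q) (P : Pieces μ c ν x L A δ) :
    ∃ M : ℝ, 0 < M ∧ ∀ z, infDist z {w | ∃ k i, w = x k i} ≤ M * rho μ z := by
  have hL := P.one_le
  obtain ⟨K, hK1, hK⟩ := B.exists_comparable (1 + L)
  refine ⟨1 + 2 * L * K, by positivity, fun z => ?_⟩
  have hz := B.rho_pos z
  obtain ⟨k, hk⟩ : ∃ k, ν k (ball z (rho μ z)) ≠ 0 := by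
    by_contra! hcon
    have h1 := B.measure_ball_rho z
    have h2 : Measure.sum ν (ball z (rho μ z)) = 0 := by
      rw [Measure.sum_apply _ measurableSet_ball]; simp [hcon]
    rw [P.sum_eq] at h2
    rw [Measure.real, h2] at h1
    simp at h1
  obtain ⟨w, hw, hwk⟩ : ∃ w ∈ ball z (rho μ z), w ∈ closedBall (c k) (L * rho μ (c k)) := by
    by_contra! hcon
    exact hk (measure_mono_null hcon (P.supp k))
  have hk0 := B.rho_pos (c k)
  have h1 : dist z (c k) ≤ rho μ z + L * rho μ (c k) := by
    have h2 : dist w z < rho μ z := hw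
    have h3 : dist w (c k) ≤ L * rho μ (c k) := hwk
    have := dist_triangle_left z (c k) w
    linarith
  have h2 : rho μ (c k) ≤ K * rho μ z := by
    apply hK
    rw [dist_comm, max_comm]
    refine h1.trans ?_
    have h3 := le_max_left (rho μ z) (rho μ (c k))
    have h4 : L * rho μ (c k) ≤ L * max (rho μ z) (rho μ (c k)) := by
      gcongr; exact le_max_right _ _
    linarith
  calc infDist z {w | ∃ k i, w = x k i} ≤ dist z (x k 0) := infDist_le_dist_of_mem ⟨k, 0, rfl⟩
    _ ≤ dist z (c k) + dist (x k 0) (c k) := dist_triangle_right _ _ _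
    _ ≤ (rho μ z + L * rho μ (c k)) + L * rho μ (c k) := add_le_add h1 (P.loc k 0)
    _ = rho μ z + 2 * L * rho μ (c k) := by ring
    _ ≤ rho μ z + 2 * L * (K * rho μ z) := by gcongr
    _ = (1 + 2 * L * K) * rho μ z := by ring

/-- The separation of the points at the scale of their pieces is a separation at the scale `rho`, as
`rho` at a point is at most a multiple of `rho` at the centre of its piece. -/
theorem DoublingBounds.isRhoSeparated (B : DoublingBounds μ C q) (P : Pieces μ c ν x L A δ) :
    IsRhoSeparated μ {w | ∃ k i, w = x k i} := by
  have hL := P.one_le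
  have hδ := P.pos
  have hx : ∀ k i, rho μ (x k i) ≤ (1 + L) * rho μ (c k) := by
    intro k i
    have h1 := B.rho_le_add (x k i) (c k)
    have h2 := P.loc k i
    linarith
  refine ⟨δ / (1 + L), by positivity, ?_⟩
  rintro _ ⟨k, i, rfl⟩ _ ⟨l, j, rfl⟩ hne
  have h1 := P.sep k i l j fun h => hne (by rw [(Prod.mk.inj h).1, (Prod.mk.inj h).2])
  have hk := B.rho_pos (c k)
  rw [← dist_eq_norm]
  refine le_trans ?_ h1
  have h2 : max (rho μ (x k i)) (rho μ (x l j)) ≤ (1 + L) * max (rho μ (c k)) (rho μ (c l)) := by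
    apply max_le
    · exact (hx k i).trans (by gcongr; exact le_max_left _ _)
    · exact (hx l j).trans (by gcongr; exact le_max_right _ _)
  calc δ / (1 + L) * max (rho μ (x k i)) (rho μ (x l j))
      ≤ δ / (1 + L) * ((1 + L) * max (rho μ (c k)) (rho μ (c l))) := by gcongr
    _ = δ * max (rho μ (c k)) (rho μ (c l)) := by field_simp

/-- Up to a bounded term, the compensating potential is the logarithm of the distance to the nearest
point, truncated at the scale of its piece: by separation every other point is at a distance bounded
below in units of its own scale, and all but boundedly many are beyond their scale. -/
theorem DoublingBounds.exists_abs_potentialSum_sub_le (B : DoublingBounds μ C q)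
    (P : Pieces μ c ν x L A δ) :
    ∃ E : ℝ, 0 < E ∧ ∀ z, (∀ k i, z ≠ x k i) → ∀ k₀ i₀,
      (∀ k i, dist z (x k₀ i₀) ≤ dist z (x k i)) →
      |potentialSum ν x z - Real.log (min 1 (dist z (x k₀ i₀) / rho μ (c k₀)))| ≤ E := by
  have hL := P.one_le
  have hδ := P.pos
  obtain ⟨A', hA', hu⟩ := B.exists_abs_potentialDiff_sub_le P
  obtain ⟨N, hN⟩ := B.exists_card_le P.decay (1 + L)
  have hA : 0 < A + 1 := ((B.pieceBound_pos c 0 0).trans_le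
    ((P.summable_pieceBound 0).1.le_tsum 0 fun k _ => (B.pieceBound_pos c k 0).le)).trans_le
    (P.summable_pieceBound 0).2
  set ε : ℝ := min 1 (δ / 2) with hε
  have hε0 : 0 < ε := by positivity
  have hlogε : Real.log ε ≤ 0 := Real.log_nonpos hε0.le (min_le_left _ _)
  refine ⟨A' * (A + 1) + N * (3 * -Real.log ε), add_pos_of_pos_of_nonneg (by positivity)
    (mul_nonneg N.cast_nonneg (by linarith)), fun z hz k₀ i₀ hmin => ?_⟩
  have hρ : ∀ k, 0 < rho μ (c k) := fun k => B.rho_pos (c k)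
  have hd : ∀ k i, 0 < dist z (x k i) := fun k i => dist_pos.2 (hz k i)
  set ℓ : ℕ → ℝ := fun k => localLog (rho μ (c k)) (x k) z with hℓ
  set m : ℕ → Fin 3 → ℝ := fun k i => min 1 (dist z (x k i) / rho μ (c k)) with hm
  have hm0 : ∀ k i, 0 < m k i := fun k i => lt_min one_pos (div_pos (hd k i) (hρ k))
  have hm1 : ∀ k i, Real.log (m k i) ≤ 0 := fun k i =>
    Real.log_nonpos (hm0 k i).le (min_le_left _ _)
  have hℓm : ∀ k, ℓ k = ∑ i, Real.log (m k i) := fun k => by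
    simp only [hℓ, hm, localLog, dist_eq_norm]
  have hℓ0 : ∀ k, ℓ k ≤ 0 := fun k => by
    rw [hℓm]; exact Finset.sum_nonpos fun i _ => hm1 k i
  obtain ⟨F, hF⟩ := B.exists_finset_far P (‖z‖ + 1)
  have hℓF : ∀ k ∉ F, ℓ k = 0 := fun k hk =>
    localLog_eq_zero (hρ k) (hF k hk z (by simp))
  have hsum : HasSum ℓ (∑ k ∈ F, ℓ k) := hasSum_sum_of_ne_finset_zero hℓF
  -- the difference of the two potentials
  have h1 : |potentialSum ν x z - ∑ k ∈ F, ℓ k| ≤ A' * (A + 1) := by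
    have h2 := (B.summable_potentialDiff P z).hasSum.sub hsum
    have h3 := (P.summable_pieceBound z).1.mul_left A'
    rw [potentialSum, ← h2.tsum_eq, ← Real.norm_eq_abs]
    refine (tsum_of_norm_bounded h3.hasSum fun k => hu k z (hz k)).trans ?_
    rw [tsum_mul_left]
    gcongr
    exact (P.summable_pieceBound z).2
  have h2 : ∑ k ∈ F, ℓ k ≤ Real.log (m k₀ i₀) := by
    have h3 := le_hasSum hsum.neg k₀ fun j _ => neg_nonneg.2 (hℓ0 j)
    have h4 : ℓ k₀ ≤ Real.log (m k₀ i₀) := by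
      rw [hℓm, ← neg_le_neg_iff, ← Finset.sum_neg_distrib]
      exact Finset.single_le_sum (f := fun i => -Real.log (m k₀ i))
        (fun i _ => neg_nonneg.2 (hm1 k₀ i)) (Finset.mem_univ i₀)
    linarith
  have h3 : N * (3 * Real.log ε) + Real.log (m k₀ i₀) ≤ ∑ k ∈ F, ℓ k := by
    classical
    set S := F.filter fun k => dist z (c k) ≤ (1 + L) * rho μ (c k) with hS
    have hSF : ∑ k ∈ S, ℓ k = ∑ k ∈ F, ℓ k := by
      refine Finset.sum_subset (Finset.filter_subset _ _) fun k hk hkS => ?_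
      refine localLog_eq_zero (hρ k) fun i => ?_
      have h4 : (1 + L) * rho μ (c k) < dist z (c k) := by
        by_contra! hcon
        exact hkS (Finset.mem_filter.2 ⟨hk, hcon⟩)
      rw [← dist_eq_norm]
      have := dist_triangle z (x k i) (c k)
      have := P.loc k i
      linarith
    have hcard : S.card ≤ N := by
      refine hN z S fun k hk => (Finset.mem_filter.1 hk).2.trans ?_
      gcongr
      exact le_max_right _ _
    have hterm : ∀ k i, Real.log ε + (if k = k₀ ∧ i = i₀ then Real.log (m k₀ i₀) else 0) ≤
        Real.log (m k i) := by
      intro k i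
      split_ifs with h
      · rw [h.1, h.2]; linarith
      · rw [add_zero]
        apply Real.log_le_log hε0
        apply min_le_min le_rfl
        -- as `z` is no farther from the nearest point than from `x k i`, its distance to `x k i` is at
        -- least half the distance between these two points
        have h4 := P.sep k i k₀ i₀ fun h' => h ⟨(Prod.mk.inj h').1, (Prod.mk.inj h').2⟩
        have h5 : δ * rho μ (c k) ≤ δ * max (rho μ (c k)) (rho μ (c k₀)) := by
          gcongr; exact le_max_left _ _
        have h6 := dist_triangle_left (x k i) (x k₀ i₀) z
        have h7 := hmin k i
        rw [le_div_iff₀ (hρ k)]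
        linarith
    have hpiece : ∀ k, 3 * Real.log ε + (if k = k₀ then Real.log (m k₀ i₀) else 0) ≤ ℓ k := by
      intro k
      rw [hℓm]
      refine le_trans (le_of_eq ?_) (Finset.sum_le_sum fun i _ => hterm k i)
      rw [Finset.sum_add_distrib]
      by_cases hk : k = k₀ <;> simp [hk]
    rw [← hSF]
    refine le_trans ?_ (Finset.sum_le_sum fun k _ => hpiece k)
    rw [Finset.sum_add_distrib, Finset.sum_const, nsmul_eq_mul, Finset.sum_ite_eq']
    apply add_le_add
    · exact mul_le_mul_of_nonpos_right (by exact_mod_cast hcard) (by linarith)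
    · split_ifs
      · exact le_rfl
      · exact hm1 _ _
  have h4 := abs_le.1 h1
  have h5 : 0 ≤ A' * (A + 1) := by positivity
  have h6 : (N:ℝ) * (3 * Real.log ε) ≤ 0 :=
    mul_nonpos_of_nonneg_of_nonpos N.cast_nonneg (by linarith)
  rw [abs_le]
  constructor <;> linarith [h4.1, h4.2]

/-- Off the points, the exponential of the compensating potential is comparable to the distance to
the points in units of `rho`. -/
theorem DoublingBounds.exists_exp_potentialSum_comparable (B : DoublingBounds μ C q)
    (P : Pieces μ c ν x L A δ) (hclosed : IsClosed {w | ∃ k i, w = x k i}) :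
    ∃ K : ℝ, 0 < K ∧ ∀ z, (∀ k i, z ≠ x k i) →
      Real.exp (potentialSum ν x z) ≤ K * (infDist z {w | ∃ k i, w = x k i} / rho μ z) ∧
      infDist z {w | ∃ k i, w = x k i} / rho μ z ≤ K * Real.exp (potentialSum ν x z) := by
  have hL := P.one_le
  obtain ⟨M, hM0, hM⟩ := B.exists_infDist_le P
  obtain ⟨E, hE0, hE⟩ := B.exists_abs_potentialSum_sub_le P
  obtain ⟨K, hK1, hK⟩ := B.exists_comparable (M + L)
  refine ⟨(K + M) * Real.exp E, by positivity, fun z hz => ?_⟩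
  obtain ⟨a, ⟨k, i, rfl⟩, hd⟩ := hclosed.exists_infDist_eq_dist ⟨x 0 0, 0, 0, rfl⟩ z
  have hz0 := B.rho_pos z
  have hk0 := B.rho_pos (c k)
  have ht : 0 < dist z (x k i) := dist_pos.2 (hz k i)
  have htM : dist z (x k i) ≤ M * rho μ z := hd ▸ hM z
  have h1 := abs_le.1 (hE z hz k i fun l j => hd ▸ infDist_le_dist_of_mem ⟨l, j, rfl⟩)
  rw [hd]
  set t := dist z (x k i)
  have h2 : dist z (c k) ≤ (M + L) * max (rho μ z) (rho μ (c k)) := by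
    have h3 := dist_triangle z (x k i) (c k)
    have h4 := P.loc k i
    have h5 : M * rho μ z ≤ M * max (rho μ z) (rho μ (c k)) := by
      gcongr; exact le_max_left _ _
    have h6 : L * rho μ (c k) ≤ L * max (rho μ z) (rho μ (c k)) := by
      gcongr; exact le_max_right _ _
    linarith
  have h3 : rho μ z ≤ K * rho μ (c k) := hK _ _ h2
  have h4 : rho μ (c k) ≤ K * rho μ z := hK _ _ (by rwa [dist_comm, max_comm])
  have hm0 : 0 < min 1 (t / rho μ (c k)) := lt_min one_pos (by positivity)
  constructor
  · calc Real.exp (potentialSum ν x z)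
        ≤ Real.exp (Real.log (min 1 (t / rho μ (c k))) + E) := by
          apply Real.exp_le_exp.2; linarith [h1.2]
      _ = min 1 (t / rho μ (c k)) * Real.exp E := by rw [Real.exp_add, Real.exp_log hm0]
      _ ≤ ((K + M) * (t / rho μ z)) * Real.exp E := by
          gcongr
          refine (min_le_right _ _).trans ?_
          rw [mul_div_assoc', div_le_div_iff₀ hk0 hz0]
          have h5 : t * rho μ z ≤ t * (K * rho μ (c k)) := by gcongr
          have h6 : 0 ≤ M * t * rho μ (c k) := by positivity
          linarith
      _ = _ := by ring
  · calc t / rho μ z ≤ (K + M) * min 1 (t / rho μ (c k)) := by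
          rw [mul_min_of_nonneg _ _ (by positivity)]
          apply le_min
          · rw [div_le_iff₀ hz0]
            have : 0 ≤ K * rho μ z := by positivity
            linarith
          · rw [mul_div_assoc', div_le_div_iff₀ hz0 hk0]
            have h5 : t * rho μ (c k) ≤ t * (K * rho μ z) := by gcongr
            have h6 : 0 ≤ M * t * rho μ z := by positivity
            linarith
      _ = (K + M) * Real.exp (Real.log (min 1 (t / rho μ (c k)))) := by rw [Real.exp_log hm0]
      _ ≤ (K + M) * Real.exp (E + potentialSum ν x z) := by
          gcongr
          linarith [h1.1]
      _ = _ := by rw [Real.exp_add]; ring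

end Comparison

end FockMultiplier
end

theorem mainTheorem5 (φ : ℂ → EReal) (μ : MeasureTheory.Measure ℂ)
    (hφ : FockMultiplier.IsSubharmonic φ)
    (hμ : FockMultiplier.HasDistribLaplacian φ μ)
    (hdoubling : FockMultiplier.IsDoubling μ) (hμ0 : μ ≠ 0) (z₀ : ℂ) :
    ∃ g : ℂ → ℂ, Differentiable ℂ g ∧
      FockMultiplier.IsRhoSeparated μ {z | g z = 0} ∧
      (⨆ z : ℂ, FockMultiplier.rhoInfDist μ z {w | g w = 0}) < ⊤ ∧
      (∃ C : ℝ≥0, ∀ z : ℂ,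
        ‖g z‖ₑ ≤ C * (EReal.exp (φ z) * FockMultiplier.rhoInfDist μ z {w | g w = 0}) ∧
        EReal.exp (φ z) * FockMultiplier.rhoInfDist μ z {w | g w = 0} ≤ C * ‖g z‖ₑ) ∧
      g z₀ = 0 := by
  have hfin := hμ.isLocallyFiniteMeasure
  obtain ⟨C, q, B⟩ := hdoubling.exists_bounds hμ0
  obtain ⟨c, ν, x, L, A, δ, P, hx⟩ := B.exists_pieces z₀
  obtain ⟨g, hg, hgφ, hg0⟩ := B.exists_entire P hμ
  have hΛ : {w | ∃ k i, w = x k i} = {w | g w = 0} := by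
    ext w; exact (hg0 w).symm
  have hclosed : IsClosed {w | g w = 0} := isClosed_eq hg.continuous continuous_const
  have hne : {w | g w = 0}.Nonempty := ⟨x 0 0, (hg0 _).2 ⟨0, 0, rfl⟩⟩
  obtain ⟨M, hM0, hM⟩ := B.exists_infDist_le P
  obtain ⟨K, hK0, hK⟩ := B.exists_exp_potentialSum_comparable P (hΛ ▸ hclosed)
  have hsep := B.isRhoSeparated P
  simp only [hΛ] at hM hK hsep
  obtain ⟨K₁, hK₁, hdist⟩ := B.exists_rhoInfDist_comparable hne hclosed hM0 hM
  have hρ := B.rho_pos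
  set d : ℂ → ℝ := fun z => infDist z {w | g w = 0} / FockMultiplier.rho μ z with hd
  have hdc : Continuous d :=
    (continuous_infDist_pt _).div B.continuous_rho fun z => (hρ z).ne'
  have hd0 : ∀ z, 0 ≤ d z := fun z => div_nonneg infDist_nonneg (hρ z).le
  have hae := FockMultiplier.ae_ne_points x
  have hdpos : ∀ᵐ z, 0 < d z := by
    filter_upwards [hae] with z hz
    refine div_pos ((hclosed.notMem_iff_infDist_pos hne).1 fun h => ?_) (hρ z)
    obtain ⟨k, i, h⟩ := (hg0 z).1 h
    exact hz k i h
  have hupper : ∀ z, ‖g z‖ₑ ≤ EReal.exp (φ z) * ENNReal.ofReal (K * d z) := by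
    refine hφ.norm_le_of_ae_le hμ.ae_finite hg.continuous (continuous_const.mul hdc)
      (fun z => mul_nonneg hK0.le (hd0 z)) ?_
    filter_upwards [hgφ, hae] with z h1 h2
    rw [h1, Real.exp_add]
    gcongr
    exact (hK z h2).1
  have hlower : ∀ z, EReal.exp (φ z) * ENNReal.ofReal (K⁻¹ * d z) ≤ ‖g z‖ₑ := by
    refine hφ.exp_mul_le_of_ae_le hμ.ae_finite hg.continuous (continuous_const.mul hdc)
      (fun z => mul_nonneg (inv_nonneg.2 hK0.le) (hd0 z)) ?_ (fun z hz => ?_) ?_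
    · filter_upwards [hdpos] with z hz using mul_pos (inv_pos.2 hK0) hz
    · rw [hd]
      simp only
      rw [infDist_zero_of_mem (show z ∈ {w | g w = 0} from hz), zero_div, mul_zero]
    · filter_upwards [hgφ, hae] with z h1 h2
      rw [h1, Real.exp_add]
      gcongr
      rw [inv_mul_le_iff₀ hK0]
      exact (hK z h2).2
  refine ⟨g, hg, hsep, ?_, ⟨(K * K₁).toNNReal, fun z => ⟨?_, ?_⟩⟩, (hg0 z₀).2 ⟨0, 0, hx.symm⟩⟩
  · refine lt_of_le_of_lt (iSup_le fun z => (hdist z).1.trans (ENNReal.ofReal_le_ofReal ?_))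
      (ENNReal.ofReal_lt_top (r := K₁ * M))
    gcongr
    rw [div_le_iff₀ (hρ z)]
    exact hM z
  · calc ‖g z‖ₑ ≤ EReal.exp (φ z) * ENNReal.ofReal (K * d z) := hupper z
      _ = EReal.exp (φ z) * (ENNReal.ofReal K * ENNReal.ofReal (d z)) := by
          rw [ENNReal.ofReal_mul hK0.le]
      _ ≤ EReal.exp (φ z) * (ENNReal.ofReal K * (ENNReal.ofReal K₁ *
            FockMultiplier.rhoInfDist μ z {w | g w = 0})) := by
          gcongr
          exact (hdist z).2
      _ = ENNReal.ofReal (K * K₁) *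
            (EReal.exp (φ z) * FockMultiplier.rhoInfDist μ z {w | g w = 0}) := by
          rw [ENNReal.ofReal_mul hK0.le]; ring
  · calc EReal.exp (φ z) * FockMultiplier.rhoInfDist μ z {w | g w = 0}
        ≤ EReal.exp (φ z) * ENNReal.ofReal (K₁ * d z) := by
          gcongr
          exact (hdist z).1
      _ = ENNReal.ofReal (K * K₁) * (EReal.exp (φ z) * ENNReal.ofReal (K⁻¹ * d z)) := by
          rw [mul_left_comm, ← ENNReal.ofReal_mul (by positivity)]
          congr 2
          field_simp
      _ ≤ ENNReal.ofReal (K * K₁) * ‖g z‖ₑ := by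
          gcongr
          exact hlower z
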